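/- For odd $m\in\mathbb Z$ and $\alpha\in\mathbb Z[i]$, let $\left(\frac{\alpha}{m}\right)_4$ be the quartic Jacobi symbol: the product, over the prime factors $\pi$ of $m$ in $\mathbb Z[i]$ counted with multiplicity, of the quartic residue symbols $\left(\frac{\alpha}{\pi}\right)_4$, where $\left(\frac{\alpha}{\pi}\right)_4=0$ if $\pi\mid\alpha$, and otherwise $\left(\frac{\alpha}{\pi}\right)_4\in\{1,i,-1,-i\}$ is determined by $\left(\frac{\alpha}{\pi}\right)_4\equiv\alpha^{(N\pi-1)/4}\pmod\pi$; it is $1$ if $m=\pm1$. For a rational number $a$ with denominator prime to $m$ put $\left(\frac{a+i}{m}\right)_4=\left(\frac{n+i}{m}\right)_4$, where $n$ is any integer with $n\equiv a\pmod m$. **Theorem 3.2.** Let $p\equiv1\pmod 4$ be a prime and let $q\in\mathbb Z$ (of either sign) with $2\nmid q$ and $p\nmid q$. Suppose that $p=c^2+d^2=x^2+qy^2$ with $c,d,x,y\in\mathbb Z$, $c\equiv1\pmod4$, $d=2^rd_0$, $y=2^ty_0$ with integers $r,t\ge0$ and $d_0\equiv y_0\equiv1\pmod4$, $(c,x+d)=1$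 and $2\nmid x$. Let $k\in\mathbb Z$ be such that (note that these hypotheses force $x+d$ to be prime to $q$) $$\left(\frac{\frac{c}{x+d}+i}{q}\right)_4=i^k .$$ (i) If $p\equiv1\pmod8$, then $$q^{\frac{p-1}8}\equiv\begin{cases}(-1)^{\frac{q-1}8+\frac d4+\frac y4}\left(\frac dc\right)^k\pmod p&\text{if }q\equiv1\pmod8,\\(-1)^{\frac{q+5}8+\frac{x-1}2+\frac y4}\left(\frac dc\right)^{k-1}\pmod p&\text{if }q\equiv3\pmod8,\\(-1)^{\frac{q-5}8+\frac d4+\frac{x-1}2+\frac y4}\left(\frac dc\right)^{k-1}\pmod p&\text{if }q\equiv5\pmod8,\\(-1)^{\frac{q+1}8+\frac y4}\left(\frac dc\right)^k\pmod p&\text{if }q\equiv7\pmod8.\end{cases}$$ (ii) If $p\equiv5\pmod8$, then $$q^{\frac{p-5}8}\equiv\begin{cases}(-1)^{\frac{q-1}8+\frac{x-1}2}\left(\frac dc\right)^{k-1}\frac yx\pmod p&\text{if }q\equiv1\pmod8,\\(-1)^{\frac{q+5}8}\left(\frac dc\right)^{k-1}\frac yx\pmod p&\text{if }q\equiv3\pmod8,\\(-1)^{\frac{q+3}8}\left(\frac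 dc\right)^k\frac yx\pmod p&\text{if }q\equiv5\pmod8,\\(-1)^{\frac{q+1}8+\frac{x-1}2}\left(\frac dc\right)^k\frac yx\pmod p&\text{if }q\equiv7\pmod8.\end{cases}$$ Here $\frac dc$ and $\frac yx$ in the congruences are ordinary fractions, read modulo $p$ ($p\nmid c$ and $p\nmid x$). -/

import Mathlib

/-- The quartic residue symbol `(α/π)₄` for a Gaussian prime `π` not dividing `2`:
it is `0` if `π ∣ α`, and otherwise it is the unique fourth root of unity `u ∈ {1, i, -1, -i}`
with `α ^ ((N π - 1) / 4) ≡ u (mod π)`. -/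
noncomputable def quarticResidueSymbol (α π : GaussianInt) : GaussianInt :=
  open Classical in
  if π ∣ α then 0
  else if π ∣ α ^ ((π.norm.natAbs - 1) / 4) - 1 then 1
  else if π ∣ α ^ ((π.norm.natAbs - 1) / 4) - ⟨0, 1⟩ then ⟨0, 1⟩
  else if π ∣ α ^ ((π.norm.natAbs - 1) / 4) - (-1) then -1
  else ⟨0, -1⟩

/-- The quartic Jacobi symbol `(α/β)₄` for a Gaussian integer `β` prime to `2`: the product of the
quartic residue symbols `(α/π)₄` over the prime factors `π` of `β`, with multiplicity.
It is `1` if `β` is a unit. The symbol `(α/π)₄` depends only on the ideal generated by `π`, so the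
choice of the prime factors up to units does not matter. -/
noncomputable def quarticJacobiSymbol (α β : GaussianInt) : GaussianInt :=
  ((UniqueFactorizationMonoid.factors β).map (quarticResidueSymbol α)).prod

/-- For a nonzero integer `m` and a rational number `a` whose denominator is prime to `m`,
an integer congruent to `a` modulo `m`. -/
def ratResidue (m : ℤ) (a : ℚ) : ℤ :=
  ((a.num : ZMod m.natAbs) * (a.den : ZMod m.natAbs)⁻¹).valMinAbs

/-- The defining property of `ratResidue`. -/
theorem ratResidue_spec (m : ℤ) (a : ℚ) (h : Nat.Coprime a.den m.natAbs) :
    m ∣ ratResidue m a * a.den - a.num := by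
  have hu : (a.den : ZMod m.natAbs) * (a.den : ZMod m.natAbs)⁻¹ = 1 :=
    ZMod.coe_mul_inv_eq_one a.den h
  rw [← Int.natAbs_dvd, ← ZMod.intCast_zmod_eq_zero_iff_dvd]
  push_cast
  unfold ratResidue
  rw [ZMod.coe_valMinAbs]
  linear_combination (a.num : ZMod m.natAbs) * hu

/-- The quartic Jacobi symbol `((a + b i)/m)₄` for an odd integer `m` and rational numbers `a`, `b`
whose denominators are prime to `m`: the numbers `a` and `b` are replaced by integers congruent to
them modulo `m`. -/
noncomputable def quarticJacobiSymbolRat (a b : ℚ) (m : ℤ) : GaussianInt :=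
  quarticJacobiSymbol ⟨ratResidue m a, ratResidue m b⟩ ⟨m, 0⟩

/-! Put `π = c + di`, a Gaussian prime of norm `p`, and `s = x + d`, `γ = c + si`. Modulo `p` one
has `q ≡ -(x/y)²`, so the required power of `q` is known once `(x/y)^((p-1)/4)` is. That power is
the reduction modulo `π` of `(x/π)₄ (y/π)₄⁻¹`, and `i` reduces to `d/c`. Since `(s/q)₄ = 1`, the
hypothesis on `k` says `(γ/q)₄ = i^k`. Everything thus rests on `jacobiUnit_div_eq`, an identity
`(x/π)₄ (y/π)₄⁻¹ = (γ/q)₄ i^E` with explicit `E`.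

The bridge between the two sides is the norm of `γ`: the two representations of `p` give `c² + s² =
qy² + 2sx`. Both `c` and `s` are odd, so `γ = (1+i)δ` with `δ = A + Bi` of odd norm, and `qy² ≡ -2sx
(mod δ)`. Taking symbols over `δ` and inverting each of them by reciprocity (`jacobiUnit_relation`):
`(q/δ)₄` leads to `(γ/q)₄`; `(s/δ)₄` to `(γ/s)₄ = (c/s)₄ = 1`; `(x/δ)₄` to `(γ/x)₄ = (π/x)₄`, hence
to `(x/π)₄`; and `(y₀/δ)₄²` to `(γ²/y₀)₄`, where `γ² ≡ 2siπ (mod y₀)`, hence to `(y₀/π)₄`. The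
symbols of `-1`, `i`, `1 + i` and `2` account for `E`, whose residue modulo 4 is found in
`quotientExponent_of_mod_eight_eq_one` and `quotientExponent_of_mod_eight_eq_five`.

Reciprocity between an odd rational integer and a Gaussian integer with even imaginary part
(`jacobiUnit_reciprocity`) comes from Gauss sums. For a prime `π` of prime norm `p` and `χ =
(·/π)₄`, the Jacobi sum `J = J(χ, χ)` is an associate of `π` with even imaginary part, and the Gauss
sum satisfies `g⁴ = J²p = J³J̄`. In characteristic `l`, Frobenius evaluates `g^(l-1)` or `g^(l+1)`
through `χ(±l)`; comparison gives the symbol of `J` modulo `l`. -/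

namespace GaussianInt

/-! ### Units of `ℤ[i]`. -/

/-- The imaginary unit as a unit of `ℤ[i]`. -/
def unitI : GaussianIntˣ := ⟨⟨0, 1⟩, ⟨0, -1⟩, by decide, by decide⟩

@[simp] theorem coe_unitI : (unitI : GaussianInt) = ⟨0, 1⟩ := rfl

theorem coe_unitI_inv : ((unitI⁻¹ : GaussianIntˣ) : GaussianInt) = ⟨0, -1⟩ := rfl

theorem unitI_sq : unitI ^ 2 = -1 := by
  ext <;> rfl

theorem unitI_pow_four : unitI ^ 4 = 1 := by
  ext <;> rfl

theorem unitI_zpow_congr {a b : ℤ} (h : a ≡ b [ZMOD 4]) : unitI ^ a = unitI ^ b := by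
  obtain ⟨t, ht⟩ := h.dvd
  obtain rfl : b = a + 4 * t := by linarith
  have h4 : unitI ^ (4 : ℤ) = 1 := unitI_pow_four
  rw [zpow_add, zpow_mul, h4, one_zpow, mul_one]

theorem unit_cases (u : GaussianIntˣ) :
    (u : GaussianInt) = 1 ∨ (u : GaussianInt) = ⟨0, 1⟩ ∨ (u : GaussianInt) = -1 ∨
      (u : GaussianInt) = ⟨0, -1⟩ := by
  have h : (u : GaussianInt).norm = 1 :=
    (Zsqrtd.norm_eq_one_iff' (by norm_num) _).2 u.isUnit
  rcases hu : (u : GaussianInt) with ⟨a, b⟩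
  rw [hu, Zsqrtd.norm_def] at h
  dsimp only at h
  have ha : -1 ≤ a ∧ a ≤ 1 := ⟨by nlinarith [mul_self_nonneg b], by nlinarith [mul_self_nonneg b]⟩
  have hb : -1 ≤ b ∧ b ≤ 1 := ⟨by nlinarith [mul_self_nonneg a], by nlinarith [mul_self_nonneg a]⟩
  obtain ⟨ha1, ha2⟩ := ha
  obtain ⟨hb1, hb2⟩ := hb
  interval_cases a <;> interval_cases b <;> simp_all [Zsqrtd.ext_iff]

theorem exists_unitI_zpow (u : GaussianIntˣ) : ∃ k : ℤ, u = unitI ^ k := by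
  rcases unit_cases u with h | h | h | h
  · exact ⟨0, by ext <;> rw [h] <;> rfl⟩
  · exact ⟨1, by ext <;> rw [h] <;> rfl⟩
  · exact ⟨2, by ext <;> rw [h] <;> rfl⟩
  · exact ⟨-1, by ext <;> rw [h] <;> rfl⟩

theorem unit_pow_four (u : GaussianIntˣ) : u ^ 4 = 1 := by
  obtain ⟨k, rfl⟩ := exists_unitI_zpow u
  rw [← zpow_natCast, ← zpow_mul, mul_comm, zpow_mul]
  norm_cast
  rw [unitI_pow_four, one_zpow]

theorem star_unit (u : GaussianIntˣ) : star (u : GaussianInt) = ((u⁻¹ : GaussianIntˣ) : GaussianInt) := by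
  refine eq_comm.1 (Units.inv_eq_of_mul_eq_one_right ?_)
  rw [← Zsqrtd.norm_eq_mul_conj, (Zsqrtd.norm_eq_one_iff' (by norm_num) _).2 u.isUnit]
  rfl

/-- The difference of two distinct units of `ℤ[i]` divides `4`. -/
theorem unit_sub_dvd_four {u v : GaussianIntˣ} (h : u ≠ v) :
    (u : GaussianInt) - v ∣ 4 := by
  have h' : (u : GaussianInt) ≠ v := fun e => h (Units.ext e)
  rcases unit_cases u with hu | hu | hu | hu <;> rcases unit_cases v with hv | hv | hv | hv <;>
    rw [hu, hv] at h' ⊢ <;> first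
      | exact absurd rfl h'
      | exact ⟨2, by decide⟩
      | exact ⟨-2, by decide⟩
      | exact ⟨⟨2, 2⟩, by decide⟩
      | exact ⟨⟨2, -2⟩, by decide⟩
      | exact ⟨⟨-2, 2⟩, by decide⟩
      | exact ⟨⟨-2, -2⟩, by decide⟩
      | exact ⟨⟨0, 2⟩, by decide⟩
      | exact ⟨⟨0, -2⟩, by decide⟩

theorem not_dvd_two_of_odd_norm {π : GaussianInt} (hπ : Prime π) (h : Odd π.norm) : ¬ π ∣ 2 := by
  rintro ⟨β, hβ⟩
  have h4 : π.norm * β.norm = 2 ^ 2 := by rw [← Zsqrtd.norm_mul, ← hβ]; rfl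
  have hu : IsUnit π.norm := by
    have hc : IsCoprime π.norm ((2 : ℤ) ^ 2) :=
      IsCoprime.pow_right (Int.isCoprime_two_right.2 h)
    exact hc.isUnit_of_dvd' dvd_rfl ⟨_, h4.symm⟩
  exact hπ.not_isUnit ((Zsqrtd.isUnit_iff_norm_isUnit π).2 hu)

/-- A prime of odd norm separates the four units, because their differences divide 4. This makes the
quartic residue symbol well defined. -/
theorem unit_eq_of_dvd_sub {π : GaussianInt} (hπ : Prime π) (h : Odd π.norm) {u v : GaussianIntˣ}
    (huv : π ∣ (u : GaussianInt) - v) : u = v := by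
  by_contra hne
  have h4 : π ∣ 2 * 2 := by
    have := huv.trans (unit_sub_dvd_four hne)
    norm_num
    exact this
  exact not_dvd_two_of_odd_norm hπ h ((hπ.dvd_or_dvd h4).elim id id)

/-! ### Frobenius and the primes of odd norm. -/

/-- Binomial theorem modulo `l`, with Fermat applied to both coordinates. As `i^l = ±i`, the `l`-th
power map modulo `l` is the identity or conjugation according to `l` modulo 4. -/
theorem pow_prime_sub_dvd (l : ℕ) [Fact l.Prime] (α : GaussianInt) :
    (l : GaussianInt) ∣ α ^ l - (⟨α.re, 0⟩ + ⟨α.im, 0⟩ * (⟨0, 1⟩ : GaussianInt) ^ l) := by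
  have key : ∀ n : ℤ, (l : GaussianInt) ∣ (⟨n, 0⟩ : GaussianInt) ^ l - ⟨n, 0⟩ := by
    intro n
    have h1 : (l : ℤ) ∣ n ^ l - n := by
      rw [← ZMod.intCast_zmod_eq_zero_iff_dvd]
      push_cast
      rw [ZMod.pow_card, sub_self]
    obtain ⟨t, ht⟩ := h1
    refine ⟨(t : GaussianInt), ?_⟩
    have h2 : (⟨n, 0⟩ : GaussianInt) = (n : GaussianInt) := by ext <;> simp
    rw [h2]
    exact_mod_cast ht
  have hα : α = ⟨α.re, 0⟩ + ⟨α.im, 0⟩ * (⟨0, 1⟩ : GaussianInt) := by ext <;> simp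
  obtain ⟨r, hr⟩ := exists_add_pow_prime_eq (Fact.out : l.Prime) (⟨α.re, 0⟩ : GaussianInt)
    (⟨α.im, 0⟩ * (⟨0, 1⟩ : GaussianInt))
  obtain ⟨s, hs⟩ := key α.re
  obtain ⟨t, ht⟩ := key α.im
  conv_rhs => rw [hα, hr, mul_pow]
  refine ⟨s + t * ⟨0, 1⟩ ^ l + ⟨α.re, 0⟩ * (⟨α.im, 0⟩ * ⟨0, 1⟩) * r, ?_⟩
  simp only [Zsqrtd.re_add, Zsqrtd.re_mul, Zsqrtd.im_add, Zsqrtd.im_mul]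
  simp only [mul_zero, mul_one, add_zero, zero_add]
  linear_combination hs + (⟨0, 1⟩ : GaussianInt) ^ l * ht

theorem I_pow_of_mod_four_eq_one {l : ℕ} (h : l % 4 = 1) :
    (⟨0, 1⟩ : GaussianInt) ^ l = ⟨0, 1⟩ := by
  have h4 : (⟨0, 1⟩ : GaussianInt) ^ 4 = 1 := by decide
  rw [← Nat.div_add_mod l 4, h, pow_add, pow_mul, h4, one_pow, one_mul, pow_one]

theorem I_pow_of_mod_four_eq_three {l : ℕ} (h : l % 4 = 3) :
    (⟨0, 1⟩ : GaussianInt) ^ l = -⟨0, 1⟩ := by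
  have h4 : (⟨0, 1⟩ : GaussianInt) ^ 4 = 1 := by decide
  rw [← Nat.div_add_mod l 4, h, pow_add, pow_mul, h4, one_pow, one_mul]
  decide

theorem pow_sub_self_dvd {l : ℕ} [Fact l.Prime] (h : l % 4 = 1) (α : GaussianInt) :
    (l : GaussianInt) ∣ α ^ l - α := by
  have := pow_prime_sub_dvd l α
  rw [I_pow_of_mod_four_eq_one h] at this
  convert this using 2
  ext <;> simp

theorem pow_sub_star_dvd {l : ℕ} [Fact l.Prime] (h : l % 4 = 3) (α : GaussianInt) :
    (l : GaussianInt) ∣ α ^ l - star α := by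
  have := pow_prime_sub_dvd l α
  rw [I_pow_of_mod_four_eq_three h] at this
  convert this using 2
  ext <;> simp

theorem exists_nat_prime_dvd {π : GaussianInt} (hπ : Prime π) :
    ∃ l : ℕ, l.Prime ∧ π ∣ (l : GaussianInt) := by
  have key : ∀ n : ℕ, n ≠ 0 → π ∣ (n : GaussianInt) →
      ∃ l : ℕ, l.Prime ∧ π ∣ (l : GaussianInt) := by
    intro n
    induction n using induction_on_primes with
    | zero => exact fun h => absurd rfl h
    | one => exact fun _ h => absurd (isUnit_of_dvd_one (by simpa using h)) hπ.not_isUnit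
    | prime_mul p a hp ih =>
      intro h0 h
      push_cast at h
      rcases hπ.dvd_or_dvd h with h | h
      · exact ⟨p, hp, h⟩
      · exact ih (right_ne_zero_of_mul h0) h
  refine key π.norm.natAbs (by simpa [GaussianInt.norm_eq_zero] using hπ.ne_zero) ?_
  rw [GaussianInt.natCast_natAbs_norm, Zsqrtd.norm_eq_mul_conj]
  exact dvd_mul_right _ _

/-- Classification of the primes of `ℤ[i]` of odd norm. -/
theorem prime_cases {π : GaussianInt} (hπ : Prime π) (h : Odd π.norm) :
    (∃ l : ℕ, l.Prime ∧ l % 4 = 3 ∧ Associated π (l : GaussianInt)) ∨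
      (∃ l : ℕ, l.Prime ∧ l % 4 = 1 ∧ π.norm = l) := by
  obtain ⟨l, hl, hd⟩ := exists_nat_prime_dvd hπ
  have := Fact.mk hl
  have hl2 : l ≠ 2 := by
    rintro rfl
    exact not_dvd_two_of_odd_norm hπ h (by simpa using hd)
  have hodd := hl.eq_two_or_odd.resolve_left hl2
  by_cases h3 : l % 4 = 3
  · exact Or.inl ⟨l, hl, h3, hπ.associated_of_dvd (prime_of_nat_prime_of_mod_four_eq_three l h3) hd⟩
  · refine Or.inr ⟨l, hl, by omega, ?_⟩
    obtain ⟨β, hβ⟩ := hd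
    have hn : π.norm.natAbs * β.norm.natAbs = l ^ 2 := by
      rw [← Int.natAbs_mul, ← Zsqrtd.norm_mul, ← hβ, Zsqrtd.norm_natCast, Int.natAbs_mul, sq]
      simp
    -- Both factors of `l²` differ from 1, so both equal `l`; if `β` were a unit, `l` would be inert
    -- and hence 3 modulo 4.
    have h1 : π.norm.natAbs ≠ 1 := fun e => hπ.not_isUnit (Zsqrtd.norm_eq_one_iff.1 e)
    have h2 : β.norm.natAbs ≠ 1 := fun e => by
      have hu := Zsqrtd.norm_eq_one_iff.1 e
      refine h3 (mod_four_eq_three_of_nat_prime_of_prime l ?_)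
      rw [hβ]
      exact (associated_mul_unit_right π β hu).prime hπ
    have h3 := ((hl.mul_eq_prime_sq_iff h1 h2).1 hn).1
    rw [← GaussianInt.abs_natCast_norm, h3]

theorem norm_mod_four_of_odd {π : GaussianInt} (h : Odd π.norm) : π.norm % 4 = 1 := by
  rw [Zsqrtd.norm_def] at h ⊢
  have h1 : π.re * π.re - -1 * π.im * π.im = π.re * π.re + π.im * π.im := by ring
  rw [h1] at h ⊢
  rcases Int.even_or_odd' π.re with ⟨a, ha | ha⟩ <;> rcases Int.even_or_odd' π.im with ⟨b, hb | hb⟩ <;>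
    rw [ha, hb] at h ⊢ <;> ring_nf at h ⊢ <;> rw [Int.odd_iff] at h <;> omega

theorem natAbs_norm_mod_four {π : GaussianInt} (h : Odd π.norm) : π.norm.natAbs % 4 = 1 := by
  have h1 := norm_mod_four_of_odd h
  have h2 := GaussianInt.norm_nonneg π
  omega

/-- Over an inert `l` the norm is `l²` and Frobenius conjugates twice; over a split `l` the norm is
`l` and Frobenius is already the identity. -/
theorem dvd_pow_norm_sub_self {π : GaussianInt} (hπ : Prime π) (h : Odd π.norm) (α : GaussianInt) :
    π ∣ α ^ π.norm.natAbs - α := by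
  rcases prime_cases hπ h with ⟨l, hl, h3, ha⟩ | ⟨l, hl, h1, hn⟩
  · have := Fact.mk hl
    have hN : π.norm.natAbs = l * l := by
      rw [Zsqrtd.norm_eq_of_associated (by norm_num) ha, Zsqrtd.norm_natCast, Int.natAbs_mul]
      simp
    refine ha.dvd.trans ?_
    rw [hN, pow_mul]
    have e1 := (pow_sub_star_dvd h3 α).trans (sub_dvd_pow_sub_pow (α ^ l) (star α) l)
    have e2 := pow_sub_star_dvd h3 (star α)
    rw [star_star] at e2
    simpa using dvd_add e1 e2
  · have := Fact.mk hl
    have hN : π.norm.natAbs = l := by omega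
    have hd : π ∣ (l : GaussianInt) := by
      refine ⟨star π, ?_⟩
      rw [← Zsqrtd.norm_eq_mul_conj, hn]
      simp
    rw [hN]
    exact hd.trans (pow_sub_self_dvd h1 α)

theorem dvd_pow_norm_sub_one {π : GaussianInt} (hπ : Prime π) (h : Odd π.norm) {α : GaussianInt}
    (hα : ¬ π ∣ α) : π ∣ (α ^ ((π.norm.natAbs - 1) / 4)) ^ 4 - 1 := by
  have h4 := natAbs_norm_mod_four h
  have h1 := dvd_pow_norm_sub_self hπ h α
  have h2 : α ^ π.norm.natAbs - α = α * ((α ^ ((π.norm.natAbs - 1) / 4)) ^ 4 - 1) := by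
    rw [← pow_mul, mul_sub, ← pow_succ', mul_one]
    congr 2
    omega
  rw [h2] at h1
  exact (hπ.dvd_or_dvd h1).resolve_left hα

theorem exists_unit_dvd_pow_sub {π : GaussianInt} (hπ : Prime π) (h : Odd π.norm) {α : GaussianInt}
    (hα : ¬ π ∣ α) : ∃ u : GaussianIntˣ, π ∣ α ^ ((π.norm.natAbs - 1) / 4) - u := by
  have h1 := dvd_pow_norm_sub_one hπ h hα
  set t := α ^ ((π.norm.natAbs - 1) / 4)
  have h2 : t ^ 4 - 1 = (t - 1) * (t - (-1)) * ((t - ⟨0, 1⟩) * (t - ⟨0, -1⟩)) := by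
    have e : (⟨0, 1⟩ : GaussianInt) * ⟨0, -1⟩ = 1 := by decide
    have e2 : (⟨0, -1⟩ : GaussianInt) = - ⟨0, 1⟩ := by decide
    rw [e2] at e ⊢
    linear_combination (t ^ 2 - 1) * (-e)
  rw [h2] at h1
  rcases hπ.dvd_or_dvd h1 with h1 | h1 <;> rcases hπ.dvd_or_dvd h1 with h1 | h1
  · exact ⟨1, by simpa using h1⟩
  · exact ⟨-1, by simpa using h1⟩
  · exact ⟨unitI, by simpa using h1⟩
  · exact ⟨unitI⁻¹, by simpa [coe_unitI_inv] using h1⟩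

/-! ### Formal properties of the quartic residue symbol. -/

theorem quarticResidueSymbol_eq_of_dvd {π : GaussianInt} (hπ : Prime π) (h : Odd π.norm)
    {α : GaussianInt} (hα : ¬ π ∣ α) {u : GaussianIntˣ}
    (hu : π ∣ α ^ ((π.norm.natAbs - 1) / 4) - u) : quarticResidueSymbol α π = u := by
  have key : ∀ v : GaussianIntˣ, π ∣ α ^ ((π.norm.natAbs - 1) / 4) - v → u = v := by
    intro v hv
    refine unit_eq_of_dvd_sub hπ h ?_
    have := dvd_sub hv hu
    simpa using this
  unfold quarticResidueSymbol
  rw [if_neg hα]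
  split_ifs with h1 h2 h3
  · rw [key 1 (by simpa using h1)]; rfl
  · rw [key unitI (by simpa using h2)]; rfl
  · rw [key (-1) (by simpa using h3)]; rfl
  · rcases unit_cases u with h' | h' | h' | h' <;> rw [h'] at hu ⊢
    · exact absurd hu h1
    · exact absurd hu h2
    · exact absurd hu h3

theorem dvd_pow_sub_quarticResidueSymbol {π : GaussianInt} (hπ : Prime π) (h : Odd π.norm)
    {α : GaussianInt} (hα : ¬ π ∣ α) : ∃ u : GaussianIntˣ, quarticResidueSymbol α π = u ∧
      π ∣ α ^ ((π.norm.natAbs - 1) / 4) - u := by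
  obtain ⟨u, hu⟩ := exists_unit_dvd_pow_sub hπ h hα
  exact ⟨u, quarticResidueSymbol_eq_of_dvd hπ h hα hu, hu⟩

theorem quarticResidueSymbol_of_associated {π ρ : GaussianInt} (h : Associated π ρ)
    (α : GaussianInt) : quarticResidueSymbol α π = quarticResidueSymbol α ρ := by
  have hn : π.norm = ρ.norm := Zsqrtd.norm_eq_of_associated (by norm_num) h
  classical
  unfold quarticResidueSymbol
  rw [hn]
  have hd : ∀ β, π ∣ β ↔ ρ ∣ β := fun β => h.dvd_iff_dvd_left
  exact if_congr (hd _) rfl (if_congr (hd _) rfl (if_congr (hd _) rfl (if_congr (hd _) rfl rfl)))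

theorem quarticResidueSymbol_mul {π : GaussianInt} (hπ : Prime π) (h : Odd π.norm)
    (α β : GaussianInt) : quarticResidueSymbol (α * β) π =
      quarticResidueSymbol α π * quarticResidueSymbol β π := by
  by_cases hα : π ∣ α
  · simp [quarticResidueSymbol, hα, hα.mul_right]
  by_cases hβ : π ∣ β
  · simp [quarticResidueSymbol, hβ, hβ.mul_left]
  obtain ⟨u, hu, hu'⟩ := dvd_pow_sub_quarticResidueSymbol hπ h hα
  obtain ⟨v, hv, hv'⟩ := dvd_pow_sub_quarticResidueSymbol hπ h hβ
  rw [hu, hv, ← Units.val_mul]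
  refine quarticResidueSymbol_eq_of_dvd hπ h (fun hd => (hπ.dvd_or_dvd hd).elim hα hβ) ?_
  rw [mul_pow, Units.val_mul]
  have : ∀ a b c d : GaussianInt, a * b - c * d = (a - c) * b + c * (b - d) := by intros; ring
  rw [this]
  exact dvd_add (hu'.mul_right _) (hv'.mul_left _)

theorem quarticResidueSymbol_congr {π : GaussianInt} (hπ : Prime π) (h : Odd π.norm)
    {α β : GaussianInt} (hd : π ∣ α - β) :
    quarticResidueSymbol α π = quarticResidueSymbol β π := by
  by_cases hα : π ∣ α
  · have hβ : π ∣ β := by simpa using dvd_sub hα hd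
    simp [quarticResidueSymbol, hα, hβ]
  have hβ : ¬ π ∣ β := fun hβ => hα (by simpa using dvd_add hd hβ)
  obtain ⟨u, hu, hu'⟩ := dvd_pow_sub_quarticResidueSymbol hπ h hβ
  rw [hu]
  refine quarticResidueSymbol_eq_of_dvd hπ h hα ?_
  simpa using dvd_add (hd.trans (sub_dvd_pow_sub_pow α β ((π.norm.natAbs - 1) / 4))) hu'

theorem star_dvd_star {α β : GaussianInt} (h : α ∣ β) : star α ∣ star β := by
  obtain ⟨γ, rfl⟩ := h
  exact ⟨star γ, by rw [star_mul']⟩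

theorem prime_star {π : GaussianInt} (hπ : Prime π) : Prime (star π) :=
  (MulEquiv.prime_iff (starRingAut (R := GaussianInt))).2 hπ

theorem quarticResidueSymbol_star {π : GaussianInt} (hπ : Prime π) (h : Odd π.norm)
    (α : GaussianInt) : quarticResidueSymbol (star α) (star π) =
      star (quarticResidueSymbol α π) := by
  by_cases hα : π ∣ α
  · simp [quarticResidueSymbol, hα, star_dvd_star hα]
  obtain ⟨u, hu, hu'⟩ := dvd_pow_sub_quarticResidueSymbol hπ h hα
  rw [hu, star_unit]
  refine quarticResidueSymbol_eq_of_dvd (prime_star hπ) (by rwa [Zsqrtd.norm_conj])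
    (fun hd => hα (by simpa using star_dvd_star hd)) ?_
  rw [Zsqrtd.norm_conj, ← star_unit, ← star_pow, ← star_sub]
  exact star_dvd_star hu'

/-! ### Formal properties of the quartic Jacobi symbol. -/

open UniqueFactorizationMonoid in
theorem quarticJacobiSymbol_mul_right {α β γ : GaussianInt} (hβ : β ≠ 0) (hγ : γ ≠ 0) :
    quarticJacobiSymbol α (β * γ) = quarticJacobiSymbol α β * quarticJacobiSymbol α γ := by
  unfold quarticJacobiSymbol
  rw [← Multiset.prod_add, ← Multiset.map_add]
  have h := factors_mul hβ hγ
  congr 1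
  rw [← Multiset.rel_eq, Multiset.rel_map]
  exact h.mono fun a _ b _ hab => quarticResidueSymbol_of_associated hab α

open UniqueFactorizationMonoid in
theorem quarticJacobiSymbol_prime {α π : GaussianInt} (hπ : Prime π) :
    quarticJacobiSymbol α π = quarticResidueSymbol α π := by
  obtain ⟨ρ, hρ, hf⟩ := prime_factors_irreducible hπ.irreducible
    ⟨fun b hb => prime_of_factor b hb, factors_prod hπ.ne_zero⟩
  rw [quarticJacobiSymbol, hf, Multiset.map_singleton, Multiset.prod_singleton,
    quarticResidueSymbol_of_associated hρ]

open UniqueFactorizationMonoid in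
theorem quarticJacobiSymbol_isUnit {α β : GaussianInt} (hβ : IsUnit β) :
    quarticJacobiSymbol α β = 1 := by
  have h : factors β = 0 := by
    by_contra hne
    obtain ⟨π, hπ⟩ := Multiset.exists_mem_of_ne_zero hne
    exact (prime_of_factor π hπ).not_isUnit (isUnit_of_dvd_unit (dvd_of_mem_factors hπ) hβ)
  rw [quarticJacobiSymbol, h, Multiset.map_zero, Multiset.prod_zero]

theorem ne_zero_of_odd_norm {β : GaussianInt} (h : Odd β.norm) : β ≠ 0 := by
  rintro rfl
  simp at h

theorem odd_norm_mul {β γ : GaussianInt} : Odd (β * γ).norm ↔ Odd β.norm ∧ Odd γ.norm := by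
  rw [Zsqrtd.norm_mul, Int.odd_mul]

/-- Induction on the prime factorization of Gaussian integers of odd norm. -/
theorem odd_induction {P : GaussianInt → Prop} (hu : ∀ u, IsUnit u → P u)
    (hmul : ∀ α π, Odd α.norm → Odd π.norm → Prime π → P π → P α → P (π * α))
    (hp : ∀ π, Prime π → Odd π.norm → P π) (α : GaussianInt) (hα : Odd α.norm) : P α := by
  induction α using UniqueFactorizationMonoid.induction_on_prime with
  | h₁ => simp at hα
  | h₂ u h => exact hu u h
  | h₃ a π _ hπ ih =>
    have h := odd_norm_mul.1 hα
    exact hmul a π h.2 h.1 hπ (hp π hπ h.1) (ih h.2)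

theorem quarticJacobiSymbol_mul_left (α β : GaussianInt) {γ : GaussianInt} (hγ : Odd γ.norm) :
    quarticJacobiSymbol (α * β) γ = quarticJacobiSymbol α γ * quarticJacobiSymbol β γ := by
  refine odd_induction (P := fun γ => quarticJacobiSymbol (α * β) γ =
    quarticJacobiSymbol α γ * quarticJacobiSymbol β γ) ?_ ?_ ?_ γ hγ
  · intro u hu
    simp [quarticJacobiSymbol_isUnit hu]
  · intro δ π hδ ho hπ h1 h2
    simp only [quarticJacobiSymbol_mul_right hπ.ne_zero (ne_zero_of_odd_norm hδ), h1, h2]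
    ring
  · intro π hπ ho
    simp only [quarticJacobiSymbol_prime hπ, quarticResidueSymbol_mul hπ ho]

theorem quarticJacobiSymbol_congr {α β γ : GaussianInt} (hγ : Odd γ.norm) (hd : γ ∣ α - β) :
    quarticJacobiSymbol α γ = quarticJacobiSymbol β γ := by
  revert hd
  refine odd_induction (P := fun γ => γ ∣ α - β → quarticJacobiSymbol α γ =
    quarticJacobiSymbol β γ) ?_ ?_ ?_ γ hγ
  · intro u hu _
    simp [quarticJacobiSymbol_isUnit hu]
  · intro δ π hδ ho hπ h1 h2 hd
    simp only [quarticJacobiSymbol_mul_right hπ.ne_zero (ne_zero_of_odd_norm hδ),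
      h1 (dvd_of_mul_right_dvd hd), h2 (dvd_of_mul_left_dvd hd)]
  · intro π hπ ho hd
    simp only [quarticJacobiSymbol_prime hπ, quarticResidueSymbol_congr hπ ho hd]

theorem quarticJacobiSymbol_star (α : GaussianInt) {γ : GaussianInt} (hγ : Odd γ.norm) :
    quarticJacobiSymbol (star α) (star γ) = star (quarticJacobiSymbol α γ) := by
  refine odd_induction (P := fun γ => quarticJacobiSymbol (star α) (star γ) =
    star (quarticJacobiSymbol α γ)) ?_ ?_ ?_ γ hγ
  · intro u hu
    rw [quarticJacobiSymbol_isUnit hu, quarticJacobiSymbol_isUnit hu.star, star_one]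
  · intro δ π hδ ho hπ h1 h2
    have h0 := ne_zero_of_odd_norm hδ
    rw [star_mul', quarticJacobiSymbol_mul_right (star_ne_zero.2 hπ.ne_zero) (star_ne_zero.2 h0),
      quarticJacobiSymbol_mul_right hπ.ne_zero h0, star_mul', h1, h2]
  · intro π hπ ho
    simp only [quarticJacobiSymbol_prime hπ, quarticJacobiSymbol_prime (prime_star hπ),
      quarticResidueSymbol_star hπ ho]

theorem isUnit_quarticJacobiSymbol {α γ : GaussianInt} (hγ : Odd γ.norm) (h : IsCoprime α γ) :
    IsUnit (quarticJacobiSymbol α γ) := by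
  revert h
  refine odd_induction (P := fun γ => IsCoprime α γ → IsUnit (quarticJacobiSymbol α γ))
    ?_ ?_ ?_ γ hγ
  · intro u hu _
    simp [quarticJacobiSymbol_isUnit hu]
  · intro δ π hδ ho hπ h1 h2 hc
    rw [quarticJacobiSymbol_mul_right hπ.ne_zero (ne_zero_of_odd_norm hδ)]
    exact (h1 hc.of_mul_right_left).mul (h2 hc.of_mul_right_right)
  · intro π hπ ho hc
    rw [quarticJacobiSymbol_prime hπ]
    obtain ⟨u, hu, -⟩ := dvd_pow_sub_quarticResidueSymbol hπ ho
      (fun hd => hπ.not_isUnit (hc.isUnit_of_dvd' hd dvd_rfl))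
    rw [hu]
    exact u.isUnit

/-! ### The Jacobi symbol in the unit group, where symbols can be inverted. -/

open Classical in
/-- The quartic Jacobi symbol as a unit of `ℤ[i]` (`1` if the symbol is not a unit). -/
noncomputable def jacobiUnit (α β : GaussianInt) : GaussianIntˣ :=
  if h : IsUnit (quarticJacobiSymbol α β) then h.unit else 1

theorem coe_jacobiUnit {α β : GaussianInt} (hβ : Odd β.norm) (h : IsCoprime α β) :
    (jacobiUnit α β : GaussianInt) = quarticJacobiSymbol α β := by
  rw [jacobiUnit, dif_pos (isUnit_quarticJacobiSymbol hβ h), IsUnit.unit_spec]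

theorem jacobiUnit_congr {α β γ : GaussianInt} (hγ : Odd γ.norm) (hd : γ ∣ α - β) :
    jacobiUnit α γ = jacobiUnit β γ := by
  have h := quarticJacobiSymbol_congr hγ hd
  by_cases hu : IsUnit (quarticJacobiSymbol α γ)
  · have hu' := h ▸ hu
    rw [jacobiUnit, jacobiUnit, dif_pos hu, dif_pos hu']
    exact Units.ext h
  · have hu' := h ▸ hu
    rw [jacobiUnit, jacobiUnit, dif_neg hu, dif_neg hu']

theorem jacobiUnit_mul_left {α β γ : GaussianInt} (hγ : Odd γ.norm) (hα : IsCoprime α γ)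
    (hβ : IsCoprime β γ) : jacobiUnit (α * β) γ = jacobiUnit α γ * jacobiUnit β γ := by
  ext1
  rw [Units.val_mul, coe_jacobiUnit hγ hα, coe_jacobiUnit hγ hβ,
    coe_jacobiUnit hγ (hα.mul_left hβ), quarticJacobiSymbol_mul_left _ _ hγ]

theorem jacobiUnit_mul_right {α β γ : GaussianInt} (hβ : Odd β.norm) (hγ : Odd γ.norm)
    (hαβ : IsCoprime α β) (hαγ : IsCoprime α γ) :
    jacobiUnit α (β * γ) = jacobiUnit α β * jacobiUnit α γ := by
  ext1
  rw [Units.val_mul, coe_jacobiUnit hβ hαβ, coe_jacobiUnit hγ hαγ,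
    coe_jacobiUnit (odd_norm_mul.2 ⟨hβ, hγ⟩) (hαβ.mul_right hαγ),
    quarticJacobiSymbol_mul_right (ne_zero_of_odd_norm hβ) (ne_zero_of_odd_norm hγ)]

theorem jacobiUnit_one_left {γ : GaussianInt} (hγ : Odd γ.norm) : jacobiUnit 1 γ = 1 := by
  have h := jacobiUnit_mul_left hγ (isCoprime_one_left (x := γ)) isCoprime_one_left
  rw [mul_one] at h
  exact left_eq_mul.1 h

theorem jacobiUnit_pow_left {α γ : GaussianInt} (hγ : Odd γ.norm) (hα : IsCoprime α γ) (n : ℕ) :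
    jacobiUnit (α ^ n) γ = jacobiUnit α γ ^ n := by
  induction n with
  | zero => rw [pow_zero, pow_zero, jacobiUnit_one_left hγ]
  | succ n ih => rw [pow_succ, pow_succ, jacobiUnit_mul_left hγ hα.pow_left hα, ih]

theorem jacobiUnit_isUnit_right {α β : GaussianInt} (hβ : IsUnit β) : jacobiUnit α β = 1 := by
  ext1
  rw [jacobiUnit, quarticJacobiSymbol_isUnit hβ, dif_pos isUnit_one]
  rfl

theorem odd_norm_of_isUnit {β : GaussianInt} (hβ : IsUnit β) : Odd β.norm := by
  rw [(Zsqrtd.norm_eq_one_iff' (by norm_num) _).2 hβ]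
  exact odd_one

theorem isCoprime_of_isUnit_right {α β : GaussianInt} (hβ : IsUnit β) : IsCoprime α β :=
  (isCoprime_one_right (x := α)).of_isCoprime_of_dvd_right hβ.dvd

theorem isCoprime_of_isUnit_left {α β : GaussianInt} (hβ : IsUnit β) : IsCoprime β α :=
  (isCoprime_of_isUnit_right hβ).symm

theorem jacobiUnit_of_associated {α β γ : GaussianInt} (h : Associated β γ) (hβ : Odd β.norm)
    (hα : IsCoprime α β) : jacobiUnit α β = jacobiUnit α γ := by
  obtain ⟨u, rfl⟩ := h
  rw [jacobiUnit_mul_right hβ (odd_norm_of_isUnit u.isUnit) hα (isCoprime_of_isUnit_right u.isUnit),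
    jacobiUnit_isUnit_right u.isUnit, mul_one]

theorem jacobiUnit_neg_right {α β : GaussianInt} (hβ : Odd β.norm)
    (hα : IsCoprime α β) : jacobiUnit α (-β) = jacobiUnit α β :=
  (jacobiUnit_of_associated (Associated.refl β).neg_right hβ hα).symm

theorem isCoprime_star {α β : GaussianInt} (h : IsCoprime α β) : IsCoprime (star α) (star β) :=
  h.map (starRingEnd GaussianInt)

theorem jacobiUnit_star {α β : GaussianInt} (hβ : Odd β.norm) (h : IsCoprime α β) :
    jacobiUnit (star α) (star β) = (jacobiUnit α β)⁻¹ := by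
  ext1
  rw [coe_jacobiUnit (by rwa [Zsqrtd.norm_conj]) (isCoprime_star h), quarticJacobiSymbol_star _ hβ,
    ← coe_jacobiUnit hβ h, star_unit]

/-- No coprimality has to be assumed: the exponent is positive, so `π ∣ α` would force `π` to divide
the unit `u`. -/
theorem jacobiUnit_eq_of_dvd {π α : GaussianInt} (hπ : Prime π) (h : Odd π.norm)
    {u : GaussianIntˣ} (hu : π ∣ α ^ ((π.norm.natAbs - 1) / 4) - u) : jacobiUnit α π = u := by
  by_cases hα : π ∣ α
  · by_cases h0 : (π.norm.natAbs - 1) / 4 = 0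
    · have h4 := natAbs_norm_mod_four h
      have h1 : π.norm.natAbs = 1 := by omega
      exact absurd (Zsqrtd.norm_eq_one_iff.1 h1) hπ.not_isUnit
    · have hd := dvd_sub (dvd_pow hα h0) hu
      rw [sub_sub_cancel] at hd
      exact absurd (isUnit_of_dvd_unit hd u.isUnit) hπ.not_isUnit
  · ext1
    rw [coe_jacobiUnit h (((hπ.irreducible.coprime_iff_not_dvd).2 hα).symm),
      quarticJacobiSymbol_prime hπ, quarticResidueSymbol_eq_of_dvd hπ h hα hu]

theorem dvd_pow_sub_jacobiUnit {π α : GaussianInt} (hπ : Prime π) (h : Odd π.norm)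
    (hα : ¬ π ∣ α) : π ∣ α ^ ((π.norm.natAbs - 1) / 4) - jacobiUnit α π := by
  obtain ⟨u, hu⟩ := exists_unit_dvd_pow_sub hπ h hα
  rwa [jacobiUnit_eq_of_dvd hπ h hu]

/-! ### Symbols with a rational lower argument -/

theorem odd_norm_intCast {m : ℤ} (h : Odd m) : Odd (m : GaussianInt).norm := by
  rw [Zsqrtd.norm_intCast]
  exact h.mul h

theorem isCoprime_intCast {m n : ℤ} (h : IsCoprime m n) :
    IsCoprime (m : GaussianInt) (n : GaussianInt) :=
  h.map (Int.castRingHom GaussianInt)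

theorem prime_of_norm_natPrime {π : GaussianInt} {p : ℕ} (hp : p.Prime) (hn : π.norm = p) :
    Prime π := by
  refine Irreducible.prime ⟨fun hu => ?_, fun β γ hβγ => ?_⟩
  · rw [← Zsqrtd.norm_eq_one_iff, hn] at hu
    exact hp.one_lt.ne' (by simpa using hu)
  · have h1 : β.norm.natAbs * γ.norm.natAbs = p := by
      rw [← Int.natAbs_mul, ← Zsqrtd.norm_mul, ← hβγ, hn, Int.natAbs_natCast]
    rcases (Nat.prime_mul_iff.1 (h1 ▸ hp)) with h2 | h2
    · exact Or.inr (Zsqrtd.norm_eq_one_iff.1 h2.2)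
    · exact Or.inl (Zsqrtd.norm_eq_one_iff.1 h2.2)

theorem exists_prime_of_mod_four_eq_one {l : ℕ} (hl : l.Prime) (h : l % 4 = 1) :
    ∃ π : GaussianInt, Prime π ∧ Odd π.norm ∧ π.norm = l ∧ (l : GaussianInt) = π * star π := by
  have := Fact.mk hl
  obtain ⟨a, b, hab⟩ := sq_add_sq_of_nat_prime_of_not_irreducible l (fun hi => by
    have := mod_four_eq_three_of_nat_prime_of_prime l hi.prime
    omega)
  have hn : (⟨a, b⟩ : GaussianInt).norm = l := by
    rw [Zsqrtd.norm_def, ← hab]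
    push_cast
    ring
  refine ⟨⟨a, b⟩, prime_of_norm_natPrime hl hn, ?_, hn, ?_⟩
  · rw [hn, Int.odd_iff]
    omega
  · rw [← Zsqrtd.norm_eq_mul_conj, hn]
    simp

/-- Conjugation moves the factor at `star π` to `π`, so a symbol with split rational denominator is
computed at `π` alone. -/
theorem jacobiUnit_split {l : ℕ} {π α : GaussianInt} (h : Odd π.norm)
    (hl : (l : GaussianInt) = π * star π) (hα : IsCoprime α (l : GaussianInt)) :
    jacobiUnit α l = jacobiUnit α π * (jacobiUnit (star α) π)⁻¹ := by
  rw [hl] at hα ⊢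
  have h2 := isCoprime_star hα.of_mul_right_right
  rw [star_star] at h2
  rw [jacobiUnit_mul_right h (by rwa [Zsqrtd.norm_conj]) hα.of_mul_right_left
    hα.of_mul_right_right, ← jacobiUnit_star h h2, star_star]

theorem norm_natCast_natAbs (l : ℕ) : (l : GaussianInt).norm.natAbs = l ^ 2 := by
  rw [Zsqrtd.norm_natCast, Int.natAbs_mul, sq]
  rfl

theorem odd_norm_natCast {l : ℕ} (h : Odd l) : Odd (l : GaussianInt).norm := by
  simpa using odd_norm_intCast ((Int.odd_coe_nat l).2 h)

/-- For split `l` the two conjugate factors cancel. For inert `l` the exponent `(l² - 1)/4` is a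
multiple of `l - 1`, and Fermat applies. -/
theorem jacobiUnit_intCast_natPrime {l : ℕ} (hl : l.Prime) (h : Odd l) {n : ℤ}
    (hn : IsCoprime (n : GaussianInt) (l : GaussianInt)) :
    jacobiUnit (n : GaussianInt) (l : GaussianInt) = 1 := by
  have := Fact.mk hl
  rw [Nat.odd_iff] at h
  have h13 : l % 4 = 1 ∨ l % 4 = 3 := by omega
  rcases h13 with h1 | h3
  · obtain ⟨π, -, ho, -, hπ⟩ := exists_prime_of_mod_four_eq_one hl h1
    rw [jacobiUnit_split ho hπ hn]
    simp
  · have hp := prime_of_nat_prime_of_mod_four_eq_three l h3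
    refine jacobiUnit_eq_of_dvd hp (odd_norm_natCast (Nat.odd_iff.2 h)) ?_
    rw [norm_natCast_natAbs]
    have he : (l ^ 2 - 1) / 4 = (l - 1) * ((l + 1) / 4) := by
      obtain ⟨k, rfl⟩ : ∃ k, l = 4 * k + 3 := ⟨l / 4, by omega⟩
      have h1 : (4 * k + 3 + 1) / 4 = k + 1 := by omega
      have h2 : 4 * k + 3 - 1 = 4 * k + 2 := by omega
      rw [h1, h2]
      have : (4 * k + 3) ^ 2 - 1 = 4 * ((4 * k + 2) * (k + 1)) := by
        rw [Nat.sub_eq_iff_eq_add (by nlinarith)]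
        ring
      rw [this, Nat.mul_div_cancel_left _ (by norm_num)]
    rw [he, pow_mul]
    have h5 : (l : GaussianInt) ∣ (n : GaussianInt) ^ (l - 1) - 1 := by
      have h6 := pow_sub_star_dvd h3 (n : GaussianInt)
      rw [show star (n : GaussianInt) = n by ext <;> simp] at h6
      have h7 : (n : GaussianInt) ^ l - n = n * ((n : GaussianInt) ^ (l - 1) - 1) := by
        rw [mul_sub, ← pow_succ', mul_one, Nat.sub_add_cancel hl.one_le]
      rw [h7] at h6
      exact (hp.dvd_or_dvd h6).resolve_left
        (fun hd => hp.not_isUnit (hn.isUnit_of_dvd' hd dvd_rfl))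
    simpa using h5.trans (sub_dvd_pow_sub_pow _ 1 ((l + 1) / 4))

/-- Induction on prime factors for odd natural numbers. -/
theorem odd_nat_induction {P : ℕ → Prop} (h1 : P 1)
    (hmul : ∀ p a : ℕ, p.Prime → Odd p → Odd a → P p → P a → P (p * a))
    (hp : ∀ p : ℕ, p.Prime → Odd p → P p) (n : ℕ) (hn : Odd n) : P n := by
  induction n using induction_on_primes with
  | zero => simp at hn
  | one => exact h1
  | prime_mul p a hp' ih =>
    rw [Nat.odd_mul] at hn
    exact hmul p a hp' hn.1 hn.2 (hp p hp' hn.1) (ih hn.2)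

theorem jacobiUnit_intCast_natAbs {α : GaussianInt} {m : ℤ} (hm : Odd m)
    (h : IsCoprime α (m : GaussianInt)) :
    jacobiUnit α (m : GaussianInt) = jacobiUnit α (m.natAbs : GaussianInt) := by
  rcases Int.natAbs_eq m with e | e
  · conv_lhs => rw [e]
    simp
  · conv_rhs => rw [← jacobiUnit_neg_right (odd_norm_natCast (Int.natAbs_odd.2 hm)) (by
      rwa [e, Int.cast_neg, IsCoprime.neg_right_iff, Int.cast_natCast] at h)]
    conv_lhs => rw [e]
    simp

/-- Used throughout to discard rational factors of a numerator. -/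
theorem jacobiUnit_intCast_intCast {n m : ℤ} (hm : Odd m) (h : IsCoprime n m) :
    jacobiUnit (n : GaussianInt) (m : GaussianInt) = 1 := by
  rw [jacobiUnit_intCast_natAbs hm (isCoprime_intCast h)]
  have h' : IsCoprime (n : GaussianInt) (m.natAbs : GaussianInt) := by
    have := isCoprime_intCast (Int.isCoprime_iff_gcd_eq_one.2
      (show Int.gcd n (m.natAbs : ℤ) = 1 by
        have := Int.isCoprime_iff_gcd_eq_one.1 h
        rwa [Int.gcd_eq_natAbs_gcd_natAbs] at this ⊢))
    rwa [Int.cast_natCast] at this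
  revert h'
  refine odd_nat_induction (P := fun k => IsCoprime (n : GaussianInt) (k : GaussianInt) →
    jacobiUnit (n : GaussianInt) (k : GaussianInt) = 1) ?_ ?_ ?_ _ (Int.natAbs_odd.2 hm)
  · intro _
    rw [Nat.cast_one, jacobiUnit_isUnit_right isUnit_one]
  · intro p a _ hp ha h1 h2 hc
    rw [Nat.cast_mul] at hc ⊢
    rw [jacobiUnit_mul_right (odd_norm_natCast hp) (odd_norm_natCast ha) hc.of_mul_right_left
      hc.of_mul_right_right, h1 hc.of_mul_right_left, h2 hc.of_mul_right_right, mul_one]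
  · exact fun p hp ho hc => jacobiUnit_intCast_natPrime hp ho hc

/-- The sign change of an odd integer that is congruent to `1` modulo `4`. -/
def signedOdd (m : ℤ) : ℤ := if m % 4 = 1 then m else -m

theorem signedOdd_mod {m : ℤ} (h : Odd m) : signedOdd m % 4 = 1 := by
  rw [Int.odd_iff] at h
  unfold signedOdd
  split_ifs <;> omega

theorem signedOdd_eq_or (m : ℤ) : signedOdd m = m ∨ signedOdd m = -m := by
  unfold signedOdd
  split_ifs <;> simp

theorem signedOdd_unique {m n : ℤ} (h : n = m ∨ n = -m) (hn : n % 4 = 1) : signedOdd m = n := by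
  unfold signedOdd
  split_ifs <;> omega

theorem signedOdd_mul {m n : ℤ} (hm : Odd m) (hn : Odd n) :
    signedOdd (m * n) = signedOdd m * signedOdd n := by
  refine signedOdd_unique ?_ ?_
  · rcases signedOdd_eq_or m with h | h <;> rcases signedOdd_eq_or n with h' | h' <;>
      rw [h, h'] <;> simp
  · rw [Int.mul_emod, signedOdd_mod hm, signedOdd_mod hn]
    rfl

theorem signedOdd_natAbs {m : ℤ} (h : Odd m) : signedOdd (m.natAbs : ℤ) = signedOdd m := by
  refine signedOdd_unique ?_ (signedOdd_mod h)
  rcases Int.natAbs_eq m with e | e <;> rcases signedOdd_eq_or m with h | h <;> omega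

/-- With `m = 4a + 1` and `n = 4b + 1` the cross term contributes `4ab`. This additivity makes the
supplementary laws multiplicative in the denominator. -/
theorem mul_sub_one_div_four {m n : ℤ} (hm : m % 4 = 1) (hn : n % 4 = 1) :
    (m * n - 1) / 4 ≡ (m - 1) / 4 + (n - 1) / 4 [ZMOD 4] := by
  obtain ⟨a, rfl⟩ : ∃ a, m = 4 * a + 1 := ⟨m / 4, by omega⟩
  obtain ⟨b, rfl⟩ : ∃ b, n = 4 * b + 1 := ⟨n / 4, by omega⟩
  have h1 : ((4 * a + 1) * (4 * b + 1) - 1) = 4 * (4 * (a * b) + a + b) := by ring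
  rw [h1, Int.mul_ediv_cancel_left _ (by norm_num)]
  have h2 : (4 * a + 1 - 1) / 4 = a := by omega
  have h3 : (4 * b + 1 - 1) / 4 = b := by omega
  rw [h2, h3]
  exact (Int.modEq_iff_dvd.2 ⟨-(a * b), by ring⟩)

/-- `1 + i` is prime to every odd integer. -/
theorem isCoprime_one_add_I {α : GaussianInt} (h : Odd α.norm) :
    IsCoprime (⟨1, 1⟩ : GaussianInt) α := by
  obtain ⟨k, hk⟩ := h
  refine ⟨-(⟨1, -1⟩ * (k : GaussianInt)), star α, ?_⟩
  have h1 : star α * α = ((2 * k + 1 : ℤ) : GaussianInt) := by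
    rw [← hk, Zsqrtd.norm_eq_mul_conj, mul_comm]
  rw [h1]
  ext <;> simp
  ring

theorem isCoprime_two {α : GaussianInt} (h : Odd α.norm) : IsCoprime (2 : GaussianInt) α := by
  obtain ⟨k, hk⟩ := h
  refine ⟨-(k : GaussianInt), star α, ?_⟩
  have h1 : star α * α = ((2 * k + 1 : ℤ) : GaussianInt) := by
    rw [← hk, Zsqrtd.norm_eq_mul_conj, mul_comm]
  rw [h1]
  push_cast
  ring

theorem isUnit_I : IsUnit (⟨0, 1⟩ : GaussianInt) := unitI.isUnit

theorem jacobiUnit_I {α : GaussianInt} (hα : Odd α.norm) :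
    jacobiUnit ⟨0, 1⟩ α = unitI ^ ((α.norm - 1) / 4) := by
  refine odd_induction (P := fun α => jacobiUnit ⟨0, 1⟩ α = unitI ^ ((α.norm - 1) / 4))
    ?_ ?_ ?_ α hα
  · intro u hu
    rw [jacobiUnit_isUnit_right hu, (Zsqrtd.norm_eq_one_iff' (by norm_num) _).2 hu]
    rfl
  · intro β π hβ hπ _ h1 h2
    rw [jacobiUnit_mul_right hπ hβ (isCoprime_of_isUnit_left isUnit_I)
      (isCoprime_of_isUnit_left isUnit_I), h1, h2, ← zpow_add, Zsqrtd.norm_mul]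
    exact unitI_zpow_congr
      (mul_sub_one_div_four (norm_mod_four_of_odd hπ) (norm_mod_four_of_odd hβ)).symm
  · intro π hπ ho
    refine jacobiUnit_eq_of_dvd hπ ho ?_
    have h1 : (π.norm - 1) / 4 = (((π.norm.natAbs - 1) / 4 : ℕ) : ℤ) := by
      have := natAbs_norm_mod_four ho
      have := GaussianInt.norm_nonneg π
      omega
    rw [h1, zpow_natCast, Units.val_pow_eq_pow_val, coe_unitI, sub_self]
    exact dvd_zero _

theorem jacobiUnit_neg_one {α : GaussianInt} (hα : Odd α.norm) :
    jacobiUnit (-1) α = unitI ^ (2 * ((α.norm - 1) / 4)) := by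
  have h1 : (-1 : GaussianInt) = ⟨0, 1⟩ ^ 2 := by decide
  rw [h1, jacobiUnit_pow_left hα (isCoprime_of_isUnit_left isUnit_I), jacobiUnit_I hα, mul_comm,
    zpow_mul]
  rfl

/-- Split case: `1 + i = i(1 - i)`, so the symbols of `1 + i` and of its conjugate modulo `π` differ
by that of `i`. Inert case: Frobenius gives `(1+i)^(l-1) ≡ -i`, which is then raised to the power
`(l+1)/4`. -/
theorem jacobiUnit_one_add_I_natPrime {l : ℕ} (hl : l.Prime) (h : Odd l) :
    jacobiUnit ⟨1, 1⟩ (l : GaussianInt) = unitI ^ ((signedOdd l - 1) / 4) := by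
  have := Fact.mk hl
  have hc := isCoprime_one_add_I (odd_norm_natCast h)
  have h' := Nat.odd_iff.1 h
  have h13 : l % 4 = 1 ∨ l % 4 = 3 := by omega
  rcases h13 with h1 | h3
  · obtain ⟨π, -, ho, hn, hπ⟩ := exists_prime_of_mod_four_eq_one hl h1
    have hs : signedOdd l = l := signedOdd_unique (Or.inl rfl) (by omega)
    have hc' : IsCoprime (⟨1, 1⟩ : GaussianInt) π := isCoprime_one_add_I ho
    have h2 : (⟨1, 1⟩ : GaussianInt) = ⟨0, 1⟩ * star ⟨1, 1⟩ := by decide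
    have hc2 : IsCoprime (star ⟨1, 1⟩ : GaussianInt) π := by
      rw [h2] at hc'
      exact hc'.of_mul_left_right
    rw [jacobiUnit_split ho hπ hc, hs, ← hn]
    conv_lhs => rw [h2, jacobiUnit_mul_left ho (isCoprime_of_isUnit_left isUnit_I) hc2]
    rw [← h2, jacobiUnit_I ho, mul_inv_cancel_right]
  · have hp := prime_of_nat_prime_of_mod_four_eq_three l h3
    refine jacobiUnit_eq_of_dvd hp (odd_norm_natCast h) ?_
    have hs : signedOdd l = -l := signedOdd_unique (Or.inr rfl) (by omega)
    rw [norm_natCast_natAbs, hs]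
    obtain ⟨k, hk⟩ : ∃ k, l = 4 * k + 3 := ⟨l / 4, by omega⟩
    have he : (l ^ 2 - 1) / 4 = (l - 1) * (k + 1) := by
      rw [hk]
      have h2 : 4 * k + 3 - 1 = 4 * k + 2 := by omega
      have : (4 * k + 3) ^ 2 - 1 = 4 * ((4 * k + 2) * (k + 1)) := by
        rw [Nat.sub_eq_iff_eq_add (by nlinarith)]
        ring
      rw [this, Nat.mul_div_cancel_left _ (by norm_num), h2]
    have he2 : (-(l : ℤ) - 1) / 4 = -((k + 1 : ℕ) : ℤ) := by
      rw [hk]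
      push_cast
      omega
    rw [he, pow_mul, he2, zpow_neg, zpow_natCast, ← inv_pow, Units.val_pow_eq_pow_val, coe_unitI_inv]
    refine dvd_trans ?_ (sub_dvd_pow_sub_pow _ _ (k + 1))
    have h5 := pow_sub_star_dvd h3 (⟨1, 1⟩ : GaussianInt)
    have h6 : (⟨1, 1⟩ : GaussianInt) ^ l - star ⟨1, 1⟩ =
        ⟨1, 1⟩ * (⟨1, 1⟩ ^ (l - 1) - ⟨0, -1⟩) := by
      rw [mul_sub, ← pow_succ', Nat.sub_add_cancel hl.one_le]
      rfl
    rw [h6] at h5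
    exact hc.symm.dvd_of_dvd_mul_left h5

theorem jacobiUnit_one_add_I {m : ℤ} (hm : Odd m) :
    jacobiUnit ⟨1, 1⟩ (m : GaussianInt) = unitI ^ ((signedOdd m - 1) / 4) := by
  rw [jacobiUnit_intCast_natAbs hm (isCoprime_one_add_I (odd_norm_intCast hm)),
    ← signedOdd_natAbs hm]
  refine odd_nat_induction (P := fun k => jacobiUnit ⟨1, 1⟩ (k : GaussianInt) =
    unitI ^ ((signedOdd k - 1) / 4)) ?_ ?_ ?_ _ (Int.natAbs_odd.2 hm)
  · rw [Nat.cast_one, jacobiUnit_isUnit_right isUnit_one]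
    rfl
  · intro p a _ hp ha h1 h2
    have hp' := (Int.odd_coe_nat p).2 hp
    have ha' := (Int.odd_coe_nat a).2 ha
    rw [Nat.cast_mul, jacobiUnit_mul_right (odd_norm_natCast hp) (odd_norm_natCast ha)
      (isCoprime_one_add_I (odd_norm_natCast hp)) (isCoprime_one_add_I (odd_norm_natCast ha)), h1,
      h2, ← zpow_add, Nat.cast_mul, signedOdd_mul hp' ha']
    exact unitI_zpow_congr (mul_sub_one_div_four (signedOdd_mod hp') (signedOdd_mod ha')).symm
  · exact fun p hp ho => jacobiUnit_one_add_I_natPrime hp ho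

theorem jacobiUnit_two_intCast {m : ℤ} (hm : Odd m) :
    jacobiUnit 2 (m : GaussianInt) = 1 := by
  have := jacobiUnit_intCast_intCast hm (Int.isCoprime_two_left.2 hm)
  exact_mod_cast this

/-- From `(1+i)² = 2i` and the triviality of the symbol of 2. -/
theorem jacobiUnit_I_intCast {m : ℤ} (hm : Odd m) :
    jacobiUnit ⟨0, 1⟩ (m : GaussianInt) = unitI ^ (2 * ((signedOdd m - 1) / 4)) := by
  have ho := odd_norm_intCast hm
  have h1 : (⟨1, 1⟩ : GaussianInt) ^ 2 = 2 * ⟨0, 1⟩ := by decide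
  have h2 := jacobiUnit_pow_left ho (isCoprime_one_add_I ho) 2
  rw [h1, jacobiUnit_mul_left ho (isCoprime_two ho) (isCoprime_of_isUnit_left isUnit_I),
    jacobiUnit_two_intCast hm, one_mul, jacobiUnit_one_add_I hm] at h2
  rw [h2, mul_comm, zpow_mul]
  rfl

end GaussianInt

/-! ### Quartic Gauss sums and their Frobenius powers. -/

section QuarticGaussSum

open MulChar AddChar

variable {p : ℕ} [Fact p.Prime] {K : Type*} [Field K] {χ : MulChar (ZMod p) K}
  {ψ : AddChar (ZMod p) K}

/-- `g(χ)² = J(χ,χ) g(χ²)`, and `χ²` is quadratic with value 1 at `-1`, so `g(χ²)² = p`. -/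
theorem gaussSum_pow_four (h4 : χ ^ 4 = 1) (h2 : χ ^ 2 ≠ 1) (hψ : ψ.IsPrimitive) :
    gaussSum χ ψ ^ 4 = jacobiSum χ χ ^ 2 * p := by
  have hq : (χ ^ 2).IsQuadratic := by
    rw [isQuadratic_iff_sq_eq_one, ← pow_mul]
    exact h4
  have h1 : (χ ^ 2) (-1) = 1 := by
    rw [pow_apply' χ two_ne_zero, ← map_pow]
    simp
  have e1 := jacobiSum_mul_nontrivial (χ := χ) (φ := χ) (by rwa [← sq]) ψ
  have e2 := gaussSum_sq h2 hq hψ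
  rw [h1, one_mul, ZMod.card] at e2
  rw [← sq] at e1
  calc gaussSum χ ψ ^ 4 = (gaussSum χ ψ * gaussSum χ ψ) ^ 2 := by ring
    _ = _ := by rw [← e1, mul_pow, e2, mul_comm]

theorem natCast_zmod_ne_zero {l : ℕ} (hl : l.Prime) (hlp : l ≠ p) : (l : ZMod p) ≠ 0 := by
  rw [Ne, ZMod.natCast_eq_zero_iff]
  exact fun h => hlp ((Nat.prime_dvd_prime_iff_eq Fact.out hl).1 h).symm

/-- In characteristic `l`, `g(χ,ψ)^l = g(χ^l, ψ^l)`. Here `χ^l = χ`, and replacing `ψ` by `ψ^l`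
contributes `χ(l)⁻¹`; then `g` is cancelled. -/
theorem gaussSum_pow_sub_one {l : ℕ} [Fact l.Prime] [CharP K l] (h4 : χ ^ 4 = 1) (hχ : χ ≠ 1)
    (hψ : ψ.IsPrimitive) (hlp : l ≠ p) (hl : l % 4 = 1) :
    χ l * gaussSum χ ψ ^ (l - 1) = 1 := by
  have hl' : l.Prime := Fact.out
  have hu : (l : ZMod p) ≠ 0 := natCast_zmod_ne_zero hl' hlp
  have hχl : χ ^ l = χ := by
    rw [← Nat.div_add_mod l 4, hl, pow_add, pow_mul, h4, one_pow, one_mul, pow_one]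
  have hp0 : (p : K) ≠ 0 := by
    rw [Ne, CharP.cast_eq_zero_iff K l]
    exact fun h => hlp ((Nat.prime_dvd_prime_iff_eq hl' Fact.out).1 h)
  have h0 : gaussSum χ ψ ≠ 0 := gaussSum_ne_zero_of_nontrivial (by rwa [ZMod.card]) hχ hψ
  have e1 := gaussSum_frob l χ ψ
  rw [hχl, pow_mulShift] at e1
  have e2 := gaussSum_mulShift χ ψ (Units.mk0 _ hu)
  rw [Units.val_mk0, ← e1] at e2
  refine mul_right_cancel₀ h0 ?_
  rw [mul_assoc, ← pow_succ, Nat.sub_add_cancel hl'.one_le, e2, one_mul]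

/-- Now `χ^l = χ⁻¹`, so `g(χ)^l = χ(l) g(χ⁻¹)`, while `g(χ) g(χ⁻¹) = χ(-1) p`. -/
theorem gaussSum_pow_add_one {l : ℕ} [Fact l.Prime] [CharP K l] (h4 : χ ^ 4 = 1) (hχ : χ ≠ 1)
    (hψ : ψ.IsPrimitive) (hlp : l ≠ p) (hl : l % 4 = 3) :
    gaussSum χ ψ ^ (l + 1) = χ (-l) * p := by
  have hl' : l.Prime := Fact.out
  have hu : (l : ZMod p) ≠ 0 := natCast_zmod_ne_zero hl' hlp
  have hχl : χ ^ l = χ⁻¹ := by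
    rw [eq_inv_iff_mul_eq_one, ← pow_succ]
    obtain ⟨k, rfl⟩ : ∃ k, l = 4 * k + 3 := ⟨l / 4, by omega⟩
    rw [show 4 * k + 3 + 1 = 4 * (k + 1) by ring, pow_mul, h4, one_pow]
  have e1 := gaussSum_frob l χ ψ
  rw [hχl, pow_mulShift] at e1
  have e2 := gaussSum_mulShift χ⁻¹ ψ (Units.mk0 _ hu)
  rw [Units.val_mk0, ← e1] at e2
  have e3 := gaussSum_mul_gaussSum_eq_card hχ hψ
  rw [ZMod.card] at e3
  have e4 := mul_gaussSum_inv_eq_gaussSum χ⁻¹ ψ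
  have e5 : χ⁻¹ (-1) = χ (-1) := by rw [MulChar.inv_apply', inv_neg, inv_one]
  have e6 : χ l * χ⁻¹ l = 1 := by
    rw [MulChar.inv_apply', ← map_mul, mul_inv_cancel₀ hu, map_one]
  have e7 : χ (-l) = χ (-1) * χ l := by rw [← map_mul, neg_one_mul]
  rw [e5] at e4
  rw [e7, pow_succ, ← e3]
  linear_combination (-gaussSum χ ψ * gaussSum χ ψ ^ l) * e6 + χ l * gaussSum χ ψ * e2 -
    χ l * gaussSum χ ψ * e4

end QuarticGaussSum

/-! ### The quartic character modulo `π` and its Jacobi sum. -/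

namespace GaussianInt

/-- Reduction modulo a Gaussian prime of prime norm. -/
theorem exists_ringHom_zmod {π : GaussianInt} (hπ : Prime π) {p : ℕ} [hp : Fact p.Prime]
    (hn : π.norm = p) :
    ∃ ρ : GaussianInt →+* ZMod p, ∀ z, ρ z = 0 ↔ π ∣ z := by
  have hsum : ((π.re : ZMod p)) ^ 2 + (π.im : ZMod p) ^ 2 = 0 := by
    have h1 : ((π.norm : ℤ) : ZMod p) = 0 := by rw [hn]; simp
    rw [Zsqrtd.norm_def] at h1
    push_cast at h1
    linear_combination h1
  have him : (π.im : ZMod p) ≠ 0 := by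
    intro h0
    have h1 : (π.re : ZMod p) = 0 := by
      rw [h0] at hsum
      simpa using hsum
    rw [ZMod.intCast_zmod_eq_zero_iff_dvd] at h0 h1
    have h2 : (p : ℤ) ^ 2 ∣ p := by
      obtain ⟨a, ha⟩ := h0
      obtain ⟨b, hb⟩ := h1
      refine ⟨b ^ 2 + a ^ 2, ?_⟩
      conv_lhs => rw [← hn, Zsqrtd.norm_def, ha, hb]
      ring
    have h3 := Int.natAbs_dvd_natAbs.2 h2
    rw [Int.natAbs_pow, Int.natAbs_natCast] at h3
    have h4 := Nat.le_of_dvd hp.1.pos h3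
    have h5 := hp.1.two_le
    nlinarith
  -- The image of `i` is forced by `π ↦ 0`.
  let ρ : GaussianInt →+* ZMod p := Zsqrtd.lift ⟨-(π.re : ZMod p) / π.im, by
    field_simp
    push_cast
    linear_combination hsum⟩
  have hρ : ρ π = 0 := by
    simp only [ρ, Zsqrtd.lift_apply_apply]
    field_simp
    ring
  refine ⟨ρ, fun z => ⟨fun hz => ?_, ?_⟩⟩
  · by_contra hd
    obtain ⟨a, b, hab⟩ := (hπ.irreducible.coprime_iff_not_dvd).2 hd
    have := congrArg ρ hab
    simp [hρ, hz] at this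
  · rintro ⟨w, rfl⟩
    rw [map_mul, hρ, zero_mul]

theorem ringHom_zmod_natCast_val {p : ℕ} [Fact p.Prime] (ρ : GaussianInt →+* ZMod p) (a : ZMod p) :
    ρ (a.val : GaussianInt) = a := by
  rw [map_natCast, ZMod.natCast_zmod_val]

theorem natPrime_mod_four {π : GaussianInt} {p : ℕ} (ho : Odd π.norm) (hn : π.norm = p) : p % 4 = 1 := by
  have := natAbs_norm_mod_four ho
  rwa [hn, Int.natAbs_natCast] at this

variable {p : ℕ} [hp : Fact p.Prime] {π : GaussianInt}

open Classical in
/-- The quartic residue symbol modulo `π` as a multiplicative character on `ZMod p`. -/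
noncomputable def quarticChar (hπ : Prime π) (ho : Odd π.norm) (hn : π.norm = p) :
    MulChar (ZMod p) GaussianInt where
  toFun a := quarticResidueSymbol (a.val : GaussianInt) π
  map_one' := by
    obtain ⟨ρ, hρ⟩ := exists_ringHom_zmod hπ hn
    have h1 : quarticResidueSymbol ((1 : ZMod p).val : GaussianInt) π =
        quarticResidueSymbol 1 π := by
      refine quarticResidueSymbol_congr hπ ho ((hρ _).1 ?_)
      rw [map_sub, ringHom_zmod_natCast_val, map_one, sub_self]
    rw [h1]
    exact quarticResidueSymbol_eq_of_dvd (u := 1) hπ ho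
      (fun h => hπ.not_isUnit (isUnit_of_dvd_one h)) (by simp)
  map_mul' a b := by
    obtain ⟨ρ, hρ⟩ := exists_ringHom_zmod hπ hn
    rw [← quarticResidueSymbol_mul hπ ho]
    refine quarticResidueSymbol_congr hπ ho ((hρ _).1 ?_)
    simp only [map_sub, map_mul, ringHom_zmod_natCast_val, sub_self]
  map_nonunit' a ha := by
    have h0 : a = 0 := by
      by_contra h
      exact ha (isUnit_iff_ne_zero.2 h)
    rw [h0, ZMod.val_zero, Nat.cast_zero, quarticResidueSymbol, if_pos (dvd_zero _)]

theorem quarticChar_apply (hπ : Prime π) (ho : Odd π.norm) (hn : π.norm = p) (a : ZMod p) :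
    quarticChar hπ ho hn a = quarticResidueSymbol (a.val : GaussianInt) π := rfl

theorem quarticChar_apply_of_ne_zero (hπ : Prime π) (ho : Odd π.norm) (hn : π.norm = p)
    {a : ZMod p} (ha : a ≠ 0) {z : GaussianInt} {ρ : GaussianInt →+* ZMod p}
    (hρ : ∀ z, ρ z = 0 ↔ π ∣ z) (hz : ρ z = a) :
    quarticChar hπ ho hn a = jacobiUnit z π := by
  have hd : ¬ π ∣ z := by rwa [← hρ, hz]
  rw [quarticChar_apply, coe_jacobiUnit ho ((hπ.irreducible.coprime_iff_not_dvd).2 hd).symm,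
    quarticJacobiSymbol_prime hπ]
  refine quarticResidueSymbol_congr hπ ho ((hρ _).1 ?_)
  rw [map_sub, ringHom_zmod_natCast_val, hz, sub_self]

theorem quarticChar_apply_intCast (hπ : Prime π) (ho : Odd π.norm) (hn : π.norm = p)
    {n : ℤ} (ha : (n : ZMod p) ≠ 0) :
    quarticChar hπ ho hn n = jacobiUnit (n : GaussianInt) π := by
  obtain ⟨ρ, hρ⟩ := exists_ringHom_zmod hπ hn
  exact quarticChar_apply_of_ne_zero hπ ho hn ha hρ (by simp)

theorem exists_unit_quarticChar (hπ : Prime π) (ho : Odd π.norm) (hn : π.norm = p)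
    {a : ZMod p} (ha : a ≠ 0) : ∃ u : GaussianIntˣ, quarticChar hπ ho hn a = u := by
  obtain ⟨ρ, hρ⟩ := exists_ringHom_zmod hπ hn
  exact ⟨_, quarticChar_apply_of_ne_zero hπ ho hn ha hρ (ringHom_zmod_natCast_val ρ a)⟩

theorem quarticChar_pow_four (hπ : Prime π) (ho : Odd π.norm) (hn : π.norm = p) :
    quarticChar hπ ho hn ^ 4 = 1 := by
  refine MulChar.ext fun a => ?_
  obtain ⟨u, hu⟩ := exists_unit_quarticChar hπ ho hn a.ne_zero
  rw [MulChar.pow_apply_coe, MulChar.one_apply_coe, hu, ← Units.val_pow_eq_pow_val, unit_pow_four]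
  rfl

theorem ringHom_quarticChar (hπ : Prime π) (ho : Odd π.norm) (hn : π.norm = p)
    {ρ : GaussianInt →+* ZMod p} (hρ : ∀ z, ρ z = 0 ↔ π ∣ z) (a : ZMod p) :
    ρ (quarticChar hπ ho hn a) = a ^ ((p - 1) / 4) := by
  have h4 := natPrime_mod_four ho hn
  by_cases ha : a = 0
  · have h1 := hp.1.one_lt
    rw [ha, MulChar.map_zero, map_zero, zero_pow (by omega)]
  · have hz := ringHom_zmod_natCast_val ρ a
    have hd : ¬ π ∣ (a.val : GaussianInt) := by rwa [← hρ, hz]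
    rw [quarticChar_apply_of_ne_zero hπ ho hn ha hρ hz]
    have h5 := (hρ _).2 (dvd_pow_sub_jacobiUnit hπ ho hd)
    rw [map_sub, map_pow, hz, hn, Int.natAbs_natCast, sub_eq_zero] at h5
    exact h5.symm

/-- Modulo `π` the square of the character is `a^((p-1)/2)`, which by Euler's criterion is not 1 at
a nonsquare. -/
theorem quarticChar_sq_ne_one (hπ : Prime π) (ho : Odd π.norm) (hn : π.norm = p) :
    quarticChar hπ ho hn ^ 2 ≠ 1 := by
  intro h
  have h4 := natPrime_mod_four ho hn
  obtain ⟨ρ, hρ⟩ := exists_ringHom_zmod hπ hn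
  obtain ⟨a, ha⟩ := FiniteField.exists_nonsquare (F := ZMod p) (by rw [ZMod.ringChar_zmod_n]; omega)
  have h0 : a ≠ 0 := by
    rintro rfl
    exact ha (IsSquare.zero)
  refine ha ((ZMod.euler_criterion p h0).2 ?_)
  have h1 : (quarticChar hπ ho hn ^ 2) a = 1 := by
    rw [h]
    exact MulChar.one_apply (isUnit_iff_ne_zero.2 h0)
  rw [MulChar.pow_apply' _ two_ne_zero] at h1
  have h2 := congrArg ρ h1
  rw [map_pow, ringHom_quarticChar hπ ho hn hρ, map_one, ← pow_mul] at h2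
  rw [← h2]
  congr 1
  omega

theorem quarticChar_ne_one (hπ : Prime π) (ho : Odd π.norm) (hn : π.norm = p) :
    quarticChar hπ ho hn ≠ 1 := by
  intro h
  apply quarticChar_sq_ne_one hπ ho hn
  rw [h, one_pow]

/-- Modulo `π` the Jacobi sum is the sum over `x` of `x^n (1-x)^n` with `n = (p-1)/4`. The degree
`2n` is below `p - 1`, and sums of such powers over `ZMod p` vanish. -/
theorem dvd_jacobiSum (hπ : Prime π) (ho : Odd π.norm) (hn : π.norm = p) :
    π ∣ jacobiSum (quarticChar hπ ho hn) (quarticChar hπ ho hn) := by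
  have h4 := natPrime_mod_four ho hn
  have h2 := hp.1.two_le
  obtain ⟨ρ, hρ⟩ := exists_ringHom_zmod hπ hn
  rw [← hρ, jacobiSum, map_sum]
  simp only [map_mul, ringHom_quarticChar hπ ho hn hρ]
  have h1 : ∀ x : ZMod p, x ^ ((p - 1) / 4) * (1 - x) ^ ((p - 1) / 4) =
      ∑ m ∈ Finset.range ((p - 1) / 4 + 1), x ^ ((p - 1) / 4 + m) *
        ((-1) ^ m * (((p - 1) / 4).choose m : ZMod p)) := by
    intro x
    rw [sub_eq_add_neg, add_comm (1 : ZMod p), add_pow, Finset.mul_sum]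
    refine Finset.sum_congr rfl fun m _ => ?_
    rw [neg_pow, one_pow, pow_add]
    ring
  simp only [h1]
  rw [Finset.sum_comm]
  refine Finset.sum_eq_zero fun m hm => ?_
  rw [← Finset.sum_mul, FiniteField.sum_pow_lt_card_sub_one, zero_mul]
  rw [ZMod.card]
  rw [Finset.mem_range] at hm
  omega

theorem star_quarticChar (hπ : Prime π) (ho : Odd π.norm) (hn : π.norm = p) (a : ZMod p) :
    star (quarticChar hπ ho hn a) = (quarticChar hπ ho hn)⁻¹ a := by
  by_cases ha : a = 0
  · rw [ha, MulChar.map_zero, MulChar.map_zero, star_zero]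
  · obtain ⟨u, hu⟩ := exists_unit_quarticChar hπ ho hn ha
    rw [MulChar.inv_apply_eq_inv, hu, Ring.inverse_unit, star_unit]

/-- Conjugation replaces `χ` by `χ⁻¹`. The product formula for `J(χ,χ) J(χ⁻¹,χ⁻¹)`, valid because
`χ` and `χ²` are nontrivial, is applied in `ℂ`. -/
theorem jacobiSum_mul_star (hπ : Prime π) (ho : Odd π.norm) (hn : π.norm = p) :
    jacobiSum (quarticChar hπ ho hn) (quarticChar hπ ho hn) *
      star (jacobiSum (quarticChar hπ ho hn) (quarticChar hπ ho hn)) = p := by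
  have h1 : star (jacobiSum (quarticChar hπ ho hn) (quarticChar hπ ho hn)) =
      jacobiSum (quarticChar hπ ho hn)⁻¹ (quarticChar hπ ho hn)⁻¹ := by
    rw [jacobiSum, star_sum, jacobiSum]
    simp only [star_mul', star_quarticChar]
  rw [h1]
  apply toComplex_injective
  have hc := MulChar.ringHomComp_ne_one_iff (R := ZMod p) toComplex_injective (χ := quarticChar hπ ho hn)
  have hc2 := MulChar.ringHomComp_ne_one_iff (R := ZMod p) toComplex_injective
    (χ := quarticChar hπ ho hn ^ 2)
  have h2 := jacobiSum_mul_jacobiSum_inv (F := ZMod p) (F' := ℂ)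
    (χ := (quarticChar hπ ho hn).ringHomComp toComplex)
    (φ := (quarticChar hπ ho hn).ringHomComp toComplex)
    (by rw [ZMod.ringChar_zmod_n, ringChar.eq_zero]; exact hp.1.ne_zero.symm)
    (hc.2 (quarticChar_ne_one hπ ho hn)) (hc.2 (quarticChar_ne_one hπ ho hn))
    (by rw [← sq, MulChar.ringHomComp_pow]; exact hc2.2 (quarticChar_sq_ne_one hπ ho hn))
  rw [MulChar.ringHomComp_inv, jacobiSum_ringHomComp, jacobiSum_ringHomComp, ZMod.card] at h2
  rw [map_mul, h2, map_natCast]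

/-- `J ≡ -1` modulo `(i-1)² = -2i`. This selects the associate of `π` up to sign, and the sign is
harmless because `-1` has trivial symbol modulo odd integers. -/
theorem jacobiSum_even_im (hπ : Prime π) (ho : Odd π.norm) (hn : π.norm = p) :
    Even (jacobiSum (quarticChar hπ ho hn) (quarticChar hπ ho hn)).im := by
  have h4 := natPrime_mod_four ho hn
  have hI : IsPrimitiveRoot (⟨0, 1⟩ : GaussianInt) 4 := by
    refine IsPrimitiveRoot.mk_of_lt _ (by norm_num) (by decide) ?_
    intro l h0 h1
    interval_cases l <;> decide
  obtain ⟨z, -, hz⟩ := exists_jacobiSum_eq_neg_one_add (n := 4) (by norm_num)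
    (quarticChar_pow_four hπ ho hn) (quarticChar_pow_four hπ ho hn)
    (by rw [ZMod.card]; omega) hI
  rw [hz]
  have h1 : ((⟨0, 1⟩ : GaussianInt) - 1) ^ 2 = ⟨0, -2⟩ := by decide
  rw [h1]
  refine ⟨-z.re, ?_⟩
  simp
  ring

/-- `π` divides `J`, and both have norm `p`. -/
theorem associated_jacobiSum (hπ : Prime π) (ho : Odd π.norm) (hn : π.norm = p) :
    Associated π (jacobiSum (quarticChar hπ ho hn) (quarticChar hπ ho hn)) := by
  have h1 := jacobiSum_mul_star hπ ho hn
  obtain ⟨w, hw⟩ := dvd_jacobiSum hπ ho hn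
  rw [← Zsqrtd.norm_eq_mul_conj, hw, Zsqrtd.norm_mul, hn] at h1
  have h2 : (p : ℤ) * w.norm = p := by exact_mod_cast h1
  have h3 : w.norm = 1 := by
    have hp0 : (p : ℤ) ≠ 0 := by exact_mod_cast hp.1.ne_zero
    exact mul_left_cancel₀ hp0 (by rw [h2, mul_one])
  rw [hw]
  exact associated_mul_unit_right π w ((Zsqrtd.norm_eq_one_iff' (by norm_num) w).1 h3)

/-! ### Reciprocity for rational primes, by Gauss sums in characteristic `l`. -/

/-- A field of characteristic `l ≠ p` has an extension with primitive additive characters on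
`ZMod p`. -/
theorem exists_extension_primitive_addChar (F : Type) [Field F] {l : ℕ} [hl : Fact l.Prime]
    [CharP F l] (hlp : l ≠ p) :
    ∃ (K : Type) (_ : Field K) (_ : CharP K l) (_ : F →+* K) (ψ : AddChar (ZMod p) K),
      ψ.IsPrimitive := by
  have hp0 : (p : F) ≠ 0 := by
    rw [Ne, CharP.cast_eq_zero_iff _ l]
    exact fun h => hlp ((Nat.prime_dvd_prime_iff_eq hl.1 hp.1).1 h)
  let n : ℕ+ := ⟨p, hp.1.pos⟩
  let ψ : AddChar.PrimitiveAddChar (ZMod p) F := AddChar.primitiveZModChar n F hp0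
  exact ⟨CyclotomicField ψ.n F, inferInstance,
    charP_of_injective_algebraMap (algebraMap F _).injective l, algebraMap F _, ψ.char, ψ.prim⟩

/-- For a Gaussian prime above `l`, there is a field of characteristic `l` containing its residue
field and having primitive additive characters on `ZMod p`. -/
theorem exists_primitive_addChar {l : ℕ} [hl : Fact l.Prime] (hlp : l ≠ p) {ϖ : GaussianInt}
    (hϖ : Prime ϖ) (hd : ϖ ∣ l) :
    ∃ (K : Type) (_ : Field K) (_ : CharP K l) (φ : GaussianInt →+* K)
      (ψ : AddChar (ZMod p) K), ψ.IsPrimitive ∧ ∀ z, φ z = 0 ↔ ϖ ∣ z := by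
  have hmax : (Ideal.span {ϖ}).IsMaximal :=
    PrincipalIdealRing.isMaximal_of_irreducible hϖ.irreducible
  let _ : Field (GaussianInt ⧸ Ideal.span {ϖ}) := Ideal.Quotient.field _
  have hker : ∀ z, Ideal.Quotient.mk (Ideal.span {ϖ}) z = 0 ↔ ϖ ∣ z := fun z => by
    rw [Ideal.Quotient.eq_zero_iff_mem, Ideal.mem_span_singleton]
  have hchar : CharP (GaussianInt ⧸ Ideal.span {ϖ}) l := by
    rw [CharP.charP_iff_prime_eq_zero hl.1, ← map_natCast (Ideal.Quotient.mk (Ideal.span {ϖ}))]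
    exact (hker _).2 hd
  obtain ⟨K, _, hK, f, ψ, hψ⟩ := exists_extension_primitive_addChar (GaussianInt ⧸ Ideal.span {ϖ}) hlp
  refine ⟨K, _, hK, f.comp (Ideal.Quotient.mk (Ideal.span {ϖ})), ψ, hψ, fun z => ?_⟩
  rw [RingHom.comp_apply, map_eq_zero_iff _ f.injective, hker]

theorem isCoprime_natPrime_left {l : ℕ} (hl : l.Prime) (hlp : l ≠ p) (hn : π.norm = p) :
    IsCoprime (l : GaussianInt) π := by
  have h1 := Nat.isCoprime_iff_coprime.2 ((Nat.coprime_primes hl hp.1).2 hlp)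
  have h2 := isCoprime_intCast h1
  have h3 : ((p : ℤ) : GaussianInt) = π * star π := by rw [← hn, Zsqrtd.norm_eq_mul_conj]
  rw [h3, Int.cast_natCast] at h2
  exact h2.of_mul_right_left

theorem unit_eq_one_of_map_eq_one {ϖ : GaussianInt} (hϖ : Prime ϖ) (hϖo : Odd ϖ.norm)
    {K : Type*} [Field K] {φ : GaussianInt →+* K} (hφ : ∀ z, φ z = 0 ↔ ϖ ∣ z)
    {u : GaussianIntˣ} (hu : φ u = 1) : u = 1 := by
  refine unit_eq_of_dvd_sub hϖ hϖo ?_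
  rw [← hφ, map_sub, hu, Units.val_one, map_one, sub_self]

theorem ringHomComp_quarticChar_apply (hπ : Prime π) (ho : Odd π.norm) (hn : π.norm = p)
    {K : Type*} [Field K] (φ : GaussianInt →+* K) {n : ℤ} (hn' : (n : ZMod p) ≠ 0) :
    (quarticChar hπ ho hn).ringHomComp φ n = φ (jacobiUnit (n : GaussianInt) π) := by
  rw [MulChar.ringHomComp_apply, quarticChar_apply_intCast hπ ho hn hn']

theorem ringHomComp_quarticChar_pow_four (hπ : Prime π) (ho : Odd π.norm) (hn : π.norm = p)
    {K : Type*} [Field K] (φ : GaussianInt →+* K) :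
    (quarticChar hπ ho hn).ringHomComp φ ^ 4 = 1 := by
  rw [MulChar.ringHomComp_pow, quarticChar_pow_four, MulChar.ringHomComp_one]

theorem ringHomComp_quarticChar_sq_ne_one (hπ : Prime π) (ho : Odd π.norm) (hn : π.norm = p)
    {ϖ : GaussianInt} (hϖ : Prime ϖ) (hϖo : Odd ϖ.norm)
    {K : Type*} [Field K] {φ : GaussianInt →+* K} (hφ : ∀ z, φ z = 0 ↔ ϖ ∣ z) :
    (quarticChar hπ ho hn).ringHomComp φ ^ 2 ≠ 1 := by
  intro h2
  refine quarticChar_sq_ne_one hπ ho hn (MulChar.ext fun a => ?_)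
  have h6 := quarticChar_apply_intCast hπ ho hn (n := (a : ZMod p).val) (by simp)
  have h7 := ringHomComp_quarticChar_apply hπ ho hn φ (n := (a : ZMod p).val) (by simp)
  have h5 : jacobiUnit (((a : ZMod p).val : ℤ) : GaussianInt) π ^ 2 = 1 := by
    refine unit_eq_one_of_map_eq_one hϖ hϖo hφ ?_
    rw [Units.val_pow_eq_pow_val, map_pow, ← h7, ← MulChar.pow_apply' _ two_ne_zero, h2]
    exact MulChar.one_apply (by simp)
  rw [Int.cast_natCast, ZMod.natCast_zmod_val] at h6
  rw [MulChar.pow_apply_coe, h6, ← Units.val_pow_eq_pow_val, h5, MulChar.one_apply_coe]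
  rfl

/-- Reciprocity between a rational prime congruent to `1` modulo `4` and a Jacobi sum. -/
theorem jacobiUnit_jacobiSum_of_mod_four_eq_one (hπ : Prime π) (ho : Odd π.norm) (hn : π.norm = p)
    {l : ℕ} (hl : l.Prime) (h1 : l % 4 = 1) (hlp : l ≠ p) :
    jacobiUnit (l : GaussianInt) π =
      jacobiUnit (jacobiSum (quarticChar hπ ho hn) (quarticChar hπ ho hn)) l := by
  have := Fact.mk hl
  have hJp := jacobiSum_mul_star hπ ho hn
  have hJa := associated_jacobiSum hπ ho hn
  set J := jacobiSum (quarticChar hπ ho hn) (quarticChar hπ ho hn) with hJ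
  obtain ⟨ϖ, hϖ, hϖo, hϖn, hϖl⟩ := exists_prime_of_mod_four_eq_one hl h1
  have hd : ϖ ∣ (l : GaussianInt) := hϖl ▸ dvd_mul_right _ _
  have hcop : IsCoprime J (l : GaussianInt) :=
    ((isCoprime_natPrime_left hl hlp hn).of_isCoprime_of_dvd_right hJa.symm.dvd).symm
  have hcop' : IsCoprime J ϖ := hcop.of_isCoprime_of_dvd_right hd
  have hcop'' : IsCoprime (star J) ϖ := by
    have := isCoprime_star (hcop.of_isCoprime_of_dvd_right (hϖl ▸ dvd_mul_left (star ϖ) ϖ))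
    rwa [star_star] at this
  obtain ⟨K, _, hK, φ, ψ, hψ, hφ⟩ := exists_primitive_addChar (p := p) hlp hϖ hd
  set χ := (quarticChar hπ ho hn).ringHomComp φ with hχ
  have hlz := natCast_zmod_ne_zero hl hlp
  have h4 : χ ^ 4 = 1 := ringHomComp_quarticChar_pow_four hπ ho hn φ
  have h2 : χ ^ 2 ≠ 1 := ringHomComp_quarticChar_sq_ne_one hπ ho hn hϖ hϖo hφ
  have hχ1 : χ ≠ 1 := by
    intro h
    apply h2
    rw [h, one_pow]
  have e1 := gaussSum_pow_four h4 h2 hψ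
  have e2 := gaussSum_pow_sub_one (l := l) h4 hχ1 hψ hlp h1
  have e3 : jacobiSum χ χ = φ J := jacobiSum_ringHomComp _ _ φ
  obtain ⟨k, hk⟩ : ∃ k, l - 1 = 4 * k := ⟨(l - 1) / 4, by omega⟩
  have e4 : φ (star J ^ k) = φ (jacobiUnit (star J) ϖ) ∧ φ (J ^ k) = φ (jacobiUnit J ϖ) := by
    have hk' : (ϖ.norm.natAbs - 1) / 4 = k := by
      rw [hϖn, Int.natAbs_natCast]
      omega
    constructor
    · have := dvd_pow_sub_jacobiUnit hϖ hϖo (α := star J)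
        (fun h => hϖ.not_isUnit (hcop''.isUnit_of_dvd' h dvd_rfl))
      rwa [hk', ← hφ, map_sub, sub_eq_zero] at this
    · have := dvd_pow_sub_jacobiUnit hϖ hϖo (α := J)
        (fun h => hϖ.not_isUnit (hcop'.isUnit_of_dvd' h dvd_rfl))
      rwa [hk', ← hφ, map_sub, sub_eq_zero] at this
  have e5 : (p : K) = φ J * φ (star J) := by rw [← map_mul, hJp, map_natCast]
  have e6 := ringHomComp_quarticChar_apply hπ ho hn φ (n := l) (by simpa using hlz)
  simp only [Int.cast_natCast, ← hχ] at e6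
  -- Since `g⁴ = J³J̄`, the identity `χ(l) g^(l-1) = 1` becomes `(l/π)₄ (J/ϖ)₄³ (J̄/ϖ)₄ = 1`. Here
  -- the cube is an inverse, and the splitting of `l` turns the result into `(J/l)₄`.
  rw [hk, pow_mul, e1, e3, e5, e6] at e2
  have e7 : (φ J ^ 2 * (φ J * φ (star J))) ^ k = φ (J ^ k) ^ 3 * φ (star J ^ k) := by
    rw [map_pow, map_pow]
    ring
  rw [e7, e4.1, e4.2] at e2
  have e8 := unit_eq_one_of_map_eq_one hϖ hϖo hφ
    (u := jacobiUnit (l : GaussianInt) π * (jacobiUnit J ϖ ^ 3 * jacobiUnit (star J) ϖ)) (by simpa using e2)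
  rw [jacobiUnit_split hϖo hϖl hcop]
  have e9 := unit_pow_four (jacobiUnit J ϖ)
  generalize jacobiUnit (l : GaussianInt) π = a at e8 ⊢
  generalize jacobiUnit J ϖ = b at e8 e9 ⊢
  generalize jacobiUnit (star J) ϖ = c at e8 ⊢
  rw [pow_succ] at e9
  rw [eq_inv_of_mul_eq_one_left e8, eq_inv_of_mul_eq_one_left e9, mul_inv, inv_inv]

/-- Modulo the inert prime `l` Frobenius is conjugation, so `p = J^(l+1)` and `g^(l+1) =
(J²p)^((l+1)/4)` are powers of `J`. Cancelling `p` in `g^(l+1) = χ(-l) p` leaves exactly the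
exponent `(l² - 1)/4` that defines the symbol modulo `l`. -/
theorem jacobiUnit_jacobiSum_of_mod_four_eq_three (hπ : Prime π) (ho : Odd π.norm)
    (hn : π.norm = p) {l : ℕ} (hl : l.Prime) (h3 : l % 4 = 3) (hlp : l ≠ p) :
    jacobiUnit (-(l : GaussianInt)) π =
      jacobiUnit (jacobiSum (quarticChar hπ ho hn) (quarticChar hπ ho hn)) l := by
  have := Fact.mk hl
  have hJp := jacobiSum_mul_star hπ ho hn
  have hJa := associated_jacobiSum hπ ho hn
  set J := jacobiSum (quarticChar hπ ho hn) (quarticChar hπ ho hn) with hJ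
  have hϖ := prime_of_nat_prime_of_mod_four_eq_three l h3
  have hϖo : Odd (l : GaussianInt).norm := odd_norm_natCast (Nat.odd_iff.2 (by omega))
  have hcop : IsCoprime J (l : GaussianInt) :=
    ((isCoprime_natPrime_left hl hlp hn).of_isCoprime_of_dvd_right hJa.symm.dvd).symm
  obtain ⟨K, _, hK, φ, ψ, hψ, hφ⟩ := exists_primitive_addChar (p := p) hlp hϖ dvd_rfl
  set χ := (quarticChar hπ ho hn).ringHomComp φ with hχ
  have hlz := natCast_zmod_ne_zero hl hlp
  have h4 : χ ^ 4 = 1 := ringHomComp_quarticChar_pow_four hπ ho hn φ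
  have h2 : χ ^ 2 ≠ 1 := ringHomComp_quarticChar_sq_ne_one hπ ho hn hϖ hϖo hφ
  have hχ1 : χ ≠ 1 := by
    intro h
    apply h2
    rw [h, one_pow]
  have e1 := gaussSum_pow_four h4 h2 hψ
  have e2 := gaussSum_pow_add_one (l := l) h4 hχ1 hψ hlp h3
  have e3 : jacobiSum χ χ = φ J := jacobiSum_ringHomComp _ _ φ
  obtain ⟨k, hk⟩ : ∃ k, l = 4 * k + 3 := ⟨l / 4, by omega⟩
  have e5 : (p : K) = φ J * φ (star J) := by rw [← map_mul, hJp, map_natCast]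
  have e6 := ringHomComp_quarticChar_apply hπ ho hn φ (n := -l) (by simpa using hlz)
  simp only [Int.cast_natCast, Int.cast_neg, ← hχ] at e6
  have e7 : φ (star J) = φ J ^ l := by
    have := pow_sub_star_dvd h3 J
    rw [← hφ, map_sub, map_pow, sub_eq_zero] at this
    exact this.symm
  have hJ0 : φ J ≠ 0 := by
    rw [Ne, hφ]
    exact fun h => hϖ.not_isUnit (hcop.isUnit_of_dvd' h dvd_rfl)
  have e8 : φ J ^ ((l ^ 2 - 1) / 4) = φ (jacobiUnit (-(l : GaussianInt)) π) := by
    rw [show l + 1 = 4 * (k + 1) by omega, pow_mul, e1, e3, e5, e7, e6] at e2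
    have he : (l ^ 2 - 1) / 4 = (l - 1) * (k + 1) := by
      rw [hk]
      have h2 : 4 * k + 3 - 1 = 4 * k + 2 := by omega
      have : (4 * k + 3) ^ 2 - 1 = 4 * ((4 * k + 2) * (k + 1)) := by
        rw [Nat.sub_eq_iff_eq_add (by nlinarith)]
        ring
      rw [this, Nat.mul_div_cancel_left _ (by norm_num), h2]
    refine mul_right_cancel₀ (pow_ne_zero (l + 1) hJ0) ?_
    rw [pow_succ' _ l, ← e2, he, ← pow_succ', ← pow_add, ← pow_add, ← pow_mul]
    congr 1
    rw [hk]
    have h2 : 4 * k + 3 - 1 = 4 * k + 2 := by omega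
    rw [h2]
    ring
  refine (jacobiUnit_eq_of_dvd hϖ hϖo ?_).symm
  rw [norm_natCast_natAbs, ← hφ, map_sub, map_pow, e8, sub_self]

theorem jacobiUnit_neg_one_intCast {m : ℤ} (hm : Odd m) :
    jacobiUnit (-1) (m : GaussianInt) = 1 := by
  have := jacobiUnit_intCast_intCast hm (n := -1) isCoprime_one_left.neg_left
  simpa using this

theorem jacobiUnit_neg_left {α β : GaussianInt} (hβ : Odd β.norm) (h : IsCoprime α β) :
    jacobiUnit (-α) β = jacobiUnit (-1) β * jacobiUnit α β := by
  rw [← neg_one_mul α, jacobiUnit_mul_left hβ (isCoprime_of_isUnit_left isUnit_one.neg) h]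

theorem isCoprime_signedOdd {α : GaussianInt} {n : ℤ} (h : IsCoprime α (n : GaussianInt)) :
    IsCoprime α (signedOdd n : GaussianInt) := by
  rcases signedOdd_eq_or n with e | e <;> rw [e]
  · exact h
  · rw [Int.cast_neg]
    exact h.neg_right

/-- Reciprocity between odd integers and a Jacobi sum. -/
theorem jacobiUnit_signedOdd_prime {p : ℕ} [hp : Fact p.Prime] {π : GaussianInt} (hπ : Prime π)
    (ho : Odd π.norm) (hn : π.norm = p) {n : ℤ} (hodd : Odd n)
    (hc : IsCoprime π (n : GaussianInt)) :
    jacobiUnit (signedOdd n : GaussianInt) π =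
      jacobiUnit (jacobiSum (quarticChar hπ ho hn) (quarticChar hπ ho hn)) (n : GaussianInt) := by
  have hJa := associated_jacobiSum hπ ho hn
  set J := jacobiSum (quarticChar hπ ho hn) (quarticChar hπ ho hn) with hJ
  rw [jacobiUnit_intCast_natAbs hodd (hc.of_isCoprime_of_dvd_left hJa.symm.dvd),
    ← signedOdd_natAbs hodd]
  have hc' : IsCoprime π (n.natAbs : GaussianInt) := by
    rcases Int.natAbs_eq n with e | e
    · rwa [e, Int.cast_natCast] at hc
    · rwa [e, Int.cast_neg, IsCoprime.neg_right_iff, Int.cast_natCast] at hc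
  revert hc'
  refine odd_nat_induction (P := fun k => IsCoprime π (k : GaussianInt) →
    jacobiUnit (signedOdd k : GaussianInt) π = jacobiUnit J (k : GaussianInt)) ?_ ?_ ?_ _
    (Int.natAbs_odd.2 hodd)
  · intro _
    rw [Nat.cast_one (R := GaussianInt), jacobiUnit_isUnit_right isUnit_one]
    simpa [signedOdd] using jacobiUnit_one_left ho
  · intro q a _ hq ha h1 h2 hc
    rw [Nat.cast_mul (α := GaussianInt)] at hc ⊢
    have hc1 := hc.of_mul_right_left
    have hc2 := hc.of_mul_right_right
    have hs1 := isCoprime_signedOdd (n := q) (α := π) (by simpa using hc1)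
    have hs2 := isCoprime_signedOdd (n := a) (α := π) (by simpa using hc2)
    rw [jacobiUnit_mul_right (odd_norm_natCast hq) (odd_norm_natCast ha)
      (hc1.of_isCoprime_of_dvd_left hJa.symm.dvd) (hc2.of_isCoprime_of_dvd_left hJa.symm.dvd),
      ← h1 hc1, ← h2 hc2, Nat.cast_mul,
      signedOdd_mul ((Int.odd_coe_nat q).2 hq) ((Int.odd_coe_nat a).2 ha), Int.cast_mul,
      jacobiUnit_mul_left ho hs1.symm hs2.symm]
  · intro l hl hlo hc
    have hlp : l ≠ p := by
      rintro rfl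
      have hd : π ∣ (l : GaussianInt) := by
        refine ⟨star π, ?_⟩
        rw [← Zsqrtd.norm_eq_mul_conj, hn, Int.cast_natCast]
      exact hπ.not_isUnit (hc.isUnit_of_dvd' dvd_rfl hd)
    rw [Nat.odd_iff] at hlo
    have h13 : l % 4 = 1 ∨ l % 4 = 3 := by omega
    rcases h13 with h1 | h3
    · rw [signedOdd_unique (n := l) (Or.inl rfl) (by omega), Int.cast_natCast]
      exact jacobiUnit_jacobiSum_of_mod_four_eq_one hπ ho hn hl h1 hlp
    · rw [signedOdd_unique (n := -l) (Or.inr rfl) (by omega), Int.cast_neg, Int.cast_natCast]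
      exact jacobiUnit_jacobiSum_of_mod_four_eq_three hπ ho hn hl h3 hlp

/-! ### Quartic reciprocity with one rational argument. -/

/-- Even imaginary part is preserved by products, so the existence of a good associate passes from
primes to products. For a split prime the associate is the Jacobi sum; for an inert prime it is the
rational prime itself, and both symbols are 1. -/
theorem exists_unit_reciprocity {n : ℤ} (hodd : Odd n) (α : GaussianInt) (hα : Odd α.norm)
    (hc : IsCoprime α (n : GaussianInt)) :
    ∃ u : GaussianIntˣ, Even ((u : GaussianInt) * α).im ∧
      jacobiUnit (signedOdd n : GaussianInt) α =
        jacobiUnit ((u : GaussianInt) * α) (n : GaussianInt) := by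
  have hno := odd_norm_intCast hodd
  revert hc
  refine odd_induction (P := fun α => IsCoprime α (n : GaussianInt) →
    ∃ u : GaussianIntˣ, Even ((u : GaussianInt) * α).im ∧
      jacobiUnit (signedOdd n : GaussianInt) α =
        jacobiUnit ((u : GaussianInt) * α) (n : GaussianInt)) ?_ ?_ ?_ α hα
  · rintro _ ⟨v, rfl⟩ _
    refine ⟨v⁻¹, ?_, ?_⟩
    · simp
    · rw [jacobiUnit_isUnit_right v.isUnit, Units.inv_mul, jacobiUnit_one_left hno]
  · intro β π hβ hπ _ h1 h2 hc
    have hc1 := hc.of_mul_left_left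
    have hc2 := hc.of_mul_left_right
    obtain ⟨u, hu, hu'⟩ := h1 hc1
    obtain ⟨v, hv, hv'⟩ := h2 hc2
    refine ⟨u * v, ?_, ?_⟩
    · have e : ((u * v : GaussianIntˣ) : GaussianInt) * (π * β) = (u * π) * (v * β) := by
        rw [Units.val_mul]
        ring
      rw [e, Zsqrtd.im_mul]
      exact (hv.mul_left _).add (hu.mul_right _)
    · have e : ((u * v : GaussianIntˣ) : GaussianInt) * (π * β) = (u * π) * (v * β) := by
        rw [Units.val_mul]
        ring
      rw [e, jacobiUnit_mul_left hno ((isCoprime_of_isUnit_left u.isUnit).mul_left hc1)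
        ((isCoprime_of_isUnit_left v.isUnit).mul_left hc2), ← hu', ← hv',
        jacobiUnit_mul_right hπ hβ (isCoprime_signedOdd hc1).symm (isCoprime_signedOdd hc2).symm]
  · intro π hπ ho hc
    rcases prime_cases hπ ho with ⟨l, hl, h3, ha⟩ | ⟨l, hl, h1, hn⟩
    · obtain ⟨u, hu⟩ := ha
      have hlo : Odd (l : ℤ) := by
        rw [Int.odd_iff]
        omega
      have hcl : IsCoprime (n : GaussianInt) (l : GaussianInt) := by
        rw [← hu]
        exact hc.symm.mul_right (isCoprime_of_isUnit_right u.isUnit)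
      have hcl' : IsCoprime n l := by
        have h6 : ¬ (l : ℤ) ∣ n := by
          rintro ⟨k, rfl⟩
          refine (@prime_of_nat_prime_of_mod_four_eq_three l ⟨hl⟩ h3).not_isUnit
            (hcl.isUnit_of_dvd' ⟨k, by push_cast; ring⟩ dvd_rfl)
        exact (((Nat.prime_iff_prime_int.1 hl).irreducible.coprime_iff_not_dvd).2 h6).symm
      have hcl'' : IsCoprime (signedOdd n) (l : ℤ) := by
        rcases signedOdd_eq_or n with e | e <;> rw [e]
        · exact hcl'
        · exact hcl'.neg_left
      have e1 := jacobiUnit_intCast_intCast hlo hcl''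
      have e2 := jacobiUnit_intCast_intCast hodd hcl'.symm
      rw [Int.cast_natCast] at e1 e2
      refine ⟨u, ?_, ?_⟩
      · rw [mul_comm, hu]
        simp
      · rw [mul_comm, hu, e2, jacobiUnit_of_associated ⟨u, hu⟩ ho (isCoprime_signedOdd hc).symm, e1]
    · have := Fact.mk hl
      obtain ⟨u, hu⟩ := associated_jacobiSum hπ ho hn
      refine ⟨u, ?_, ?_⟩
      · rw [mul_comm, hu]
        exact jacobiSum_even_im hπ ho hn
      · rw [mul_comm, hu]
        exact jacobiUnit_signedOdd_prime hπ ho hn hodd hc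

theorem odd_re_of_even_im {α : GaussianInt} (hα : Odd α.norm) (him : Even α.im) : Odd α.re := by
  rw [Zsqrtd.norm_def] at hα
  by_contra h
  rw [Int.not_odd_iff_even] at h
  have : Even (α.re * α.re - -1 * α.im * α.im) := (h.mul_right _).sub (him.mul_left _)
  exact (Int.not_odd_iff_even.2 this) hα

/-- **Quartic reciprocity** between an odd integer and a Gaussian integer of odd norm with even
imaginary part. -/
theorem jacobiUnit_reciprocity {n : ℤ} (hodd : Odd n) {α : GaussianInt} (hα : Odd α.norm)
    (him : Even α.im) (hc : IsCoprime α (n : GaussianInt)) :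
    jacobiUnit (signedOdd n : GaussianInt) α = jacobiUnit α (n : GaussianInt) := by
  obtain ⟨u, hu, h⟩ := exists_unit_reciprocity hodd α hα hc
  have hre := odd_re_of_even_im hα him
  rw [h]
  -- `α` and `uα` both have even imaginary part and `α` has odd real part, so only `u = ±1`
  -- survives.
  rcases unit_cases u with h' | h' | h' | h' <;> rw [h'] at hu ⊢
  · rw [one_mul]
  · simp at hu
    exact absurd hu (Int.not_even_iff_odd.2 hre)
  · rw [neg_one_mul, jacobiUnit_neg_left (odd_norm_intCast hodd) hc,
      jacobiUnit_neg_one_intCast hodd, one_mul]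
  · simp at hu
    exact absurd hu (Int.not_even_iff_odd.2 hre)

/-- Squaring removes the sign in `signedOdd`, since the symbol of `-1` squares to 1. -/
theorem jacobiUnit_sq_reciprocity {n : ℤ} (hodd : Odd n) {α : GaussianInt} (hα : Odd α.norm)
    (him : Even α.im) (hc : IsCoprime α (n : GaussianInt)) :
    jacobiUnit (n : GaussianInt) α ^ 2 = jacobiUnit α (n : GaussianInt) ^ 2 := by
  rw [← jacobiUnit_reciprocity hodd hα him hc]
  rcases signedOdd_eq_or n with e | e <;> rw [e]
  rw [Int.cast_neg, jacobiUnit_neg_left hα hc.symm, mul_pow,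
    ← jacobiUnit_pow_left hα (isCoprime_of_isUnit_left isUnit_one.neg)]
  norm_num [jacobiUnit_one_left hα]

/-! ### The supplementary law for 2, and odd imaginary parts. -/

/-- The quartic character of `2`. -/
theorem jacobiUnit_two {a b : ℤ} (ha : Odd a) (hb : Even b) (hab : IsCoprime a b) :
    jacobiUnit 2 ⟨a, b⟩ =
      unitI ^ (2 * ((signedOdd (a + b) - 1) / 4) - (a ^ 2 + b ^ 2 - 1) / 4) := by
  have hm : Odd (a + b) := ha.add_even hb
  have hnorm : (⟨a, b⟩ : GaussianInt).norm = a ^ 2 + b ^ 2 := by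
    rw [Zsqrtd.norm_def]
    ring
  have hα : Odd (⟨a, b⟩ : GaussianInt).norm := by
    rw [hnorm]
    exact (ha.pow).add_even (hb.pow_of_ne_zero two_ne_zero)
  have hαdef : (⟨a, b⟩ : GaussianInt) = a + b * ⟨0, 1⟩ := by ext <;> simp
  have hII : (⟨0, 1⟩ : GaussianInt) * ⟨0, 1⟩ = -1 := by decide
  set α : GaussianInt := ⟨a, b⟩
  have hca : IsCoprime (a : GaussianInt) α := by
    obtain ⟨x, y, hxy⟩ := hab
    have hxy' : (x : GaussianInt) * a + y * b = 1 := by exact_mod_cast congrArg (Int.cast) hxy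
    exact ⟨x + y * ⟨0, 1⟩, -(y * ⟨0, 1⟩), by
      rw [hαdef]
      linear_combination hxy' - (y : GaussianInt) * b * hII⟩
  have hcm : IsCoprime ((a + b : ℤ) : GaussianInt) α := by
    have h1 : ((a + b : ℤ) : GaussianInt) = a * ⟨1, 1⟩ + α * (-⟨0, 1⟩) := by
      have h2 : (⟨1, 1⟩ : GaussianInt) = 1 + ⟨0, 1⟩ := by decide
      rw [hαdef, h2]
      push_cast
      linear_combination (b : GaussianInt) * hII
    rw [h1, IsCoprime.add_mul_left_left_iff]
    exact hca.mul_left (isCoprime_one_add_I hα)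
  -- Modulo `α` one has `b ≡ ia`, hence `(a+b)² ≡ 2i a²`; comparing symbols isolates that of 2. For
  -- the left side reciprocity is used: modulo `a + b`, `α ≡ a(1-i)`, and `(1-i)² = -2i`.
  have e1 : jacobiUnit ((a + b : ℤ) : GaussianInt) α ^ 2 =
      unitI ^ (2 * ((signedOdd (a + b) - 1) / 4)) := by
    have ho := odd_norm_intCast hm
    have hc1 : IsCoprime (⟨1, 1⟩ : GaussianInt) ((a + b : ℤ) : GaussianInt) :=
      isCoprime_one_add_I ho
    have hc2 : IsCoprime (⟨1, -1⟩ : GaussianInt) ((a + b : ℤ) : GaussianInt) := by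
      have h2 : (⟨1, -1⟩ : GaussianInt) = ⟨1, 1⟩ * ⟨0, -1⟩ := by decide
      rw [h2]
      exact hc1.mul_left (isCoprime_of_isUnit_left (unitI⁻¹).isUnit)
    have hca' : IsCoprime a (a + b) := by
      obtain ⟨x, y, h⟩ := hab
      exact ⟨x - y, y, by linear_combination h⟩
    rw [jacobiUnit_sq_reciprocity hm hα hb hcm.symm,
      jacobiUnit_congr (β := a * ⟨1, -1⟩) ho ⟨⟨0, 1⟩, by
        have h2 : (⟨1, -1⟩ : GaussianInt) = 1 - ⟨0, 1⟩ := by decide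
        rw [hαdef, h2]
        push_cast
        ring⟩,
      jacobiUnit_mul_left ho (isCoprime_intCast hca') hc2, jacobiUnit_intCast_intCast hm hca',
      one_mul, ← jacobiUnit_pow_left ho hc2, show (⟨1, -1⟩ : GaussianInt) ^ 2 = -(2 * ⟨0, 1⟩) by decide,
      jacobiUnit_neg_left ho ((isCoprime_two ho).mul_left (isCoprime_of_isUnit_left isUnit_I)),
      jacobiUnit_mul_left ho (isCoprime_two ho) (isCoprime_of_isUnit_left isUnit_I),
      jacobiUnit_neg_one_intCast hm, jacobiUnit_two_intCast hm, jacobiUnit_I_intCast hm]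
    simp
  -- Reciprocity again: modulo `a`, `α ≡ bi`, and the symbol of `i` modulo `a` is `±1`.
  have e2 : jacobiUnit (a : GaussianInt) α ^ 2 = 1 := by
    have ho := odd_norm_intCast ha
    rw [jacobiUnit_sq_reciprocity ha hα hb hca.symm,
      jacobiUnit_congr (β := b * ⟨0, 1⟩) ho ⟨1, by rw [hαdef]; ring⟩,
      jacobiUnit_mul_left ho (isCoprime_intCast hab.symm) (isCoprime_of_isUnit_left isUnit_I),
      jacobiUnit_intCast_intCast ha hab.symm, one_mul, jacobiUnit_I_intCast ha, ← zpow_natCast,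
      ← zpow_mul]
    refine (unitI_zpow_congr (b := 0) ?_).trans (zpow_zero _)
    exact Int.modEq_zero_iff_dvd.2 ⟨(signedOdd a - 1) / 4, by push_cast; ring⟩
  have e3 : jacobiUnit (((a + b : ℤ) : GaussianInt) ^ 2) α =
      jacobiUnit (2 * ⟨0, 1⟩ * (a : GaussianInt) ^ 2) α := by
    refine jacobiUnit_congr hα ?_
    refine ⟨a * (1 - 2 * ⟨0, 1⟩) - ⟨0, 1⟩ * b, ?_⟩
    rw [hαdef]
    push_cast
    linear_combination (2 * (a : GaussianInt) * b + (b : GaussianInt) ^ 2) * hII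
  rw [jacobiUnit_pow_left hα hcm, e1, jacobiUnit_mul_left hα ((isCoprime_two hα).mul_left
    (isCoprime_of_isUnit_left isUnit_I)) hca.pow_left, jacobiUnit_pow_left hα hca, e2, mul_one,
    jacobiUnit_mul_left hα (isCoprime_two hα) (isCoprime_of_isUnit_left isUnit_I),
    jacobiUnit_I hα, hnorm] at e3
  rw [zpow_sub, e3, mul_inv_cancel_right]

theorem signedOdd_neg {m : ℤ} (h : Odd m) : signedOdd (-m) = signedOdd m := by
  refine signedOdd_unique ?_ (signedOdd_mod h)
  rcases signedOdd_eq_or m with e | e <;> rw [e] <;> simp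

theorem jacobiUnit_intCast_eq {α : GaussianInt} (hα : Odd α.norm) {n : ℤ}
    (hc : IsCoprime (n : GaussianInt) α) :
    jacobiUnit (n : GaussianInt) α = jacobiUnit (signedOdd n : GaussianInt) α *
      unitI ^ (2 * ((α.norm - 1) / 4) * (if n % 4 = 1 then 0 else 1)) := by
  unfold signedOdd
  split_ifs with h
  · simp
  · rw [Int.cast_neg, jacobiUnit_neg_left hα hc, jacobiUnit_neg_one hα, mul_one, mul_right_comm,
      ← zpow_add]
    rw [(unitI_zpow_congr (b := 0) ?_).trans (zpow_zero _), one_mul]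
    exact Int.modEq_zero_iff_dvd.2 ⟨(α.norm - 1) / 4, by ring⟩

theorem odd_norm_of_odd_add {A B : ℤ} (h : Odd (A + B)) : Odd (⟨A, B⟩ : GaussianInt).norm := by
  rw [Zsqrtd.norm_def]
  have h1 : A * A - -1 * B * B = (A + B) * (A + B) - 2 * (A * B) := by ring
  dsimp only
  rw [h1]
  exact (h.mul h).sub_even (even_two_mul _)

theorem unitI_mul_mk (A B : ℤ) : (⟨A, B⟩ : GaussianInt) = ⟨0, 1⟩ * ⟨B, -A⟩ := by
  ext <;> simp

/-- Reciprocity for Gaussian integers of odd norm, whichever coordinate is even. -/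
theorem jacobiUnit_signedOdd {A B n : ℤ} (h : Odd (A + B)) (hn : Odd n)
    (hc : IsCoprime (⟨A, B⟩ : GaussianInt) (n : GaussianInt)) :
    jacobiUnit (signedOdd n : GaussianInt) ⟨A, B⟩ =
      jacobiUnit ⟨A, B⟩ (n : GaussianInt) * unitI ^ (2 * B * ((signedOdd n - 1) / 4)) := by
  have hα := odd_norm_of_odd_add h
  rcases Int.even_or_odd B with hB | hB
  · rw [jacobiUnit_reciprocity hn hα hB hc, (unitI_zpow_congr (b := 0) ?_).trans (zpow_zero _),
      mul_one]
    obtain ⟨b, rfl⟩ := hB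
    exact Int.modEq_zero_iff_dvd.2 ⟨b * ((signedOdd n - 1) / 4), by ring⟩
  -- `A + Bi = i(B - Ai)` and `B - Ai` has even imaginary part; the symbol of `i` modulo `n` is the
  -- correction factor.
  · have hA : Even A := by
      by_contra hA
      rw [Int.not_even_iff_odd] at hA
      exact (Int.not_even_iff_odd.2 h) (hA.add_odd hB)
    have e := unitI_mul_mk A B
    have has : Associated (⟨B, -A⟩ : GaussianInt) ⟨A, B⟩ :=
      ⟨unitI, by rw [mul_comm, coe_unitI, ← e]⟩
    have hα' : Odd (⟨B, -A⟩ : GaussianInt).norm := odd_norm_of_odd_add (hB.add_even hA.neg)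
    have hc' : IsCoprime (⟨B, -A⟩ : GaussianInt) (n : GaussianInt) :=
      hc.of_isCoprime_of_dvd_left has.dvd
    rw [← jacobiUnit_of_associated has hα' (isCoprime_signedOdd hc').symm,
      jacobiUnit_reciprocity hn hα' hA.neg hc']
    conv_rhs => rw [e, jacobiUnit_mul_left (odd_norm_intCast hn) (isCoprime_of_isUnit_left isUnit_I)
      hc', jacobiUnit_I_intCast hn, mul_right_comm, ← zpow_add]
    rw [(unitI_zpow_congr (b := 0) ?_).trans (zpow_zero _), one_mul]
    obtain ⟨b, rfl⟩ := hB
    exact Int.modEq_zero_iff_dvd.2 ⟨(b + 1) * ((signedOdd n - 1) / 4), by ring⟩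

theorem one_add_I_mul_mk (A B : ℤ) :
    (⟨1, 1⟩ : GaussianInt) * ⟨A, B⟩ = ⟨A - B, A + B⟩ := by
  ext <;> simp <;> ring

/-- The form needed for `γ = (1+i)(A+Bi)`: the extra factor `1 + i` turns the coefficient `2B` into
`2B - 1`. -/
theorem jacobiUnit_signedOdd_one_add_I_mul {A B n : ℤ} (h : Odd (A + B)) (hn : Odd n)
    (hc : IsCoprime (⟨A, B⟩ : GaussianInt) (n : GaussianInt)) :
    jacobiUnit (signedOdd n : GaussianInt) ⟨A, B⟩ =
      jacobiUnit ⟨A - B, A + B⟩ (n : GaussianInt) *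
        unitI ^ ((2 * B - 1) * ((signedOdd n - 1) / 4)) := by
  have ho := odd_norm_intCast hn
  rw [jacobiUnit_signedOdd h hn hc, ← one_add_I_mul_mk, jacobiUnit_mul_left ho
    (isCoprime_one_add_I ho) hc, jacobiUnit_one_add_I hn,
    mul_comm (unitI ^ ((signedOdd n - 1) / 4)) (jacobiUnit _ _), mul_assoc (jacobiUnit _ _),
    ← zpow_add]
  congr 2
  ring

theorem jacobiUnit_two_mk {A B : ℤ} (h : Odd (A + B)) (hAB : IsCoprime A B) :
    jacobiUnit 2 ⟨A, B⟩ = unitI ^ (2 * ((signedOdd (if Even B then A + B else A - B) - 1) / 4) -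
      (A ^ 2 + B ^ 2 - 1) / 4) := by
  split_ifs with hB
  · have hA : Odd A := by
      by_contra hA
      rw [Int.not_odd_iff_even] at hA
      exact (Int.not_odd_iff_even.2 (hA.add hB)) h
    exact jacobiUnit_two hA hB hAB
  · rw [Int.not_even_iff_odd] at hB
    have hA : Even A := by
      by_contra hA
      rw [Int.not_even_iff_odd] at hA
      exact (Int.not_even_iff_odd.2 h) (hA.add_odd hB)
    have e := unitI_mul_mk A B
    have has : Associated (⟨B, -A⟩ : GaussianInt) ⟨A, B⟩ :=
      ⟨unitI, by rw [mul_comm, coe_unitI, ← e]⟩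
    have hα' : Odd (⟨B, -A⟩ : GaussianInt).norm := odd_norm_of_odd_add (hB.add_even hA.neg)
    rw [← jacobiUnit_of_associated has hα' (isCoprime_two hα'),
      jacobiUnit_two hB hA.neg hAB.symm.neg_right,
      ← signedOdd_neg (hA.sub_odd hB)]
    congr 1
    ring_nf

/-! ### The relation between symbols over `A + Bi` and over `c + di`. -/

theorem mk_eq (a b : ℤ) : (⟨a, b⟩ : GaussianInt) = a + b * ⟨0, 1⟩ := by ext <;> simp

theorem isCoprime_mk_left {c s : ℤ} (h : IsCoprime c s) {α : GaussianInt}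
    (hα : α ∣ ⟨c, s⟩) : IsCoprime (s : GaussianInt) α := by
  refine IsCoprime.of_isCoprime_of_dvd_right ?_ hα
  rw [mk_eq]
  have := isCoprime_intCast h.symm
  exact (IsCoprime.add_mul_left_right_iff).2 this

/-- The relation between the quartic characters of `x`, `y` and `q` when
`c² + d² = x² + q y²`, before the symbols over `c + d i` are evaluated. Here
`c + (x + d) i = (1 + i) (A + B i)` and `y = 2 ^ t * y₀`. -/
theorem jacobiUnit_relation {c d x q y₀ A B : ℤ} {t : ℕ} (hq : Odd q) (hx : Odd x)
    (hd : Even d) (hy₀ : y₀ % 4 = 1)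
    (h : c ^ 2 + d ^ 2 = x ^ 2 + q * (2 ^ t * y₀) ^ 2)
    (hcs : IsCoprime c (x + d)) (hA : c = A - B) (hB : x + d = A + B)
    (hπo : Odd (⟨c, d⟩ : GaussianInt).norm)
    (hπx : IsCoprime (⟨c, d⟩ : GaussianInt) (x : GaussianInt))
    (hπy : IsCoprime (⟨c, d⟩ : GaussianInt) (y₀ : GaussianInt)) :
    jacobiUnit (signedOdd x : GaussianInt) ⟨c, d⟩ * (jacobiUnit (y₀ : GaussianInt) ⟨c, d⟩)⁻¹ *
      unitI ^ ((2 * B - 1) * ((signedOdd (x + d) - 1) / 4) +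
        (2 * B - 1) * ((signedOdd x - 1) / 4) +
        2 * ((A ^ 2 + B ^ 2 - 1) / 4) * (1 + (if (x + d) % 4 = 1 then 0 else 1) +
          (if x % 4 = 1 then 0 else 1))) =
    jacobiUnit ⟨c, x + d⟩ (q : GaussianInt) * jacobiUnit 2 ⟨A, B⟩ ^ (2 * t - 1 : ℤ) *
      unitI ^ ((2 * B - 1) * ((signedOdd q - 1) / 4) +
        2 * ((A ^ 2 + B ^ 2 - 1) / 4) * (if q % 4 = 1 then 0 else 1)) := by
  have hs : Odd (x + d) := hx.add_even hd
  have hy : Odd y₀ := Int.odd_iff.2 (by omega)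
  have hII : (⟨0, 1⟩ : GaussianInt) * ⟨0, 1⟩ = -1 := by decide
  have hAB : IsCoprime A B := by
    obtain ⟨u, v, huv⟩ := hcs
    exact ⟨u + v, v - u, by rw [hA, hB] at huv; linear_combination huv⟩
  have hδo : Odd (⟨A, B⟩ : GaussianInt).norm := odd_norm_of_odd_add (hB ▸ hs)
  have hnorm : (⟨A, B⟩ : GaussianInt).norm = A ^ 2 + B ^ 2 := by
    rw [Zsqrtd.norm_def]
    ring
  have hγ : (⟨1, 1⟩ : GaussianInt) * ⟨A, B⟩ = ⟨c, x + d⟩ := by rw [one_add_I_mul_mk, hA, hB]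
  have hδγ : (⟨A, B⟩ : GaussianInt) ∣ ⟨c, x + d⟩ := ⟨_, by rw [mul_comm, hγ]⟩
  have hγeq : (⟨c, x + d⟩ : GaussianInt) = ⟨c, d⟩ + x * ⟨0, 1⟩ := by ext <;> simp; ring
  -- the congruence `q y² ≡ -2 s x` modulo `A + B i`
  have hmod : (⟨A, B⟩ : GaussianInt) ∣
      (q : GaussianInt) * (2 ^ t * (y₀ : GaussianInt)) ^ 2 - -1 * (2 * ((x + d : ℤ) : GaussianInt) * x) := by
    -- The cofactor is the conjugate of `γ = c + (x+d)i`: by `h`, its norm `c² + (x+d)²` equals `qy²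
    -- + 2(x+d)x`.
    refine hδγ.trans ⟨⟨c, -(x + d)⟩, ?_⟩
    have h' : (c : GaussianInt) ^ 2 + (d : GaussianInt) ^ 2 =
        (x : GaussianInt) ^ 2 + q * (2 ^ t * y₀) ^ 2 := by exact_mod_cast congrArg (Int.cast) h
    rw [mk_eq c (x + d), mk_eq c (-(x + d))]
    push_cast
    linear_combination -h' + ((x : GaussianInt) + d) ^ 2 * hII
  -- coprimality facts
  have hsδ : IsCoprime ((x + d : ℤ) : GaussianInt) (⟨A, B⟩ : GaussianInt) :=
    isCoprime_mk_left hcs hδγ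
  have hxδ : IsCoprime (x : GaussianInt) (⟨A, B⟩ : GaussianInt) := by
    refine IsCoprime.of_isCoprime_of_dvd_right ?_ hδγ
    rw [hγeq]
    exact (IsCoprime.add_mul_left_right_iff).2 hπx.symm
  have h2δ : IsCoprime (2 : GaussianInt) (⟨A, B⟩ : GaussianInt) := isCoprime_two hδo
  -- The right side of the congruence is prime to `A + Bi`, hence so is the left; this supplies the
  -- coprimality of `q` and `y₀`.
  have hprod : IsCoprime ((q : GaussianInt) * (2 ^ t * (y₀ : GaussianInt)) ^ 2)
      (⟨A, B⟩ : GaussianInt) := by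
    obtain ⟨w, hw⟩ := hmod
    rw [sub_eq_iff_eq_add'] at hw
    rw [hw, IsCoprime.add_mul_left_left_iff]
    exact (isCoprime_of_isUnit_left isUnit_one.neg).mul_left ((h2δ.mul_left hsδ).mul_left hxδ)
  have hqδ : IsCoprime (q : GaussianInt) (⟨A, B⟩ : GaussianInt) := hprod.of_mul_left_left
  have hyδ : IsCoprime (y₀ : GaussianInt) (⟨A, B⟩ : GaussianInt) :=
    ((IsCoprime.pow_left_iff two_pos).1 hprod.of_mul_left_right).of_mul_left_right
  have hy2 : IsCoprime (y₀ : ℤ) (x + d) := by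
    have h1 : IsCoprime (q * (2 ^ t * y₀) ^ 2) (x + d) := by
      have h2 : q * (2 ^ t * y₀) ^ 2 = c ^ 2 + (x + d) * (d - x) := by linear_combination -h
      rw [h2, IsCoprime.add_mul_left_left_iff]
      exact hcs.pow_left
    exact ((IsCoprime.pow_left_iff two_pos).1 h1.of_mul_left_right).of_mul_left_right
  -- evaluation of the symbols over `A + B i`
  have eS : jacobiUnit (⟨c, x + d⟩ : GaussianInt) ((x + d : ℤ) : GaussianInt) = 1 := by
    rw [jacobiUnit_congr (β := c) (odd_norm_intCast hs) ⟨⟨0, 1⟩, by rw [mk_eq]; ring⟩,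
      jacobiUnit_intCast_intCast hs hcs]
  have eX : jacobiUnit (⟨c, x + d⟩ : GaussianInt) (x : GaussianInt) =
      jacobiUnit (signedOdd x : GaussianInt) ⟨c, d⟩ := by
    rw [jacobiUnit_congr (β := ⟨c, d⟩) (odd_norm_intCast hx) ⟨⟨0, 1⟩, by rw [hγeq]; ring⟩,
      jacobiUnit_reciprocity hx hπo hd hπx]
  have rS := jacobiUnit_signedOdd_one_add_I_mul (hB ▸ hs) hs hsδ.symm
  have rX := jacobiUnit_signedOdd_one_add_I_mul (hB ▸ hs) hx hxδ.symm
  have rQ := jacobiUnit_signedOdd_one_add_I_mul (hB ▸ hs) hq hqδ.symm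
  have rY := jacobiUnit_signedOdd_one_add_I_mul (hB ▸ hs) hy hyδ.symm
  rw [← hA, ← hB] at rS rX rQ rY
  rw [eS, one_mul] at rS
  rw [eX] at rX
  have hsy : signedOdd y₀ = y₀ := signedOdd_unique (Or.inl rfl) hy₀
  -- Modulo `y₀` one has `c² + d² ≡ x²`, whence `γ² ≡ 2(x+d) i (c+di)`. The resulting symbol of `i`
  -- is absorbed by the squared reciprocity correction, leaving the exponent `4B(y₀-1)/4`.
  have eY : jacobiUnit (y₀ : GaussianInt) ⟨A, B⟩ ^ 2 = jacobiUnit (y₀ : GaussianInt) ⟨c, d⟩ := by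
    have hyo := odd_norm_intCast hy
    have rY' := jacobiUnit_reciprocity hy hπo hd hπy
    have hγy : IsCoprime (⟨c, x + d⟩ : GaussianInt) (y₀ : GaussianInt) := by
      rw [← hγ]
      exact (isCoprime_one_add_I hyo).mul_left hyδ.symm
    have hc2 : IsCoprime (2 * (x + d)) y₀ := (Int.isCoprime_two_left.2 hy).mul_left hy2.symm
    have e1 : jacobiUnit (-((⟨c, x + d⟩ : GaussianInt) ^ 2)) (y₀ : GaussianInt) =
        jacobiUnit (-(((2 * (x + d) : ℤ) : GaussianInt) * (⟨0, 1⟩ * ⟨c, d⟩))) y₀ := by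
      refine jacobiUnit_congr hyo ?_
      refine ⟨-(q * (2 ^ t) ^ 2 * y₀), ?_⟩
      have h' : (c : GaussianInt) ^ 2 + (d : GaussianInt) ^ 2 =
          (x : GaussianInt) ^ 2 + q * (2 ^ t * y₀) ^ 2 := by exact_mod_cast congrArg (Int.cast) h
      rw [mk_eq c (x + d), mk_eq c d]
      push_cast
      linear_combination -h' + (-(x + d : GaussianInt) ^ 2 + 2 * (x + d) * d) * hII
    have hcI : IsCoprime (⟨0, 1⟩ : GaussianInt) (y₀ : GaussianInt) :=
      isCoprime_of_isUnit_left isUnit_I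
    rw [jacobiUnit_neg_left hyo hγy.pow_left, jacobiUnit_neg_left hyo
      ((isCoprime_intCast hc2).mul_left (hcI.mul_left hπy)), jacobiUnit_pow_left hyo hγy,
      jacobiUnit_mul_left hyo (isCoprime_intCast hc2) (hcI.mul_left hπy),
      jacobiUnit_intCast_intCast hy hc2, jacobiUnit_mul_left hyo hcI hπy,
      jacobiUnit_neg_one_intCast hy, one_mul, one_mul, one_mul, jacobiUnit_I_intCast hy,
      ← rY'] at e1
    rw [hsy] at rY e1
    rw [rY, mul_pow, e1, mul_right_comm, ← zpow_natCast, ← zpow_mul, ← zpow_add,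
      (unitI_zpow_congr (b := 0) ?_).trans (zpow_zero _), one_mul]
    exact Int.modEq_zero_iff_dvd.2 ⟨B * ((y₀ - 1) / 4), by push_cast; ring⟩
  -- the relation
  have main := jacobiUnit_congr hδo hmod
  have hm1 : IsCoprime (-1 : GaussianInt) (⟨A, B⟩ : GaussianInt) :=
    isCoprime_of_isUnit_left isUnit_one.neg
  rw [jacobiUnit_mul_left hδo hqδ hprod.of_mul_left_right,
    jacobiUnit_pow_left hδo (h2δ.pow_left.mul_left hyδ),
    jacobiUnit_mul_left hδo h2δ.pow_left hyδ, mul_pow, eY, jacobiUnit_pow_left hδo h2δ,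
    jacobiUnit_mul_left hδo hm1 ((h2δ.mul_left hsδ).mul_left hxδ),
    jacobiUnit_mul_left hδo (h2δ.mul_left hsδ) hxδ, jacobiUnit_mul_left hδo h2δ hsδ,
    jacobiUnit_intCast_eq hδo hqδ, jacobiUnit_intCast_eq hδo hsδ, jacobiUnit_intCast_eq hδo hxδ,
    rS, rX, rQ, jacobiUnit_neg_one hδo, hnorm] at main
  have e2 : jacobiUnit 2 ⟨A, B⟩ ^ (2 * t - 1 : ℤ) =
      (jacobiUnit 2 ⟨A, B⟩ ^ t) ^ 2 * (jacobiUnit 2 ⟨A, B⟩)⁻¹ := by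
    rw [zpow_sub_one, mul_comm 2 (t : ℤ), zpow_mul]
    rfl
  rw [e2]
  generalize jacobiUnit (⟨c, x + d⟩ : GaussianInt) (q : GaussianInt) = G at main ⊢
  generalize jacobiUnit (y₀ : GaussianInt) ⟨c, d⟩ = Y at main ⊢
  generalize jacobiUnit (signedOdd x : GaussianInt) ⟨c, d⟩ = X at main ⊢
  generalize jacobiUnit 2 ⟨A, B⟩ ^ t = T at main ⊢
  generalize jacobiUnit 2 ⟨A, B⟩ = U at main ⊢
  simp only [mul_add, mul_one, zpow_add] at main ⊢
  have e3 : ∀ g : GaussianIntˣ, G * (T ^ 2 * U⁻¹) * g = (G * g * (T ^ 2 * Y)) * (U⁻¹ * Y⁻¹) := by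
    intro g
    calc G * (T ^ 2 * U⁻¹) * g = (G * g * (T ^ 2)) * U⁻¹ * (Y * Y⁻¹) := by
          rw [mul_inv_cancel, mul_one, mul_right_comm, ← mul_assoc, mul_right_comm G]
      _ = _ := by
          simp only [mul_assoc, mul_left_comm, mul_comm]
  rw [e3, ← mul_assoc G, main]
  have e4 : ∀ a b e f g : GaussianIntˣ, a * (U * (b * e) * (X * f * g)) * (U⁻¹ * Y⁻¹) =
      X * Y⁻¹ * (b * f * (a * e * g)) := by
    intro a b e f g
    calc a * (U * (b * e) * (X * f * g)) * (U⁻¹ * Y⁻¹) =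
          (U * U⁻¹) * (a * ((b * e) * (X * f * g)) * Y⁻¹) := by
          simp only [mul_assoc, mul_left_comm, mul_comm]
      _ = _ := by
          rw [mul_inv_cancel, one_mul]
          simp only [mul_assoc, mul_left_comm, mul_comm]
  rw [e4]

/-! ### The exponent of `i` modulo 4. -/

/-- The exponent of `i` in `(x / (c + d i))₄ (y / (c + d i))₄⁻¹ ((c + (x + d) i) / q)₄⁻¹`, where
`c + (x + d) i = (1 + i) (A + B i)` and `y = 2 ^ t * y₀`. -/
def quotientExponent (c d x q A B : ℤ) (t : ℕ) : ℤ :=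
  ((2 * B - 1) * ((signedOdd q - 1) / 4) +
      2 * ((A ^ 2 + B ^ 2 - 1) / 4) * (if q % 4 = 1 then 0 else 1)) +
    (2 * ((signedOdd (if Even B then x + d else c) - 1) / 4) - (A ^ 2 + B ^ 2 - 1) / 4) *
      (2 * t - 1) -
    ((2 * B - 1) * ((signedOdd (x + d) - 1) / 4) + (2 * B - 1) * ((signedOdd x - 1) / 4) +
      2 * ((A ^ 2 + B ^ 2 - 1) / 4) *
        (1 + (if (x + d) % 4 = 1 then 0 else 1) + (if x % 4 = 1 then 0 else 1))) +
    2 * ((c ^ 2 + d ^ 2 - 1) / 4) * (if x % 4 = 1 then 0 else 1) -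
    (2 * ((signedOdd (c + d) - 1) / 4) - (c ^ 2 + d ^ 2 - 1) / 4) * t

theorem signedOdd_of_mod_one {m : ℤ} (h : m % 4 = 1) : signedOdd m = m := by
  simp [signedOdd, h]

theorem signedOdd_of_mod_three {m : ℤ} (h : m % 4 = 3) : signedOdd m = -m := by
  simp [signedOdd, h]

/-- Evaluation of the exponent when `x + d ≡ 1 (mod 4)`. -/
theorem quotientExponent_of_one {c d x q A B : ℤ} (t : ℕ) (hc : c % 4 = 1)
    (hA : c = A - B) (hB : x + d = A + B) (hs : (x + d) % 4 = 1) :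
    ∃ w, quotientExponent c d x q A B t = 4 * w - (signedOdd q - 1) / 4 + (x + d - 1) / 4 +
      (signedOdd x - 1) / 4 + 2 * ((A ^ 2 + B ^ 2 - 1) / 4) *
        ((if q % 4 = 1 then 0 else 1) - 1 - (if x % 4 = 1 then 0 else 1)) -
      (2 * ((x + d - 1) / 4) - (A ^ 2 + B ^ 2 - 1) / 4) +
      2 * ((c ^ 2 + d ^ 2 - 1) / 4) * (if x % 4 = 1 then 0 else 1) -
      (2 * ((A ^ 2 + B ^ 2 - 1) / 4) + 2 * ((signedOdd (c + d) - 1) / 4) -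
        (c ^ 2 + d ^ 2 - 1) / 4) * t := by
  -- Here `2B = (x+d) - c` is divisible by 4. The multiples of 4 arising from `b` and `t` are
  -- collected in `w`.
  obtain ⟨b, rfl⟩ : ∃ b, B = 2 * b := ⟨B / 2, by omega⟩
  refine ⟨b * ((signedOdd q - 1) / 4) - b * ((x + d - 1) / 4) - b * ((signedOdd x - 1) / 4) +
    t * ((x + d - 1) / 4), ?_⟩
  unfold quotientExponent
  rw [if_pos (even_two_mul b), if_pos hs, signedOdd_of_mod_one hs]
  ring

/-- Evaluation of the exponent when `x + d ≡ 3 (mod 4)`. -/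
theorem quotientExponent_of_three {c d x q A B : ℤ} (t : ℕ) (hc : c % 4 = 1)
    (hA : c = A - B) (hB : x + d = A + B) (hs : (x + d) % 4 = 3) :
    ∃ w, quotientExponent c d x q A B t = 4 * w + (signedOdd q - 1) / 4 - (-(x + d) - 1) / 4 -
      (signedOdd x - 1) / 4 + 2 * ((A ^ 2 + B ^ 2 - 1) / 4) *
        ((if q % 4 = 1 then 0 else 1) - 2 - (if x % 4 = 1 then 0 else 1)) -
      (2 * ((c - 1) / 4) - (A ^ 2 + B ^ 2 - 1) / 4) +
      2 * ((c ^ 2 + d ^ 2 - 1) / 4) * (if x % 4 = 1 then 0 else 1) -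
      (2 * ((A ^ 2 + B ^ 2 - 1) / 4) + 2 * ((signedOdd (c + d) - 1) / 4) -
        (c ^ 2 + d ^ 2 - 1) / 4) * t := by
  -- Now `2B = (x+d) - c ≡ 2 (mod 4)`.
  obtain ⟨b, rfl⟩ : ∃ b, B = 2 * b + 1 := ⟨B / 2, by omega⟩
  refine ⟨b * ((signedOdd q - 1) / 4) - b * ((-(x + d) - 1) / 4) - b * ((signedOdd x - 1) / 4) +
    t * ((c - 1) / 4), ?_⟩
  have hodd : ¬ Even (2 * b + 1) := by simp
  unfold quotientExponent
  rw [if_neg hodd, if_neg (show ¬ (x + d) % 4 = 1 by omega), signedOdd_of_mod_three hs, signedOdd_of_mod_one hc]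
  ring

/-- Replacing `n²` by `n + 2m` makes the quadratic relations linear, which brings the congruences
for the exponent within reach of `omega`. -/
theorem exists_sq_eq (n : ℤ) : ∃ m, n ^ 2 = n + 2 * m := by
  obtain ⟨m, hm⟩ := Int.even_mul_pred_self n
  exact ⟨m, by linear_combination hm⟩

theorem exists_odd_mul_sq_eq {q : ℤ} (hq : Odd q) (n : ℤ) : ∃ m, q * n ^ 2 = n + 2 * m := by
  obtain ⟨a, rfl⟩ := hq
  obtain ⟨m, hm⟩ := exists_sq_eq n
  exact ⟨m + a * n ^ 2, by linear_combination hm⟩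

/-- From `2(A² + B²) = (A-B)² + (A+B)²`; the sign of `A + B` drops out on squaring. -/
theorem norm_sub_one_div_four {A B c s₁ c₁ : ℤ} (hc : c = 4 * c₁ + 1) (hA : c = A - B)
    (hs : A + B = 4 * s₁ + 1 ∨ A + B = -(4 * s₁ + 1)) :
    (A ^ 2 + B ^ 2 - 1) / 4 = 2 * s₁ ^ 2 + 2 * c₁ ^ 2 + s₁ + c₁ := by
  have h1 : 2 * (A ^ 2 + B ^ 2) = (A - B) ^ 2 + (A + B) ^ 2 := by ring
  have h2 : (A + B) ^ 2 = (4 * s₁ + 1) ^ 2 := by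
    rcases hs with h | h <;> rw [h]
    ring
  rw [h2, ← hA, hc] at h1
  have h3 : A ^ 2 + B ^ 2 - 1 = 4 * (2 * s₁ ^ 2 + 2 * c₁ ^ 2 + s₁ + c₁) := by linarith
  rw [h3, Int.mul_ediv_cancel_left _ (by norm_num)]

-- As `4 ∣ d`, the residue of `x` modulo 4 decides that of `x + d`. The relation `h`, divided by 8
-- as `hrel`, links the parities of the remaining parameters.
set_option maxHeartbeats 800000 in
theorem quotientExponent_of_mod_eight_eq_one {c d x q y A B : ℤ} (t : ℕ) (hc : c % 4 = 1)
    (hq : Odd q) (hx : Odd x) (hd : 4 ∣ d) (hy : 4 ∣ y)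
    (h : c ^ 2 + d ^ 2 = x ^ 2 + q * y ^ 2) (hA : c = A - B) (hB : x + d = A + B) :
    (q % 8 = 1 → 2 * ((c ^ 2 + d ^ 2 - 1) / 8) + quotientExponent c d x q A B t ≡
      2 * ((q - 1) / 8 + d / 4 + y / 4) [ZMOD 4]) ∧
    (q % 8 = 3 → 2 * ((c ^ 2 + d ^ 2 - 1) / 8) + quotientExponent c d x q A B t ≡
      2 * ((q + 5) / 8 + (x - 1) / 2 + y / 4) - 1 [ZMOD 4]) ∧
    (q % 8 = 5 → 2 * ((c ^ 2 + d ^ 2 - 1) / 8) + quotientExponent c d x q A B t ≡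
      2 * ((q - 5) / 8 + d / 4 + (x - 1) / 2 + y / 4) - 1 [ZMOD 4]) ∧
    (q % 8 = 7 → 2 * ((c ^ 2 + d ^ 2 - 1) / 8) + quotientExponent c d x q A B t ≡
      2 * ((q + 1) / 8 + y / 4) [ZMOD 4]) := by
  obtain ⟨d₁, rfl⟩ := hd
  obtain ⟨y₁, rfl⟩ := hy
  obtain ⟨c₁, hc₁⟩ : ∃ c₁, c = 4 * c₁ + 1 := ⟨c / 4, by omega⟩
  have hP : (c ^ 2 + (4 * d₁) ^ 2 - 1) / 4 = 4 * c₁ ^ 2 + 2 * c₁ + 4 * d₁ ^ 2 := by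
    rw [hc₁, show (4 * c₁ + 1) ^ 2 + (4 * d₁) ^ 2 - 1 = 4 * (4 * c₁ ^ 2 + 2 * c₁ + 4 * d₁ ^ 2) by
      ring, Int.mul_ediv_cancel_left _ (by norm_num)]
  have hP2 : (c ^ 2 + (4 * d₁) ^ 2 - 1) / 8 = 2 * c₁ ^ 2 + c₁ + 2 * d₁ ^ 2 := by
    rw [hc₁, show (4 * c₁ + 1) ^ 2 + (4 * d₁) ^ 2 - 1 = 8 * (2 * c₁ ^ 2 + c₁ + 2 * d₁ ^ 2) by
      ring, Int.mul_ediv_cancel_left _ (by norm_num)]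
  have hcd : signedOdd (c + 4 * d₁) = c + 4 * d₁ := signedOdd_of_mod_one (by omega)
  obtain ⟨C, hC⟩ := exists_sq_eq c₁
  obtain ⟨D, hD⟩ := exists_sq_eq d₁
  obtain ⟨Z, hZ⟩ := exists_odd_mul_sq_eq hq y₁
  rw [Int.odd_iff] at hx hq
  have hx4 : x % 4 = 1 ∨ x % 4 = 3 := by omega
  rcases hx4 with hx4 | hx4
  · obtain ⟨x₁, hx₁⟩ : ∃ x₁, x = 4 * x₁ + 1 := ⟨x / 4, by omega⟩
    obtain ⟨X, hX⟩ := exists_sq_eq x₁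
    obtain ⟨S, hS⟩ := exists_sq_eq (x₁ + d₁)
    have hM := norm_sub_one_div_four (s₁ := x₁ + d₁) hc₁ hA (Or.inl (by rw [← hB, hx₁]; ring))
    have hrel : 2 * c₁ ^ 2 + c₁ + 2 * d₁ ^ 2 = 2 * x₁ ^ 2 + x₁ + 2 * (q * y₁ ^ 2) := by
      rw [hc₁, hx₁] at h
      refine mul_left_cancel₀ (show (8 : ℤ) ≠ 0 by norm_num) ?_
      linear_combination h
    obtain ⟨w, hw⟩ := quotientExponent_of_one (q := q) t hc hA hB (by clear hP hP2 h hM hrel; omega)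
    -- This is the coefficient of `t`: by `hrel`, `c₁` and `x₁` have the same parity, so it vanishes
    -- modulo 4 and the exponent does not depend on `t`.
    obtain ⟨v, hv⟩ : (4 : ℤ) ∣ 2 * ((A ^ 2 + B ^ 2 - 1) / 4) +
        2 * ((signedOdd (c + 4 * d₁) - 1) / 4) - (c ^ 2 + (4 * d₁) ^ 2 - 1) / 4 := by
      rw [hM, hP, hcd]
      clear hP hP2 h hM hw hZ hcd
      omega
    rw [hv, hM, hP, mul_assoc 4 v] at hw
    generalize v * (t : ℤ) = u at hw
    have ex : (x - 1) / 4 = x₁ := by clear hP hP2 h hM hw hrel; omega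
    have es : (x + 4 * d₁ - 1) / 4 = x₁ + d₁ := by clear hP hP2 h hM hw hrel; omega
    have ec : (c - 1) / 4 = c₁ := by clear hP hP2 h hM hw hrel; omega
    have hx2 : (x - 1) / 2 = 2 * x₁ := by clear hP hP2 h hM hw hrel; omega
    rw [hC, hD, hX, hZ] at hrel
    rw [hC, hS, hD, signedOdd_of_mod_one hx4, if_pos hx4, ex, es] at hw
    rw [hC, hD] at hP2
    clear h hA hB hM hP hcd hC hD hX hZ hS hv hc hc₁ ex es ec
    refine ⟨fun hq8 => ?_, fun hq8 => ?_, fun hq8 => ?_, fun hq8 => ?_⟩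
    · obtain ⟨q₁, hq₁⟩ : ∃ q₁, q = 8 * q₁ + 1 := ⟨q / 8, by clear hw hrel hP2; omega⟩
      have e1 : (q - 1) / 4 = 2 * q₁ := by clear hw hrel hP2; omega
      have e2 : (q - 1) / 8 = q₁ := by clear hw hrel hP2; omega
      rw [Int.ModEq, hP2, hw, signedOdd_of_mod_one (m := q) (by omega),
        if_pos (show q % 4 = 1 by omega), e1, e2]
      clear e1 e2 hP2 hw hx2 hx4 hq hx
      omega
    · obtain ⟨q₁, hq₁⟩ : ∃ q₁, q = 8 * q₁ + 3 := ⟨q / 8, by clear hw hrel hP2; omega⟩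
      have e1 : (-q - 1) / 4 = -2 * q₁ - 1 := by clear hw hrel hP2; omega
      have e2 : (q + 5) / 8 = q₁ + 1 := by clear hw hrel hP2; omega
      rw [Int.ModEq, hP2, hw, signedOdd_of_mod_three (m := q) (by omega),
        if_neg (show ¬ q % 4 = 1 by omega), e1, e2, hx2]
      clear e1 e2 hP2 hw hx2 hx4 hq hx
      omega
    · obtain ⟨q₁, hq₁⟩ : ∃ q₁, q = 8 * q₁ + 5 := ⟨q / 8, by clear hw hrel hP2; omega⟩
      have e1 : (q - 1) / 4 = 2 * q₁ + 1 := by clear hw hrel hP2; omega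
      have e2 : (q - 5) / 8 = q₁ := by clear hw hrel hP2; omega
      rw [Int.ModEq, hP2, hw, signedOdd_of_mod_one (m := q) (by omega),
        if_pos (show q % 4 = 1 by omega), e1, e2, hx2]
      clear e1 e2 hP2 hw hx2 hx4 hq hx
      omega
    · obtain ⟨q₁, hq₁⟩ : ∃ q₁, q = 8 * q₁ + 7 := ⟨q / 8, by clear hw hrel hP2; omega⟩
      have e1 : (-q - 1) / 4 = -2 * q₁ - 2 := by clear hw hrel hP2; omega
      have e2 : (q + 1) / 8 = q₁ + 1 := by clear hw hrel hP2; omega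
      rw [Int.ModEq, hP2, hw, signedOdd_of_mod_three (m := q) (by omega),
        if_neg (show ¬ q % 4 = 1 by omega), e1, e2]
      clear e1 e2 hP2 hw hx2 hx4 hq hx
      omega
  · obtain ⟨x₁, hx₁⟩ : ∃ x₁, x = -(4 * x₁ + 1) := ⟨-(x + 1) / 4, by omega⟩
    obtain ⟨X, hX⟩ := exists_sq_eq x₁
    obtain ⟨S, hS⟩ := exists_sq_eq (x₁ - d₁)
    have hM := norm_sub_one_div_four (s₁ := x₁ - d₁) hc₁ hA (Or.inr (by rw [← hB, hx₁]; ring))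
    have hrel : 2 * c₁ ^ 2 + c₁ + 2 * d₁ ^ 2 = 2 * x₁ ^ 2 + x₁ + 2 * (q * y₁ ^ 2) := by
      rw [hc₁, hx₁] at h
      refine mul_left_cancel₀ (show (8 : ℤ) ≠ 0 by norm_num) ?_
      linear_combination h
    obtain ⟨w, hw⟩ := quotientExponent_of_three (q := q) t hc hA hB (by clear hP hP2 h hM hrel; omega)
    obtain ⟨v, hv⟩ : (4 : ℤ) ∣ 2 * ((A ^ 2 + B ^ 2 - 1) / 4) +
        2 * ((signedOdd (c + 4 * d₁) - 1) / 4) - (c ^ 2 + (4 * d₁) ^ 2 - 1) / 4 := by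
      rw [hM, hP, hcd]
      clear hP hP2 h hM hw hZ hcd
      omega
    rw [hv, hM, hP, mul_assoc 4 v] at hw
    generalize v * (t : ℤ) = u at hw
    have ex : (-x - 1) / 4 = x₁ := by clear hP hP2 h hM hw hrel; omega
    have es : (-(x + 4 * d₁) - 1) / 4 = x₁ - d₁ := by clear hP hP2 h hM hw hrel; omega
    have ec : (c - 1) / 4 = c₁ := by clear hP hP2 h hM hw hrel; omega
    have hx2 : (x - 1) / 2 = -2 * x₁ - 1 := by clear hP hP2 h hM hw hrel; omega
    rw [hC, hD, hX, hZ] at hrel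
    rw [hC, hS, hD, signedOdd_of_mod_three hx4, if_neg (show ¬ x % 4 = 1 by omega), ex, es, ec] at hw
    rw [hC, hD] at hP2
    clear h hA hB hM hP hcd hC hD hX hZ hS hv hc hc₁ ex es ec
    refine ⟨fun hq8 => ?_, fun hq8 => ?_, fun hq8 => ?_, fun hq8 => ?_⟩
    · obtain ⟨q₁, hq₁⟩ : ∃ q₁, q = 8 * q₁ + 1 := ⟨q / 8, by clear hw hrel hP2; omega⟩
      have e1 : (q - 1) / 4 = 2 * q₁ := by clear hw hrel hP2; omega
      have e2 : (q - 1) / 8 = q₁ := by clear hw hrel hP2; omega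
      rw [Int.ModEq, hP2, hw, signedOdd_of_mod_one (m := q) (by omega),
        if_pos (show q % 4 = 1 by omega), e1, e2]
      clear e1 e2 hP2 hw hx2 hx4 hq hx
      omega
    · obtain ⟨q₁, hq₁⟩ : ∃ q₁, q = 8 * q₁ + 3 := ⟨q / 8, by clear hw hrel hP2; omega⟩
      have e1 : (-q - 1) / 4 = -2 * q₁ - 1 := by clear hw hrel hP2; omega
      have e2 : (q + 5) / 8 = q₁ + 1 := by clear hw hrel hP2; omega
      rw [Int.ModEq, hP2, hw, signedOdd_of_mod_three (m := q) (by omega),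
        if_neg (show ¬ q % 4 = 1 by omega), e1, e2, hx2]
      clear e1 e2 hP2 hw hx2 hx4 hq hx
      omega
    · obtain ⟨q₁, hq₁⟩ : ∃ q₁, q = 8 * q₁ + 5 := ⟨q / 8, by clear hw hrel hP2; omega⟩
      have e1 : (q - 1) / 4 = 2 * q₁ + 1 := by clear hw hrel hP2; omega
      have e2 : (q - 5) / 8 = q₁ := by clear hw hrel hP2; omega
      rw [Int.ModEq, hP2, hw, signedOdd_of_mod_one (m := q) (by omega),
        if_pos (show q % 4 = 1 by omega), e1, e2, hx2]
      clear e1 e2 hP2 hw hx2 hx4 hq hx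
      omega
    · obtain ⟨q₁, hq₁⟩ : ∃ q₁, q = 8 * q₁ + 7 := ⟨q / 8, by clear hw hrel hP2; omega⟩
      have e1 : (-q - 1) / 4 = -2 * q₁ - 2 := by clear hw hrel hP2; omega
      have e2 : (q + 1) / 8 = q₁ + 1 := by clear hw hrel hP2; omega
      rw [Int.ModEq, hP2, hw, signedOdd_of_mod_three (m := q) (by omega),
        if_neg (show ¬ q % 4 = 1 by omega), e1, e2]
      clear e1 e2 hP2 hw hx2 hx4 hq hx
      omega

-- Now `c + d ≡ 3 (mod 4)`, and `x + d` is 3 or 1 modulo 4 according as `x` is 1 or 3. Writing `qy²`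
-- as `4(q + 8Z)` keeps the relation linear in `q`.
set_option maxHeartbeats 800000 in
theorem quotientExponent_of_mod_eight_eq_five {c d x q y A B : ℤ} (hc : c % 4 = 1)
    (hq : Odd q) (hx : Odd x) (hd : d % 8 = 2) (hy : y % 8 = 2)
    (h : c ^ 2 + d ^ 2 = x ^ 2 + q * y ^ 2) (hA : c = A - B) (hB : x + d = A + B) :
    (q % 8 = 1 → 2 * ((c ^ 2 + d ^ 2 - 5) / 8) + quotientExponent c d x q A B 1 ≡
      2 * ((q - 1) / 8 + (x - 1) / 2) - 1 [ZMOD 4]) ∧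
    (q % 8 = 3 → 2 * ((c ^ 2 + d ^ 2 - 5) / 8) + quotientExponent c d x q A B 1 ≡
      2 * ((q + 5) / 8) - 1 [ZMOD 4]) ∧
    (q % 8 = 5 → 2 * ((c ^ 2 + d ^ 2 - 5) / 8) + quotientExponent c d x q A B 1 ≡
      2 * ((q + 3) / 8) [ZMOD 4]) ∧
    (q % 8 = 7 → 2 * ((c ^ 2 + d ^ 2 - 5) / 8) + quotientExponent c d x q A B 1 ≡
      2 * ((q + 1) / 8 + (x - 1) / 2) [ZMOD 4]) := by
  obtain ⟨d₁, rfl⟩ : ∃ d₁, d = 8 * d₁ + 2 := ⟨d / 8, by omega⟩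
  obtain ⟨y₁, rfl⟩ : ∃ y₁, y = 8 * y₁ + 2 := ⟨y / 8, by omega⟩
  obtain ⟨c₁, hc₁⟩ : ∃ c₁, c = 4 * c₁ + 1 := ⟨c / 4, by omega⟩
  have hP : (c ^ 2 + (8 * d₁ + 2) ^ 2 - 1) / 4 =
      4 * c₁ ^ 2 + 2 * c₁ + 16 * d₁ ^ 2 + 8 * d₁ + 1 := by
    rw [hc₁, show (4 * c₁ + 1) ^ 2 + (8 * d₁ + 2) ^ 2 - 1 =
      4 * (4 * c₁ ^ 2 + 2 * c₁ + 16 * d₁ ^ 2 + 8 * d₁ + 1) by ring,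
      Int.mul_ediv_cancel_left _ (by norm_num)]
  have hP2 : (c ^ 2 + (8 * d₁ + 2) ^ 2 - 5) / 8 =
      2 * c₁ ^ 2 + c₁ + 8 * d₁ ^ 2 + 4 * d₁ := by
    rw [hc₁, show (4 * c₁ + 1) ^ 2 + (8 * d₁ + 2) ^ 2 - 5 =
      8 * (2 * c₁ ^ 2 + c₁ + 8 * d₁ ^ 2 + 4 * d₁) by ring,
      Int.mul_ediv_cancel_left _ (by norm_num)]
  have hcd : signedOdd (c + (8 * d₁ + 2)) = -(c + (8 * d₁ + 2)) :=
    signedOdd_of_mod_three (by omega)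
  obtain ⟨C, hC⟩ := exists_sq_eq c₁
  have hrel0 : q * (8 * y₁ + 2) ^ 2 = 4 * (q + 8 * (q * (2 * y₁ ^ 2 + y₁))) := by ring
  rw [hrel0] at h
  generalize q * (2 * y₁ ^ 2 + y₁) = Z at h
  rw [Int.odd_iff] at hx hq
  have hx4 : x % 4 = 1 ∨ x % 4 = 3 := by omega
  rcases hx4 with hx4 | hx4
  · obtain ⟨x₁, hx₁⟩ : ∃ x₁, x = 4 * x₁ + 1 := ⟨x / 4, by omega⟩
    obtain ⟨X, hX⟩ := exists_sq_eq x₁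
    obtain ⟨S, hS⟩ := exists_sq_eq (-x₁ - 2 * d₁ - 1)
    have hM := norm_sub_one_div_four (s₁ := -x₁ - 2 * d₁ - 1) hc₁ hA (Or.inr (by rw [← hB, hx₁]; ring))
    have hrel : 4 * c₁ ^ 2 + 2 * c₁ + 16 * d₁ ^ 2 + 8 * d₁ + 1 =
        4 * x₁ ^ 2 + 2 * x₁ + q + 8 * Z := by
      rw [hc₁, hx₁] at h
      refine mul_left_cancel₀ (show (4 : ℤ) ≠ 0 by norm_num) ?_
      linear_combination h
    obtain ⟨w, hw⟩ := quotientExponent_of_three (q := q) 1 hc hA hB (by clear hP hP2 h hM hrel; omega)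
    rw [hM, hP, hcd, Nat.cast_one, mul_one] at hw
    have ex : (x - 1) / 4 = x₁ := by clear hP hP2 h hM hw hrel; omega
    have es : (-(x + (8 * d₁ + 2)) - 1) / 4 = -x₁ - 2 * d₁ - 1 := by clear hP hP2 h hM hw hrel; omega
    have ec : (c - 1) / 4 = c₁ := by clear hP hP2 h hM hw hrel; omega
    have hx2 : (x - 1) / 2 = 2 * x₁ := by clear hP hP2 h hM hw hrel; omega
    have ecd : (-(c + (8 * d₁ + 2)) - 1) / 4 = -c₁ - 2 * d₁ - 1 := by clear hP hP2 h hM hw hrel; omega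
    rw [hC, hX] at hrel
    rw [hC, hS, signedOdd_of_mod_one hx4, if_pos hx4, ex, es, ecd, ec] at hw
    rw [hC] at hP2
    clear h hA hB hM hP hcd hC hX hS hc hc₁ ex es ec ecd hd hy hrel0
    refine ⟨fun hq8 => ?_, fun hq8 => ?_, fun hq8 => ?_, fun hq8 => ?_⟩
    · obtain ⟨q₁, hq₁⟩ : ∃ q₁, q = 8 * q₁ + 1 := ⟨q / 8, by clear hw hrel hP2; omega⟩
      have e1 : (q - 1) / 4 = 2 * q₁ := by clear hw hrel hP2; omega
      have e2 : (q - 1) / 8 = q₁ := by clear hw hrel hP2; omega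
      rw [Int.ModEq, hP2, hw, signedOdd_of_mod_one (m := q) (by omega),
        if_pos (show q % 4 = 1 by omega), e1, e2, hx2]
      clear e1 e2 hP2 hw hx2 hx4 hq hx
      omega
    · obtain ⟨q₁, hq₁⟩ : ∃ q₁, q = 8 * q₁ + 3 := ⟨q / 8, by clear hw hrel hP2; omega⟩
      have e1 : (-q - 1) / 4 = -2 * q₁ - 1 := by clear hw hrel hP2; omega
      have e2 : (q + 5) / 8 = q₁ + 1 := by clear hw hrel hP2; omega
      rw [Int.ModEq, hP2, hw, signedOdd_of_mod_three (m := q) (by omega),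
        if_neg (show ¬ q % 4 = 1 by omega), e1, e2]
      clear e1 e2 hP2 hw hx2 hx4 hq hx
      omega
    · obtain ⟨q₁, hq₁⟩ : ∃ q₁, q = 8 * q₁ + 5 := ⟨q / 8, by clear hw hrel hP2; omega⟩
      have e1 : (q - 1) / 4 = 2 * q₁ + 1 := by clear hw hrel hP2; omega
      have e2 : (q + 3) / 8 = q₁ + 1 := by clear hw hrel hP2; omega
      rw [Int.ModEq, hP2, hw, signedOdd_of_mod_one (m := q) (by omega),
        if_pos (show q % 4 = 1 by omega), e1, e2]
      clear e1 e2 hP2 hw hx2 hx4 hq hx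
      omega
    · obtain ⟨q₁, hq₁⟩ : ∃ q₁, q = 8 * q₁ + 7 := ⟨q / 8, by clear hw hrel hP2; omega⟩
      have e1 : (-q - 1) / 4 = -2 * q₁ - 2 := by clear hw hrel hP2; omega
      have e2 : (q + 1) / 8 = q₁ + 1 := by clear hw hrel hP2; omega
      rw [Int.ModEq, hP2, hw, signedOdd_of_mod_three (m := q) (by omega),
        if_neg (show ¬ q % 4 = 1 by omega), e1, e2, hx2]
      clear e1 e2 hP2 hw hx2 hx4 hq hx
      omega
  · obtain ⟨x₁, hx₁⟩ : ∃ x₁, x = -(4 * x₁ + 1) := ⟨-(x + 1) / 4, by omega⟩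
    obtain ⟨X, hX⟩ := exists_sq_eq x₁
    obtain ⟨S, hS⟩ := exists_sq_eq (-x₁ + 2 * d₁)
    have hM := norm_sub_one_div_four (s₁ := -x₁ + 2 * d₁) hc₁ hA (Or.inl (by rw [← hB, hx₁]; ring))
    have hrel : 4 * c₁ ^ 2 + 2 * c₁ + 16 * d₁ ^ 2 + 8 * d₁ + 1 =
        4 * x₁ ^ 2 + 2 * x₁ + q + 8 * Z := by
      rw [hc₁, hx₁] at h
      refine mul_left_cancel₀ (show (4 : ℤ) ≠ 0 by norm_num) ?_
      linear_combination h
    obtain ⟨w, hw⟩ := quotientExponent_of_one (q := q) 1 hc hA hB (by clear hP hP2 h hM hrel; omega)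
    rw [hM, hP, hcd, Nat.cast_one, mul_one] at hw
    have ex : (-x - 1) / 4 = x₁ := by clear hP hP2 h hM hw hrel; omega
    have es : (x + (8 * d₁ + 2) - 1) / 4 = -x₁ + 2 * d₁ := by clear hP hP2 h hM hw hrel; omega
    have ec : (c - 1) / 4 = c₁ := by clear hP hP2 h hM hw hrel; omega
    have hx2 : (x - 1) / 2 = -2 * x₁ - 1 := by clear hP hP2 h hM hw hrel; omega
    have ecd : (-(c + (8 * d₁ + 2)) - 1) / 4 = -c₁ - 2 * d₁ - 1 := by clear hP hP2 h hM hw hrel; omega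
    rw [hC, hX] at hrel
    rw [hC, hS, signedOdd_of_mod_three hx4, if_neg (show ¬ x % 4 = 1 by omega), ex, es, ecd] at hw
    rw [hC] at hP2
    clear h hA hB hM hP hcd hC hX hS hc hc₁ ex es ec ecd hd hy hrel0
    refine ⟨fun hq8 => ?_, fun hq8 => ?_, fun hq8 => ?_, fun hq8 => ?_⟩
    · obtain ⟨q₁, hq₁⟩ : ∃ q₁, q = 8 * q₁ + 1 := ⟨q / 8, by clear hw hrel hP2; omega⟩
      have e1 : (q - 1) / 4 = 2 * q₁ := by clear hw hrel hP2; omega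
      have e2 : (q - 1) / 8 = q₁ := by clear hw hrel hP2; omega
      rw [Int.ModEq, hP2, hw, signedOdd_of_mod_one (m := q) (by omega),
        if_pos (show q % 4 = 1 by omega), e1, e2, hx2]
      clear e1 e2 hP2 hw hx2 hx4 hq hx
      omega
    · obtain ⟨q₁, hq₁⟩ : ∃ q₁, q = 8 * q₁ + 3 := ⟨q / 8, by clear hw hrel hP2; omega⟩
      have e1 : (-q - 1) / 4 = -2 * q₁ - 1 := by clear hw hrel hP2; omega
      have e2 : (q + 5) / 8 = q₁ + 1 := by clear hw hrel hP2; omega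
      rw [Int.ModEq, hP2, hw, signedOdd_of_mod_three (m := q) (by omega),
        if_neg (show ¬ q % 4 = 1 by omega), e1, e2]
      clear e1 e2 hP2 hw hx2 hx4 hq hx
      omega
    · obtain ⟨q₁, hq₁⟩ : ∃ q₁, q = 8 * q₁ + 5 := ⟨q / 8, by clear hw hrel hP2; omega⟩
      have e1 : (q - 1) / 4 = 2 * q₁ + 1 := by clear hw hrel hP2; omega
      have e2 : (q + 3) / 8 = q₁ + 1 := by clear hw hrel hP2; omega
      rw [Int.ModEq, hP2, hw, signedOdd_of_mod_one (m := q) (by omega),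
        if_pos (show q % 4 = 1 by omega), e1, e2]
      clear e1 e2 hP2 hw hx2 hx4 hq hx
      omega
    · obtain ⟨q₁, hq₁⟩ : ∃ q₁, q = 8 * q₁ + 7 := ⟨q / 8, by clear hw hrel hP2; omega⟩
      have e1 : (-q - 1) / 4 = -2 * q₁ - 2 := by clear hw hrel hP2; omega
      have e2 : (q + 1) / 8 = q₁ + 1 := by clear hw hrel hP2; omega
      rw [Int.ModEq, hP2, hw, signedOdd_of_mod_three (m := q) (by omega),
        if_neg (show ¬ q % 4 = 1 by omega), e1, e2, hx2]
      clear e1 e2 hP2 hw hx2 hx4 hq hx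
      omega

/-! ### From symbols to powers modulo `p`. -/

/-- Passes from `signedOdd x` and `y₀` to `x` and `2^t y₀`; the sign and the power of 2 cost symbols
over `c + di` that are known powers of `i`. -/
theorem jacobiUnit_div_eq {c d x q y₀ A B : ℤ} {t : ℕ} (hq : Odd q) (hx : Odd x)
    (hd : Even d) (hy₀ : y₀ % 4 = 1)
    (h : c ^ 2 + d ^ 2 = x ^ 2 + q * (2 ^ t * y₀) ^ 2)
    (hcd : IsCoprime c d) (hcs : IsCoprime c (x + d)) (hA : c = A - B) (hB : x + d = A + B)
    (hπo : Odd (⟨c, d⟩ : GaussianInt).norm)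
    (hπx : IsCoprime (⟨c, d⟩ : GaussianInt) (x : GaussianInt))
    (hπy : IsCoprime (⟨c, d⟩ : GaussianInt) (y₀ : GaussianInt)) :
    jacobiUnit (x : GaussianInt) ⟨c, d⟩ *
        (jacobiUnit ((2 ^ t * y₀ : ℤ) : GaussianInt) ⟨c, d⟩)⁻¹ =
      jacobiUnit ⟨c, x + d⟩ (q : GaussianInt) * unitI ^ quotientExponent c d x q A B t := by
  have hAB : IsCoprime A B := by
    obtain ⟨u, v, huv⟩ := hcs
    exact ⟨u + v, v - u, by rw [hA, hB] at huv; linear_combination huv⟩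
  have hs : Odd (A + B) := hB ▸ hx.add_even hd
  have hc : Odd c := odd_re_of_even_im hπo hd
  have h2 := isCoprime_two hπo
  have hnorm : (⟨c, d⟩ : GaussianInt).norm = c ^ 2 + d ^ 2 := by
    rw [Zsqrtd.norm_def]
    ring
  have rel := jacobiUnit_relation hq hx hd hy₀ h hcs hA hB hπo hπx hπy
  rw [jacobiUnit_two_mk hs hAB, ← hB, ← hA, ← zpow_mul] at rel
  have e1 := jacobiUnit_intCast_eq hπo hπx.symm
  have e2 : jacobiUnit ((2 ^ t * y₀ : ℤ) : GaussianInt) ⟨c, d⟩ =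
      unitI ^ ((2 * ((signedOdd (c + d) - 1) / 4) - (c ^ 2 + d ^ 2 - 1) / 4) * t) *
        jacobiUnit (y₀ : GaussianInt) ⟨c, d⟩ := by
    push_cast
    rw [jacobiUnit_mul_left hπo h2.pow_left hπy.symm, jacobiUnit_pow_left hπo h2,
      jacobiUnit_two hc hd hcd, zpow_mul, zpow_natCast]
  rw [← eq_mul_inv_iff_mul_eq] at rel
  have e3 : ∀ X Y f g : GaussianIntˣ, X * f * (g * Y)⁻¹ = X * Y⁻¹ * (f * g⁻¹) := by
    intro X Y f g
    rw [mul_inv]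
    simp only [mul_assoc, mul_left_comm, mul_comm]
  rw [e1, e2, hnorm, e3, rel]
  simp only [mul_assoc, ← zpow_neg, ← zpow_add]
  unfold quotientExponent
  congr 2
  ring

theorem toComplex_unitI_zpow (k : ℤ) :
    toComplex ((unitI ^ k : GaussianIntˣ) : GaussianInt) = Complex.I ^ k := by
  have h : Units.map (toComplex : GaussianInt →* ℂ) unitI = Units.mk0 Complex.I Complex.I_ne_zero := by
    ext1
    simp [toComplex_def]
  have h2 := congrArg (fun u : ℂˣ => ((u ^ k : ℂˣ) : ℂ)) h
  simp only [← map_zpow, Units.val_zpow_eq_zpow_val, Units.val_mk0] at h2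
  exact h2

/-- Multiplying by `s`, whose symbol modulo `q` is 1, clears the denominator. The fraction need not
be in lowest terms: its reduced denominator divides `s`. -/
theorem quarticJacobiSymbolRat_eq_jacobiUnit {c s q : ℤ} (hq : Odd q) (hs : s ≠ 0)
    (hsq : IsCoprime s q) (hγ : IsCoprime (⟨c, s⟩ : GaussianInt) (q : GaussianInt)) :
    quarticJacobiSymbolRat ((c : ℚ) / s) 1 q = jacobiUnit ⟨c, s⟩ (q : GaussianInt) := by
  have hqo := odd_norm_intCast hq
  have hden : (((c : ℚ) / s).den : ℤ) ∣ s := by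
    rw [← Rat.divInt_eq_div]
    exact Rat.den_dvd c s
  have hdq : IsCoprime (((c : ℚ) / s).den : ℤ) q := hsq.of_isCoprime_of_dvd_left hden
  have h1 := ratResidue_spec q ((c : ℚ) / s) (by
    have := Int.isCoprime_iff_gcd_eq_one.1 hdq
    rwa [Int.gcd_eq_natAbs_gcd_natAbs, Int.natAbs_natCast] at this)
  have h2 := ratResidue_spec q 1 (by simp)
  have h3 : ((c : ℚ) / s).num * s = c * ((c : ℚ) / s).den := by
    have hs' : (s : ℚ) ≠ 0 := by exact_mod_cast hs
    have h4 := Rat.num_div_den ((c : ℚ) / s)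
    have hd : (((c : ℚ) / s).den : ℚ) ≠ 0 := by exact_mod_cast ((c : ℚ) / s).den_ne_zero
    rw [div_eq_div_iff hd hs'] at h4
    exact_mod_cast h4
  set a := ((c : ℚ) / s)
  have h5 : q ∣ ratResidue q a * s - c := by
    refine hdq.symm.dvd_of_dvd_mul_left (?_ : q ∣ a.den * (ratResidue q a * s - c))
    obtain ⟨w, hw⟩ := h1
    exact ⟨w * s, by linear_combination s * hw + h3⟩
  have h6 : q ∣ ratResidue q 1 * s - s := by
    obtain ⟨w, hw⟩ := h2
    refine ⟨w * s, ?_⟩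
    simp only [Rat.den_one, Rat.num_one, Nat.cast_one] at hw
    linear_combination s * hw
  have h7 : (q : GaussianInt) ∣
      ⟨ratResidue q a, ratResidue q 1⟩ * (s : GaussianInt) - ⟨c, s⟩ := by
    obtain ⟨u, hu⟩ := h5
    obtain ⟨v, hv⟩ := h6
    refine ⟨⟨u, v⟩, ?_⟩
    ext
    · simpa using hu
    · simpa using hv
  have h8 : IsCoprime (⟨ratResidue q a, ratResidue q 1⟩ * (s : GaussianInt)) (q : GaussianInt) := by
    obtain ⟨w, hw⟩ := h7
    rw [sub_eq_iff_eq_add'] at hw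
    rw [hw, IsCoprime.add_mul_left_left_iff]
    exact hγ
  have h9 := jacobiUnit_congr hqo h7
  rw [jacobiUnit_mul_left hqo h8.of_mul_left_left (isCoprime_intCast hsq),
    jacobiUnit_intCast_intCast hq hsq, mul_one] at h9
  have hq' : (⟨q, 0⟩ : GaussianInt) = (q : GaussianInt) := by ext <;> simp
  rw [← h9, coe_jacobiUnit hqo h8.of_mul_left_left, quarticJacobiSymbolRat, hq']

theorem ringHom_unit_zpow {p : ℕ} [Fact p.Prime] (ρ : GaussianInt →+* ZMod p) {j : ZMod p}
    (hj : ρ ⟨0, 1⟩ = j) (k : ℤ) : ρ ((unitI ^ k : GaussianIntˣ) : GaussianInt) = j ^ k := by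
  have hj0 : j ≠ 0 := by
    rw [← hj]
    exact (isUnit_I.map ρ).ne_zero
  have h : Units.map (ρ : GaussianInt →* ZMod p) unitI = Units.mk0 j hj0 := by
    ext1
    exact hj
  have h2 := congrArg (fun u : (ZMod p)ˣ => ((u ^ k : (ZMod p)ˣ) : ZMod p)) h
  simp only [← map_zpow, Units.val_zpow_eq_zpow_val, Units.val_mk0] at h2
  exact h2

/-- As `p ∤ q`, `p` divides both of `x`, `y` or neither, and both would give `p² ∣ p`. With `q = 1`
this also serves for `c` and `d`. -/
theorem not_dvd_of_eq_sq_add {x y q : ℤ} (hpq : ¬ (p : ℤ) ∣ q) (h : (p : ℤ) = x ^ 2 + q * y ^ 2) :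
    ¬ (p : ℤ) ∣ x ∧ ¬ (p : ℤ) ∣ y := by
  have hpp := Nat.prime_iff_prime_int.1 hp.1
  have key : ¬ ((p : ℤ) ∣ x ∧ (p : ℤ) ∣ y) := by
    rintro ⟨⟨a, ha⟩, ⟨b, hb⟩⟩
    have h1 : (p : ℤ) * 1 = p * (p * (a ^ 2 + q * b ^ 2)) := by
      conv_lhs => rw [mul_one, h, ha, hb]
      ring
    exact hpp.not_isUnit (isUnit_of_dvd_one ⟨_, mul_left_cancel₀ hpp.ne_zero h1⟩)
  constructor
  · intro hx
    refine key ⟨hx, ?_⟩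
    have h1 : (p : ℤ) ∣ q * y ^ 2 := by
      have h2 : q * y ^ 2 = p - x ^ 2 := by linear_combination -h
      rw [h2]
      exact dvd_sub dvd_rfl (dvd_pow hx two_ne_zero)
    exact hpp.dvd_of_dvd_pow ((hpp.dvd_or_dvd h1).resolve_left hpq)
  · intro hy
    refine key ⟨?_, hy⟩
    have h1 : (p : ℤ) ∣ x ^ 2 := by
      have h2 : x ^ 2 = p - q * y ^ 2 := by linear_combination -h
      rw [h2]
      exact dvd_sub dvd_rfl ((dvd_pow hy two_ne_zero).mul_left _)
    exact hpp.dvd_of_dvd_pow h1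

/-- The power residue `(x / y) ^ ((p - 1) / 4)` modulo `p = c² + d² = x² + q y²` in terms of the
symbol `((c + (x + d) i) / q)₄ = i ^ k`. -/
theorem div_pow_eq {c d x q y₀ A B k : ℤ} {t : ℕ} (hq : Odd q) (hx : Odd x)
    (hd : Even d) (hy₀ : y₀ % 4 = 1) (hpq : ¬ (p : ℤ) ∣ q)
    (hcd : (p : ℤ) = c ^ 2 + d ^ 2) (hxy : (p : ℤ) = x ^ 2 + q * (2 ^ t * y₀) ^ 2)
    (hcs : IsCoprime c (x + d)) (hA : c = A - B) (hB : x + d = A + B) (hp2 : p % 2 = 1)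
    (hk : jacobiUnit ⟨c, x + d⟩ (q : GaussianInt) = unitI ^ k) :
    ((x : ZMod p) / ((2 ^ t * y₀ : ℤ) : ZMod p)) ^ ((p - 1) / 4) =
      ((d : ZMod p) / (c : ZMod p)) ^ (k + quotientExponent c d x q A B t) := by
  have hn : (⟨c, d⟩ : GaussianInt).norm = p := by
    rw [Zsqrtd.norm_def, hcd]
    ring
  have hπ := prime_of_norm_natPrime hp.1 hn
  have ho : Odd (⟨c, d⟩ : GaussianInt).norm := by
    rw [hn, Int.odd_iff]
    omega
  obtain ⟨ρ, hρ⟩ := exists_ringHom_zmod hπ hn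
  obtain ⟨hpx, hpy⟩ := not_dvd_of_eq_sq_add hpq hxy
  have hint : ∀ n : ℤ, ¬ (p : ℤ) ∣ n → ¬ (⟨c, d⟩ : GaussianInt) ∣ (n : GaussianInt) := by
    intro n hn' h
    rw [← hρ, map_intCast, ZMod.intCast_zmod_eq_zero_iff_dvd] at h
    exact hn' h
  have hcop : ∀ n : ℤ, ¬ (p : ℤ) ∣ n → IsCoprime (⟨c, d⟩ : GaussianInt) (n : GaussianInt) :=
    fun n hn' => (hπ.irreducible.coprime_iff_not_dvd).2 (hint n hn')
  have hpc : (c : ZMod p) ≠ 0 := by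
    rw [Ne, ZMod.intCast_zmod_eq_zero_iff_dvd]
    exact (not_dvd_of_eq_sq_add (q := 1) (fun h => by
      have := Int.le_of_dvd one_pos h
      have := hp.1.two_le
      omega) (by rw [hcd, one_mul])).1
  have hcd' : IsCoprime c d := by
    have hpp := Nat.prime_iff_prime_int.1 hp.1
    rw [Int.isCoprime_iff_gcd_eq_one]
    by_contra hg
    obtain ⟨l, hl, hlg⟩ := Nat.exists_prime_and_dvd hg
    obtain ⟨a, ha⟩ := (Int.natCast_dvd_natCast.2 hlg).trans (Int.gcd_dvd_left c d)
    obtain ⟨b, hb⟩ := (Int.natCast_dvd_natCast.2 hlg).trans (Int.gcd_dvd_right c d)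
    have h1 : (l ^ 2 : ℕ) ∣ p := by
      rw [← Int.natCast_dvd_natCast]
      exact ⟨a ^ 2 + b ^ 2, by rw [hcd, ha, hb]; push_cast; ring⟩
    have h2 := (Nat.prime_dvd_prime_iff_eq hl hp.1).1 ((dvd_pow_self l two_ne_zero).trans h1)
    rw [← h2] at h1
    have h3 := Nat.le_of_dvd hl.pos h1
    nlinarith [hl.two_le]
  -- `i(c + di) = ci - d` vanishes modulo `c + di`.
  have hj : ρ ⟨0, 1⟩ = (d : ZMod p) / c := by
    rw [eq_div_iff hpc]
    have h1 : ρ (⟨0, 1⟩ * c - d) = 0 := by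
      rw [hρ]
      exact ⟨⟨0, 1⟩, by ext <;> simp⟩
    rwa [map_sub, map_mul, map_intCast, map_intCast, sub_eq_zero] at h1
  have hpow : ∀ n : ℤ, ¬ (p : ℤ) ∣ n →
      (n : ZMod p) ^ ((p - 1) / 4) = ρ (jacobiUnit (n : GaussianInt) ⟨c, d⟩) := by
    intro n hn'
    have h1 := (hρ _).2 (dvd_pow_sub_jacobiUnit hπ ho (hint n hn'))
    rwa [map_sub, map_pow, map_intCast, hn, Int.natAbs_natCast, sub_eq_zero] at h1
  have hrel := jacobiUnit_div_eq hq hx hd hy₀ (hcd.symm.trans hxy) hcd' hcs hA hB ho (hcop x hpx)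
    (hcop y₀ (fun h => hpy (h.mul_left _)))
  rw [hk, ← zpow_add, mul_inv_eq_iff_eq_mul] at hrel
  have hy0 : ((2 ^ t * y₀ : ℤ) : ZMod p) ≠ 0 := by
    rwa [Ne, ZMod.intCast_zmod_eq_zero_iff_dvd]
  rw [div_pow, div_eq_iff (pow_ne_zero _ hy0), hpow x hpx, hpow _ hpy, hrel, Units.val_mul,
    map_mul, ringHom_unit_zpow ρ hj]

/-- Since `j² = -1`, both sides are powers of `j`, and `j⁴ = 1`. -/
theorem neg_one_zpow_mul_zpow {j : ZMod p} (hj0 : j ≠ 0) (hj : j ^ 2 = -1) {m : ℕ} {n E k : ℤ}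
    (h : 2 * (m : ℤ) + E ≡ 2 * n + k [ZMOD 4]) :
    (-1) ^ m * j ^ E = (-1) ^ n * j ^ k := by
  have h4 : j ^ (4 : ℤ) = 1 := by
    have : j ^ (4 : ℤ) = (j ^ 2) ^ 2 := by rw [← pow_mul]; norm_cast
    rw [this, hj]
    ring
  obtain ⟨w, hw⟩ := h.symm.dvd
  have h1 : (-1 : ZMod p) ^ m = j ^ (2 * (m : ℤ)) := by
    rw [← hj, zpow_mul, zpow_natCast]
    norm_cast
  have h2 : (-1 : ZMod p) ^ n = j ^ (2 * n) := by
    rw [← hj, zpow_mul]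
    norm_cast
  rw [h1, h2, ← zpow_add₀ hj0, ← zpow_add₀ hj0,
    show 2 * (m : ℤ) + E = 4 * w + (2 * n + k) by linear_combination hw, zpow_add₀ hj0, zpow_mul,
    h4, one_zpow, one_mul]

/-- Odd squares are 1 modulo 8, and for `y = 2e` the term `qy²` is 0 or 4 modulo 8 according to the
parity of `e`. -/
theorem four_dvd_iff_of_sq_add {x q y : ℤ} (hx : Odd x) (hq : Odd q) (hy : Even y) :
    4 ∣ y ↔ (x ^ 2 + q * y ^ 2) % 8 = 1 := by
  have h1 := Int.eight_dvd_sq_sub_one_of_odd hx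
  obtain ⟨e, rfl⟩ := hy.two_dvd
  rw [Int.odd_iff] at hq
  rcases Int.even_or_odd' e with ⟨f, rfl | rfl⟩
  · have h2 : q * (2 * (2 * f)) ^ 2 = 8 * (2 * q * f ^ 2) := by ring
    rw [h2]
    constructor
    · intro _
      omega
    · exact fun _ => ⟨f, by ring⟩
  · have h2 : q * (2 * (2 * f + 1)) ^ 2 = 4 * q + 8 * (2 * q * (f ^ 2 + f)) := by ring
    rw [h2]
    omega

theorem eq_one_of_two_pow_mul {r : ℕ} {n m : ℤ} (h : n = 2 ^ r * m) (hm : Odd m) (h2 : Even n)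
    (h4 : ¬ 4 ∣ n) : r = 1 := by
  rcases r with _ | _ | r
  · rw [h, pow_zero, one_mul] at h2
    exact absurd h2 (Int.not_even_iff_odd.2 hm)
  · rfl
  · exact absurd ⟨2 ^ r * m, by rw [h]; ring⟩ h4

end GaussianInt

/-! ### The theorem. -/

open GaussianInt in
theorem theorem3p2 (p : ℕ) [Fact p.Prime] (hp : p % 4 = 1)
    (q : ℤ) (hq : Odd q) (hpq : ¬ (p : ℤ) ∣ q)
    (c d x y : ℤ) (hcd : (p : ℤ) = c ^ 2 + d ^ 2) (hxy : (p : ℤ) = x ^ 2 + q * y ^ 2)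
    (hc : c ≡ 1 [ZMOD 4])
    (r t : ℕ) (d₀ y₀ : ℤ) (hd : d = 2 ^ r * d₀) (hy : y = 2 ^ t * y₀)
    (hd₀ : d₀ ≡ 1 [ZMOD 4]) (hy₀ : y₀ ≡ 1 [ZMOD 4])
    (hcop : IsCoprime c (x + d)) (hx : Odd x)
    (k : ℤ)
    (hk : GaussianInt.toComplex (quarticJacobiSymbolRat ((c : ℚ) / ((x : ℚ) + (d : ℚ))) 1 q)
      = Complex.I ^ k) :
    (p % 8 = 1 →
      (q ≡ 1 [ZMOD 8] →
        (q : ZMod p) ^ ((p - 1) / 8) =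
          (-1) ^ ((q - 1) / 8 + d / 4 + y / 4) * ((d : ZMod p) / (c : ZMod p)) ^ k) ∧
      (q ≡ 3 [ZMOD 8] →
        (q : ZMod p) ^ ((p - 1) / 8) =
          (-1) ^ ((q + 5) / 8 + (x - 1) / 2 + y / 4)
            * ((d : ZMod p) / (c : ZMod p)) ^ (k - 1)) ∧
      (q ≡ 5 [ZMOD 8] →
        (q : ZMod p) ^ ((p - 1) / 8) =
          (-1) ^ ((q - 5) / 8 + d / 4 + (x - 1) / 2 + y / 4)
            * ((d : ZMod p) / (c : ZMod p)) ^ (k - 1)) ∧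
      (q ≡ 7 [ZMOD 8] →
        (q : ZMod p) ^ ((p - 1) / 8) =
          (-1) ^ ((q + 1) / 8 + y / 4) * ((d : ZMod p) / (c : ZMod p)) ^ k)) ∧
    (p % 8 = 5 →
      (q ≡ 1 [ZMOD 8] →
        (q : ZMod p) ^ ((p - 5) / 8) =
          (-1) ^ ((q - 1) / 8 + (x - 1) / 2)
            * ((d : ZMod p) / (c : ZMod p)) ^ (k - 1) * ((y : ZMod p) / (x : ZMod p))) ∧
      (q ≡ 3 [ZMOD 8] →
        (q : ZMod p) ^ ((p - 5) / 8) =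
          (-1) ^ ((q + 5) / 8)
            * ((d : ZMod p) / (c : ZMod p)) ^ (k - 1) * ((y : ZMod p) / (x : ZMod p))) ∧
      (q ≡ 5 [ZMOD 8] →
        (q : ZMod p) ^ ((p - 5) / 8) =
          (-1) ^ ((q + 3) / 8)
            * ((d : ZMod p) / (c : ZMod p)) ^ k * ((y : ZMod p) / (x : ZMod p))) ∧
      (q ≡ 7 [ZMOD 8] →
        (q : ZMod p) ^ ((p - 5) / 8) =
          (-1) ^ ((q + 1) / 8 + (x - 1) / 2)
            * ((d : ZMod p) / (c : ZMod p)) ^ k * ((y : ZMod p) / (x : ZMod p)))) := by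
  have hp1 := (Fact.out : p.Prime).one_lt
  have hp0 : Odd (p : ℤ) := by
    rw [Int.odd_iff]
    omega
  have hcm : c % 4 = 1 := hc
  have hy₀m : y₀ % 4 = 1 := hy₀
  have hd₀m : d₀ % 4 = 1 := hd₀
  have hcodd : Odd c := Int.odd_iff.2 (by omega)
  have hdeven : Even d := by
    by_contra hd'
    rw [Int.not_even_iff_odd] at hd'
    rw [hcd] at hp0
    exact (Int.not_even_iff_odd.2 hp0) (hcodd.pow.add_odd hd'.pow)
  have hyeven : Even y := by
    by_contra hy'
    rw [Int.not_even_iff_odd] at hy'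
    rw [hxy] at hp0
    exact (Int.not_even_iff_odd.2 hp0) (hx.pow.add_odd (hq.mul hy'.pow))
  -- `c` and `x + d` are odd, so `1 + i` divides `c + (x+d)i`; the quotient is `A + Bi`.
  obtain ⟨A, hA⟩ : ∃ A, x + d + c = 2 * A := ((hx.add_even hdeven).add_odd hcodd).two_dvd
  obtain ⟨B, hB⟩ : ∃ B, x + d - c = 2 * B := ((hx.add_even hdeven).sub_odd hcodd).two_dvd
  have hA' : c = A - B := by linarith
  have hB' : x + d = A + B := by linarith
  have hs : Odd (x + d) := hx.add_even hdeven
  have hs0 : x + d ≠ 0 := by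
    intro h
    rw [h] at hs
    simp at hs
  have hrel : c ^ 2 + d ^ 2 = x ^ 2 + q * y ^ 2 := hcd.symm.trans hxy
  have hsq : IsCoprime (x + d) q := by
    have h1 : IsCoprime (q * y ^ 2) (x + d) := by
      have h2 : q * y ^ 2 = c ^ 2 + (x + d) * (d - x) := by linear_combination -hrel
      rw [h2, IsCoprime.add_mul_left_left_iff]
      exact hcop.pow_left
    exact h1.of_mul_left_left.symm
  obtain ⟨hpx, hpy⟩ := not_dvd_of_eq_sq_add hpq hxy
  -- The norm of `c + (x+d)i` is `2(x+d)x + qy²`, which is prime to `q`.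
  have hγq : IsCoprime (⟨c, x + d⟩ : GaussianInt) (q : GaussianInt) := by
    have h1 : IsCoprime (p : ℤ) q :=
      ((Nat.prime_iff_prime_int.1 (Fact.out : p.Prime)).irreducible.coprime_iff_not_dvd).2 hpq
    have h2 : IsCoprime x q := by
      rw [hxy, IsCoprime.add_mul_left_left_iff] at h1
      exact (IsCoprime.pow_left_iff two_pos).1 h1
    have h3 : IsCoprime (2 * (x + d) * x + q * y ^ 2) q := by
      rw [IsCoprime.add_mul_left_left_iff]
      exact ((Int.isCoprime_two_left.2 hq).mul_left hsq).mul_left h2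
    have h4 := isCoprime_intCast h3
    have h5 : ((2 * (x + d) * x + q * y ^ 2 : ℤ) : GaussianInt) =
        ⟨c, x + d⟩ * star ⟨c, x + d⟩ := by
      rw [← Zsqrtd.norm_eq_mul_conj, Zsqrtd.norm_def]
      congr 1
      linear_combination -hrel
    rw [h5] at h4
    exact h4.of_mul_left_left
  have hγ : jacobiUnit ⟨c, x + d⟩ (q : GaussianInt) = unitI ^ k := by
    have h1 := quarticJacobiSymbolRat_eq_jacobiUnit hq hs0 hsq hγq
    push_cast at h1
    rw [h1, ← toComplex_unitI_zpow] at hk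
    exact Units.ext (toComplex_injective hk)
  have hxyp : (p : ℤ) = x ^ 2 + q * (2 ^ t * y₀) ^ 2 := by rw [← hy]; exact hxy
  have main := div_pow_eq hq hx hdeven hy₀m hpq hcd hxyp hcop hA' hB' (by omega) hγ
  rw [← hy] at main
  have hx0 : (x : ZMod p) ≠ 0 := by rwa [Ne, ZMod.intCast_zmod_eq_zero_iff_dvd]
  have hy0 : (y : ZMod p) ≠ 0 := by rwa [Ne, ZMod.intCast_zmod_eq_zero_iff_dvd]
  have hnd := not_dvd_of_eq_sq_add (p := p) (q := 1) (x := c) (y := d) (fun h => by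
      have := Int.le_of_dvd one_pos h
      omega) (by rw [hcd, one_mul])
  have hc0 : (c : ZMod p) ≠ 0 := by
    rw [Ne, ZMod.intCast_zmod_eq_zero_iff_dvd]
    exact hnd.1
  have hd0 : (d : ZMod p) ≠ 0 := by
    rw [Ne, ZMod.intCast_zmod_eq_zero_iff_dvd]
    exact hnd.2
  have hj0 : (d : ZMod p) / c ≠ 0 := div_ne_zero hd0 hc0
  have hj : ((d : ZMod p) / c) ^ 2 = -1 := by
    rw [div_pow, div_eq_iff (pow_ne_zero _ hc0)]
    have h1 : ((c ^ 2 + d ^ 2 : ℤ) : ZMod p) = 0 := by rw [← hcd]; simp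
    push_cast at h1
    linear_combination h1
  have hqx : (q : ZMod p) = -1 * ((x : ZMod p) / y) ^ 2 := by
    have h1 : ((x ^ 2 + q * y ^ 2 : ℤ) : ZMod p) = 0 := by rw [← hxy]; simp
    push_cast at h1
    field_simp
    linear_combination h1
  clear hk hγ hγq hsq hpx hpy hcop hs0 hA hB
  constructor
  · intro hp8
    have h4d : (4 : ℤ) ∣ d := by
      rw [four_dvd_iff_of_sq_add hcodd odd_one hdeven, one_mul, ← hcd]
      omega
    have h4y : (4 : ℤ) ∣ y := by
      rw [four_dvd_iff_of_sq_add hx hq hyeven, ← hxy]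
      omega
    obtain ⟨m, hm⟩ : ∃ m, p = 8 * m + 1 := ⟨p / 8, by omega⟩
    have hm1 : (p - 1) / 8 = m := by omega
    have hm2 : (p - 1) / 4 = 2 * m := by omega
    have hm3 : (c ^ 2 + d ^ 2 - 1) / 8 = m := by rw [← hcd]; omega
    obtain ⟨E1, E3, E5, E7⟩ :=
      quotientExponent_of_mod_eight_eq_one t hcm hq hx h4d h4y hrel hA' hB'
    rw [hm3] at E1 E3 E5 E7
    rw [hm2, pow_mul] at main
    have hL : (q : ZMod p) ^ m =
        (-1) ^ m * ((d : ZMod p) / c) ^ (k + quotientExponent c d x q A B t) := by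
      rw [hqx, mul_pow, main]
    rw [hm1, hL]
    refine ⟨fun h => ?_, fun h => ?_, fun h => ?_, fun h => ?_⟩ <;>
      refine neg_one_zpow_mul_zpow hj0 hj ?_
    · convert (E1 h).add_right k using 1; ring
    · convert (E3 h).add_right k using 1 <;> ring
    · convert (E5 h).add_right k using 1 <;> ring
    · convert (E7 h).add_right k using 1; ring
  · intro hp8
    -- For `p ≡ 5 (mod 8)` neither `d` nor `y` is divisible by 4, so the normalisation of `d₀` and
    -- `y₀` gives `d ≡ y ≡ 2 (mod 8)`.
    have hd8 : r = 1 := by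
      refine eq_one_of_two_pow_mul hd (Int.odd_iff.2 (by omega)) hdeven ?_
      rw [four_dvd_iff_of_sq_add hcodd odd_one hdeven, one_mul, ← hcd]
      omega
    have hy8 : t = 1 := by
      refine eq_one_of_two_pow_mul hy (Int.odd_iff.2 (by omega)) hyeven ?_
      rw [four_dvd_iff_of_sq_add hx hq hyeven, ← hxy]
      omega
    subst hd8 hy8
    obtain ⟨m, hm⟩ : ∃ m, p = 8 * m + 5 := ⟨p / 8, by omega⟩
    have hm1 : (p - 5) / 8 = m := by omega
    have hm2 : (p - 1) / 4 = 2 * m + 1 := by omega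
    have hm3 : (c ^ 2 + d ^ 2 - 5) / 8 = m := by rw [← hcd]; omega
    obtain ⟨E1, E3, E5, E7⟩ :=
      quotientExponent_of_mod_eight_eq_five hcm hq hx (by omega) (by omega) hrel hA' hB'
    rw [hm3] at E1 E3 E5 E7
    rw [hm2, pow_succ, pow_mul] at main
    -- The exponent `(p-1)/4 = 2m + 1` is odd, so one factor `x/y` more than in `(x/y)^(2m)` occurs;
    -- its inverse is the factor `y/x` of the statement.
    have hL : (q : ZMod p) ^ m =
        (-1) ^ m * ((d : ZMod p) / c) ^ (k + quotientExponent c d x q A B 1) * (y / x) := by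
      rw [hqx, mul_pow, ← main]
      field_simp
    rw [hm1, hL]
    refine ⟨fun h => ?_, fun h => ?_, fun h => ?_, fun h => ?_⟩ <;>
      refine congrArg (· * ((y : ZMod p) / x)) (neg_one_zpow_mul_zpow hj0 hj ?_)
    · convert (E1 h).add_right k using 1 <;> ring
    · convert (E3 h).add_right k using 1 <;> ring
    · convert (E5 h).add_right k using 1; ring
    · convert (E7 h).add_right k using 1; ring
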